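/- **Setting.** Consider an episodic MDP with horizon $H\ge 1$, measurable state space $\mathcal S$ carrying a $\sigma$-finite reference measure $ds$, measurable action space $\mathcal A$, fixed initial state distribution, known reward distributions $\mathbb R_h(\cdot|s,a)$ on $[0,1]$ and unknown transition densities $\mathbb P_{\theta^*_h}(s'|s,a)$, $h\in[H]$. A model class is a product $\boldsymbol\Theta=\Theta_1\times\dots\times\Theta_H$, each $\theta_h\in\Theta_h$ giving a transition density $\mathbb P_{\theta_h}$, and $\boldsymbol\theta^*\in\boldsymbol\Theta$. $\Pi^\dagger$ is the set of randomized policies whose action at step $h$ depends on $(s_h,y_h)$, $y_h=\sum_{i<h}r_i$. $Z^{\boldsymbol\pi}_{\boldsymbol\theta}$ is the cumulative reward of an episode played with $\boldsymbol\pi$ under $\boldsymbol\theta$, $F_Z$ denotes the CDF of $Z$, and $\nu^{\boldsymbol\pi}_{\boldsymbol\theta,h}$ is the law of $(s_h,a_h)$. The risk measure $\rho$ depends only on the law and satisfies $|\rho(Z)-\rho(W)|\le L_\infty\|F_Z-F_W\|_\infty$ for $Z,W\in[0,H]$. For each $\boldsymbol\theta\in\boldsymbol\Theta$ fix $\boldsymbol\pi_{\boldsymbol\theta}\in\arg\max_{\boldsymbol\pi\in\Pi^\dagger}\rho(Z^{\boldsymbol\pi}_{\boldsymbol\theta})$.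 All maximizers below are assumed to exist and to be chosen measurably. *Estimation (M-Est-MLE).* Given a finite family $D$ of trajectories $(s_1,a_1,r_1,\dots,s_H,a_H,r_H,s_{H+1})$, let $\theta^{\rm MLE}_h\in\arg\max_{\theta_h\in\Theta_h}\sum_{\tau\in D}\log\mathbb P_{\theta_h}(s^\tau_{h+1}|s^\tau_h,a^\tau_h)$ for each $h$ (with $\log 0=-\infty$). The confidence set of radius $\beta$ consists of the $\boldsymbol\theta\in\boldsymbol\Theta$ with $$\sum_{\tau\in D}\sum_{h=1}^H\log\mathbb P_{\theta_h}(s^\tau_{h+1}|s^\tau_h,a^\tau_h)\ \ge\ \sum_{\tau\in D}\sum_{h=1}^H\log\mathbb P_{\theta^{\rm MLE}_h}(s^\tau_{h+1}|s^\tau_h,a^\tau_h)-\beta .$$ *Bracketing number.* $\mathcal N_{[\cdot]}(\boldsymbol\Theta,\epsilon,\|\cdot\|_1)$ is the least number of pairs of measurable functions $l\le u$ of $(h,s,a,s')$ with $\sup_{h,s,a}\int|u_h-l_h|(s'|s,a)\,ds'\le\epsilon$ such that each $\boldsymbol\theta\in\boldsymbol\Theta$ satisfies $l\le\mathbb P_{\boldsymbol\theta}\le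 u$ for one of the pairs. *Q-type witness rank.* The $(d,\alpha,B)$ witness rank condition, $\alpha>0$, holds if there are $f_h,g_h:\boldsymbol\Theta\to\mathbb R^d$ such that for all $h$ and $\boldsymbol\theta,\boldsymbol\theta'\in\boldsymbol\Theta$, with $e=\mathbb E_{(s,a)\sim\nu^{\boldsymbol\pi_{\boldsymbol\theta}}_{\boldsymbol\theta^*,h}}[\mathrm{TV}(\mathbb P_{\theta'_h}(s,a),\mathbb P_{\theta^*_h}(s,a))]$, $$\alpha^{-1}\langle f_h(\boldsymbol\theta),g_h(\boldsymbol\theta')\rangle\le e\le\langle f_h(\boldsymbol\theta),g_h(\boldsymbol\theta')\rangle,\qquad \|f_h(\boldsymbol\theta)\|_1\|g_h(\boldsymbol\theta')\|_\infty\le B .$$ **Theorem.** There are universal constants $C,c$ such that the following two statements hold for all $K\ge1$ and $\delta\in(0,1]$. (1) Suppose that $\mathcal N_{[\cdot]}(\boldsymbol\Theta,1/K,\|\cdot\|_1)<\infty$ and let $\beta^{\rm MLE}=H\log\big(eK\mathcal N_{[\cdot]}(\boldsymbol\Theta,1/K,\|\cdot\|_1)/\delta\big)$. In each episode $k=1,\dots,K$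 let $\widehat{\boldsymbol\Theta}_k$ be the confidence set of radius $\beta^{\rm MLE}$ built from the trajectories of episodes $1,\dots,k-1$, choose $\widehat{\boldsymbol\theta}_k\in\widehat{\boldsymbol\Theta}_k$ as a function of these trajectories (in particular, by optimistic planning, maximizing $\rho(Z^{\boldsymbol\pi}_{\boldsymbol\theta})$ over $\boldsymbol\pi\in\Pi^\dagger,\boldsymbol\theta\in\widehat{\boldsymbol\Theta}_k$) and execute $\boldsymbol\pi^k=\boldsymbol\pi_{\widehat{\boldsymbol\theta}_k}$. Then, with probability at least $1-\delta$, $\boldsymbol\theta^*\in\widehat{\boldsymbol\Theta}_k$ for every $k\in[K]$. If moreover the $(d_{\rm wit},\alpha,B)$ witness rank condition holds, then, with probability at least $1-\delta$, $$\sum_{k=1}^K\big\|F_{Z^{\boldsymbol\pi^k}_{\widehat{\boldsymbol\theta}_k}}-F_{Z^{\boldsymbol\pi^k}_{\boldsymbol\theta^*}}\big\|_\infty\ \le\ C\,H^c\,\log^c(e+K+B)\;\alpha\sqrt{K\,d_{\rm wit}\,\beta^{\rm MLE}} .$$ (2) Suppose that $\mathcal A$ is finite with $A$ elements and that $\Theta_h=\Phi_h\times\Psi_h$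 with finite classes of measurable maps $\phi:\mathcal S\times\mathcal A\to\mathbb R^d$, $\psi:\mathcal S\to\mathbb R^d$ and $\mathbb P_{(\phi,\psi)}(s'|s,a)=\langle\phi(s,a),\psi(s')\rangle$, each of these being a transition density, and that $\theta^*_h=(\phi^*_h,\psi^*_h)$ satisfies $\|\phi^*_h(s,a)\|\le1$ and $\|\int\psi^*_h(s)g(s)\,ds\|\le\sqrt d\,\|g\|_\infty$ for all bounded measurable $g$ ($\psi_h^*$ integrable). Let $\beta=\log(|\boldsymbol\Theta|/\delta)$, $|\boldsymbol\Theta|=\prod_h|\Phi_h||\Psi_h|$. In each round $k=1,\dots,K$ let $\widehat{\boldsymbol\Theta}_k$ be the confidence set of radius $\beta$ built from all earlier trajectories, let $(\boldsymbol\pi^k,\widehat{\boldsymbol\theta}_k)$, $\boldsymbol\pi^k=\boldsymbol\pi_{\widehat{\boldsymbol\theta}_k}$, maximize $\rho(Z^{\boldsymbol\pi}_{\boldsymbol\theta})$ over $\boldsymbol\pi\in\Pi^\dagger$, $\boldsymbol\theta\in\widehat{\boldsymbol\Theta}_k$, and collect $H$ trajectories, the $h$-th one by following $\boldsymbol\pi^k$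 in the first $h-1$ steps and taking uniformly random actions from step $h$ on. Then, with probability at least $1-\delta$, $\boldsymbol\theta^*\in\widehat{\boldsymbol\Theta}_k$ for every $k\in[K]$, and, with probability at least $1-2\delta$, for every history-dependent policy $\boldsymbol\pi^*$, $$\sum_{k=1}^K\big(\rho(Z^{\boldsymbol\pi^*}_{\boldsymbol\theta^*})-\rho(Z^{\boldsymbol\pi^k}_{\boldsymbol\theta^*})\big)\ \le\ C\,H^c\,\log^c(e+K)\;L_\infty\,A\sqrt{d\,\beta\,K} .$$ -/

import Mathlib

open MeasureTheory ProbabilityTheory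
open scoped ENNReal NNReal

namespace RSDisRL

noncomputable section

/-! ### Histories, trajectories and policies

Steps are numbered `0, …, H - 1`. A history of length `n` records
`s_0, (a_0, r_0, s_1), …, (a_{n-1}, r_{n-1}, s_n)`. -/

/-- Histories with `n` completed steps: the initial state, and for every completed step the action,
the reward and the next state. -/
abbrev Hist (S A : Type*) (n : ℕ) : Type _ := S × (Fin n → A × ℝ × S)

/-- A full episode of `H` steps, the terminal state included. -/
abbrev Traj (S A : Type*) (H : ℕ) : Type _ := Hist S A H

namespace Hist

variable {S A : Type*} {n : ℕ}

/-- The states `s_0, …, s_n` of a history. -/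
def state (w : Hist S A n) : Fin (n + 1) → S := Fin.cons w.1 (fun i => (w.2 i).2.2)

/-- The current (last) state of a history. -/
def last (w : Hist S A n) : S := w.state (Fin.last n)

/-- The action taken at step `h`. -/
def action (w : Hist S A n) (h : Fin n) : A := (w.2 h).1

/-- The reward received at step `h`. -/
def reward (w : Hist S A n) (h : Fin n) : ℝ := (w.2 h).2.1

/-- The cumulative reward of a history. -/
def totalReward (w : Hist S A n) : ℝ := ∑ h, w.reward h

/-- Append one step `(a, r, s')` to a history. -/
def extend (w : Hist S A n × (A × ℝ × S)) : Hist S A (n + 1) :=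
  (w.1.1, Fin.snoc (α := fun _ => A × ℝ × S) w.1.2 w.2)

variable [MeasurableSpace S] [MeasurableSpace A]

theorem measurable_state (i : Fin (n + 1)) : Measurable (fun w : Hist S A n => w.state i) := by
  refine Fin.cases ?_ (fun j => ?_) i
  · simpa [state] using (measurable_fst : Measurable (fun w : Hist S A n => w.1))
  · simp only [state, Fin.cons_succ]
    fun_prop

theorem measurable_last : Measurable (last : Hist S A n → S) := measurable_state _

theorem measurable_totalReward : Measurable (totalReward : Hist S A n → ℝ) := by
  unfold totalReward reward
  fun_prop

/-- The augmented state `(s, y)` of a history: current state and accumulated reward. -/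
def aug (w : Hist S A n) : S × ℝ := (w.last, w.totalReward)

theorem measurable_aug : Measurable (aug : Hist S A n → S × ℝ) :=
  measurable_last.prodMk measurable_totalReward

end Hist

/-- Randomized history-dependent policies for horizon `H`. -/
structure HistPolicy (S A : Type*) [MeasurableSpace S] [MeasurableSpace A] (H : ℕ) where
  ker : (h : Fin H) → Kernel (Hist S A h) A
  isMarkov : ∀ h, IsMarkovKernel (ker h)

/-- Markov policies of the augmented MDP: at each step the action depends on `(s_h, y_h)`. -/
structure AugPolicy (S A : Type*) [MeasurableSpace S] [MeasurableSpace A] (H : ℕ) where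
  ker : Fin H → Kernel (S × ℝ) A
  isMarkov : ∀ h, IsMarkovKernel (ker h)

section Policies

variable {S A : Type*} [MeasurableSpace S] [MeasurableSpace A] {H : ℕ}

/-- A Markov policy of the augmented MDP as a history-dependent policy of the original MDP. -/
def AugPolicy.toHist (π : AugPolicy S A H) : HistPolicy S A H where
  ker h := (π.ker h).comap Hist.aug Hist.measurable_aug
  isMarkov h := by
    have := π.isMarkov h
    infer_instance

/-- Follow `π` at the steps before `j` and take uniformly random actions from step `j` on. -/
def AugPolicy.explore [Fintype A] [Nonempty A] (π : AugPolicy S A H) (j : Fin H) :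
    AugPolicy S A H where
  ker h := if h < j then π.ker h else Kernel.const _ (PMF.uniformOfFintype A).toMeasure
  isMarkov h := by
    have := π.isMarkov h
    split_ifs <;> infer_instance

end Policies

/-! ### The environment and the laws it induces -/

/-- The known part of an episodic MDP with horizon `H`: the reference measure `ds` on the state space
with respect to which transition densities are taken, the law of the initial state, and the reward
distributions on `[0, 1]`. -/
structure Env (S A : Type*) [MeasurableSpace S] [MeasurableSpace A] (H : ℕ) where
  base : Measure S
  sigmaFinite_base : SigmaFinite base
  init : Measure S
  isProb_init : IsProbabilityMeasure init
  rewardKer : Fin H → Kernel (S × A) ℝ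
  isMarkov_rewardKer : ∀ h, IsMarkovKernel (rewardKer h)
  reward_mem : ∀ h x, rewardKer h x (Set.Icc 0 1)ᶜ = 0

/-- Transition functions `p(s' | s, a)`, written `p s a s'`. -/
abbrev TransFun (S A : Type*) : Type _ := S → A → S → ℝ≥0

/-- `p` is a (jointly measurable) conditional probability density with respect to `m`. -/
def IsTransDensity {S A : Type*} [MeasurableSpace S] [MeasurableSpace A] (m : Measure S)
    (p : TransFun S A) : Prop :=
  Measurable (fun x : (S × A) × S => p x.1.1 x.1.2 x.2) ∧
    ∀ s a, ∫⁻ s', (p s a s' : ℝ≥0∞) ∂m = 1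

namespace Env

variable {S A : Type*} [MeasurableSpace S] [MeasurableSpace A] {H : ℕ} (E : Env S A H)

/-- The transition kernel with density `p`. -/
def transKer (p : TransFun S A) : Kernel (S × A) S :=
  haveI := E.sigmaFinite_base
  Kernel.withDensity (Kernel.const _ E.base) (fun x s' => (p x.1 x.2 s' : ℝ≥0∞))

/-- One step of the interaction: given the history, draw `a ∼ π_h(· | history)`, and then,
independently given `(s, a)`, `r ∼ R_h(· | s, a)` and `s' ∼ p_h(· | s, a)`. -/
def stepKer (p : Fin H → TransFun S A) (π : HistPolicy S A H) (h : Fin H) :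
    Kernel (Hist S A h) (A × ℝ × S) :=
  (π.ker h) ⊗ₖ (((E.rewardKer h) ×ₖ (E.transKer (p h))).comap
    (fun x : Hist S A h × A => (x.1.last, x.2))
    ((Hist.measurable_last.comp measurable_fst).prodMk measurable_snd))

/-- The law of the first `n` steps of an episode played with policy `π` under transitions `p`. -/
def histLaw (p : Fin H → TransFun S A) (π : HistPolicy S A H) :
    (n : ℕ) → n ≤ H → Measure (Hist S A n)
  | 0, _ => E.init.map (fun s => (s, Fin.elim0))
  | n + 1, hn =>
      ((histLaw p π n (Nat.le_of_succ_le hn)) ⊗ₘ (E.stepKer p π ⟨n, hn⟩)).map Hist.extend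

/-- The law of a full episode. -/
def trajLaw (p : Fin H → TransFun S A) (π : HistPolicy S A H) : Measure (Traj S A H) :=
  E.histLaw p π H le_rfl

/-- The law of the cumulative reward of an episode. -/
def returnLaw (p : Fin H → TransFun S A) (π : HistPolicy S A H) : Measure ℝ :=
  (E.trajLaw p π).map Hist.totalReward

/-- The visitation measure: the law of `(s_h, a_h)`. -/
def visit (p : Fin H → TransFun S A) (π : HistPolicy S A H) (h : Fin H) : Measure (S × A) :=
  (E.trajLaw p π).map (fun w => (w.state h.castSucc, w.action h))

/-- Total variation distance between `p(· | s, a)` and `q(· | s, a)`. -/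
def tv (p q : TransFun S A) (s : S) (a : A) : ℝ :=
  (1 / 2) * ∫ s', |(p s a s' : ℝ) - (q s a s' : ℝ)| ∂E.base

end Env

/-! ### Risk measures -/

/-- Supremum distance between the distribution functions of two laws. -/
def cdfDist (μ ν : Measure ℝ) : ℝ := ⨆ x : ℝ, |cdf μ x - cdf ν x|

/-- Lipschitz risk measures. Law invariance is built in: `ρ` is a function of the law.
Lipschitz continuity, with constant `L`, is required for laws on `[0, H]`, where all
cumulative rewards take their values. -/
def IsLipschitzRisk (H : ℕ) (ρ : Measure ℝ → ℝ) (L : ℝ) : Prop :=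
  ∀ μ ν : Measure ℝ, IsProbabilityMeasure μ → IsProbabilityMeasure ν →
    μ (Set.Icc 0 (H : ℝ))ᶜ = 0 → ν (Set.Icc 0 (H : ℝ))ᶜ = 0 →
      |ρ μ - ρ ν| ≤ L * cdfDist μ ν

/-! ### Model classes and bracketing numbers -/

/-- A model class: parameters `ϑ : Par` with their transition functions, and for each step `h` the
set `Θ_h` of admissible parameters, each of which gives a transition density. -/
structure ModelClass {S A : Type*} [MeasurableSpace S] [MeasurableSpace A] {H : ℕ}
    (E : Env S A H) (Par : Type*) where
  dens : Par → TransFun S A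
  carrier : Fin H → Set Par
  isTransDensity : ∀ h, ∀ ϑ ∈ carrier h, IsTransDensity E.base (dens ϑ)

/-- A pair of functions `l ≤ u` of `(h, s, a, s')`. -/
structure Bracket (S A : Type*) [MeasurableSpace S] [MeasurableSpace A] (H : ℕ) where
  lower : Fin H → S → A → S → ℝ
  upper : Fin H → S → A → S → ℝ
  measurable_lower : ∀ h, Measurable (fun x : (S × A) × S => lower h x.1.1 x.1.2 x.2)
  measurable_upper : ∀ h, Measurable (fun x : (S × A) × S => upper h x.1.1 x.1.2 x.2)
  le : ∀ h s a s', lower h s a s' ≤ upper h s a s'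

namespace ModelClass

variable {S A : Type*} [MeasurableSpace S] [MeasurableSpace A] {H : ℕ} {E : Env S A H}
  {Par : Type*} (M : ModelClass E Par)

/-- The set `Θ = Θ_0 × ⋯ × Θ_{H-1}`. -/
def models : Set (Fin H → Par) := {θ | ∀ h, θ h ∈ M.carrier h}

/-- The transition functions of the model `θ`. -/
def trans (θ : Fin H → Par) : Fin H → TransFun S A := fun h => M.dens (θ h)

/-- `Θ` can be covered by `n` brackets `[l, u]` with
`sup_{h, s, a} ∫ |u_h(s' | s, a) - l_h(s' | s, a)| ds' ≤ ε`. -/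
def HasBracketing (ε : ℝ) (n : ℕ) : Prop :=
  ∃ b : Fin n → Bracket S A H,
    (∀ j h s a, ∫⁻ s', ENNReal.ofReal ((b j).upper h s a s' - (b j).lower h s a s') ∂E.base
      ≤ ENNReal.ofReal ε) ∧
    ∀ θ ∈ M.models, ∃ j, ∀ h s a s',
      (b j).lower h s a s' ≤ (M.trans θ h s a s' : ℝ) ∧
        (M.trans θ h s a s' : ℝ) ≤ (b j).upper h s a s'

/-- The `ε`-bracketing number of `Θ` (meaningful if some finite bracketing exists). -/
def bracketingNumber (ε : ℝ) : ℕ := sInf {n | M.HasBracketing ε n}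

/-! ### Maximum likelihood estimation -/

/-- Log-likelihood at step `h` of the parameter `ϑ`, with `log 0 = -∞`. -/
def stepLogLik {ι : Type*} [Fintype ι] (data : ι → Traj S A H) (h : Fin H) (ϑ : Par) : EReal :=
  ∑ i, ENNReal.log
    (M.dens ϑ ((data i).state h.castSucc) ((data i).action h) ((data i).state h.succ) : ℝ≥0∞)

/-- Log-likelihood of the model `θ`. -/
def logLik {ι : Type*} [Fintype ι] (data : ι → Traj S A H) (θ : Fin H → Par) : EReal :=
  ∑ h, M.stepLogLik data h (θ h)

/-- `θ` is a maximum likelihood estimator: a maximizer over `Θ_h` for every step `h`. -/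
def IsMLE {ι : Type*} [Fintype ι] (data : ι → Traj S A H) (θ : Fin H → Par) : Prop :=
  ∀ h, θ h ∈ M.carrier h ∧ ∀ ϑ ∈ M.carrier h, M.stepLogLik data h ϑ ≤ M.stepLogLik data h (θ h)

/-- The confidence set of radius `β` around the maximum likelihood estimator `θmle`. Without data it
is all of `Θ` (for `0 ≤ β`). -/
def confSet {ι : Type*} [Fintype ι] (β : ℝ) (data : ι → Traj S A H) (θmle : Fin H → Par) :
    Set (Fin H → Par) :=
  {θ | θ ∈ M.models ∧ M.logLik data θmle - (β : EReal) ≤ M.logLik data θ}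

/-- `plan θ` is an optimal policy `π_θ` of the augmented MDP with model `θ`, for each `θ ∈ Θ`. -/
def IsOptimalPlan (ρ : Measure ℝ → ℝ) (plan : (Fin H → Par) → AugPolicy S A H) : Prop :=
  ∀ θ ∈ M.models, ∀ π : AugPolicy S A H,
    ρ (E.returnLaw (M.trans θ) π.toHist) ≤ ρ (E.returnLaw (M.trans θ) (plan θ).toHist)

/-- `(plan θ, θ)` maximizes `ρ(Z_{θ'}^π)` over policies `π` and models `θ'` in `conf`. -/
def IsOptimistic (ρ : Measure ℝ → ℝ) (plan : (Fin H → Par) → AugPolicy S A H)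
    (conf : Set (Fin H → Par)) (θ : Fin H → Par) : Prop :=
  θ ∈ conf ∧ ∀ θ' ∈ conf, ∀ π : AugPolicy S A H,
    ρ (E.returnLaw (M.trans θ') π.toHist) ≤ ρ (E.returnLaw (M.trans θ) (plan θ).toHist)

/-- The Q-type `(d, α, B)` witness rank condition. -/
def WitnessRank (θstar : Fin H → Par) (plan : (Fin H → Par) → AugPolicy S A H)
    (d : ℕ) (α B : ℝ) : Prop :=
  ∃ f g : Fin H → (Fin H → Par) → (Fin d → ℝ), ∀ h, ∀ θ ∈ M.models, ∀ θ' ∈ M.models,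
    (∫ x, E.tv (M.trans θ' h) (M.trans θstar h) x.1 x.2
        ∂(E.visit (M.trans θstar) (plan θ).toHist h) ≤ ∑ i, f h θ i * g h θ' i) ∧
    (α⁻¹ * ∑ i, f h θ i * g h θ' i ≤
      ∫ x, E.tv (M.trans θ' h) (M.trans θstar h) x.1 x.2
        ∂(E.visit (M.trans θstar) (plan θ).toHist h)) ∧
    (∑ i, |f h θ i|) * (⨆ i, |g h θ' i|) ≤ B

end ModelClass

/-! ### Adaptive data collection -/

/-- The first `k` observations. -/
def past {Ω D : Type*} {K : ℕ} (X : Fin K → Ω → D) (k : Fin K) (ω : Ω) : Fin k → D :=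
  fun i => X (Fin.castLE k.isLt.le i) ω

/-- `X_0, …, X_{K-1}` are observations such that the conditional law of `X_k` given
`x = (X_0, …, X_{k-1})` is `law k x` (which depends measurably on `x`). -/
def IsAdaptiveSample {Ω D : Type*} [MeasurableSpace Ω] [MeasurableSpace D] {K : ℕ}
    (P : Measure Ω) (X : Fin K → Ω → D) (law : (k : Fin K) → (Fin k → D) → Measure D) : Prop :=
  (∀ k, Measurable (X k)) ∧
  ∀ k : Fin K, ∃ κ : Kernel (Fin k → D) D, IsMarkovKernel κ ∧ (∀ x, κ x = law k x) ∧
    P.map (fun ω => (past X k ω, X k ω)) = (P.map (past X k)) ⊗ₘ κ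

section Runs

variable {S A : Type*} [MeasurableSpace S] [MeasurableSpace A] {H : ℕ} {E : Env S A H}
  {Par : Type*} {K : ℕ} {Ω : Type*} [MeasurableSpace Ω]

/-- `K` episodes played with the maximum likelihood confidence sets in the MDP with true model
`θstar`: from the trajectories `x` of the earlier episodes one computes a maximum likelihood
estimator `mle k x`, picks a model `θhat k x` of the confidence set of radius `β` around it, and
executes its optimal policy `plan (θhat k x)`. Any choice from the confidence set is allowed;
optimistic planning, `M.IsOptimistic ρ plan (M.confSet β x (mle k x)) (θhat k x)`, is one. -/
structure IsMLERun (M : ModelClass E Par) (ρ : Measure ℝ → ℝ) (β : ℝ) (θstar : Fin H → Par)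
    (plan : (Fin H → Par) → AugPolicy S A H)
    (mle θhat : (k : Fin K) → (Fin k → Traj S A H) → Fin H → Par)
    (P : Measure Ω) (X : Fin K → Ω → Traj S A H) : Prop where
  optimalPlan : M.IsOptimalPlan ρ plan
  isMLE : ∀ k x, M.IsMLE x (mle k x)
  mem_confSet : ∀ k x, θhat k x ∈ M.confSet β x (mle k x)
  sample : IsAdaptiveSample P X
    (fun k x => E.trajLaw (M.trans θstar) (plan (θhat k x)).toHist)

/-- The trajectories of `k` rounds of `H` trajectories each, as one family. -/
def flatten {k : ℕ} (x : Fin k → Fin H → Traj S A H) : Fin k × Fin H → Traj S A H :=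
  fun i => x i.1 i.2

/-- A run of the variant for low-rank MDPs: in each of the `K` rounds the model and its policy are
chosen by optimistic planning, and one trajectory is collected with each of the `H` exploratory
policies that follow the chosen policy for the first `j` steps and then act uniformly. -/
structure IsExploratoryMLERun [Fintype A] [Nonempty A] (M : ModelClass E Par)
    (ρ : Measure ℝ → ℝ) (β : ℝ) (θstar : Fin H → Par)
    (plan : (Fin H → Par) → AugPolicy S A H)
    (mle θhat : (k : Fin K) → (Fin k → Fin H → Traj S A H) → Fin H → Par)
    (P : Measure Ω) (X : Fin K → Ω → (Fin H → Traj S A H)) : Prop where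
  optimalPlan : M.IsOptimalPlan ρ plan
  isMLE : ∀ k x, M.IsMLE (flatten x) (mle k x)
  optimistic : ∀ k x, M.IsOptimistic ρ plan (M.confSet β (flatten x) (mle k x)) (θhat k x)
  sample : IsAdaptiveSample P X
    (fun k x => Measure.pi fun j : Fin H =>
      E.trajLaw (M.trans θstar) ((plan (θhat k x)).explore j).toHist)

end Runs

/-! ### Low-rank MDPs -/

/-- Finite embedding classes `Φ_h`, `Ψ_h` whose inner products are transition densities. -/
structure LowRankClass {S A : Type*} [MeasurableSpace S] [MeasurableSpace A] {H : ℕ}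
    (E : Env S A H) (d : ℕ) where
  Phi : Fin H → Finset (S → A → EuclideanSpace ℝ (Fin d))
  Psi : Fin H → Finset (S → EuclideanSpace ℝ (Fin d))
  measurable_phi : ∀ h, ∀ φ ∈ Phi h, Measurable (fun x : S × A => φ x.1 x.2)
  measurable_psi : ∀ h, ∀ ψ ∈ Psi h, Measurable ψ
  nonneg : ∀ h, ∀ φ ∈ Phi h, ∀ ψ ∈ Psi h, ∀ s a s', 0 ≤ inner ℝ (φ s a) (ψ s')
  lintegral_eq_one : ∀ h, ∀ φ ∈ Phi h, ∀ ψ ∈ Psi h, ∀ s a,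
    ∫⁻ s', ENNReal.ofReal (inner ℝ (φ s a) (ψ s')) ∂E.base = 1

namespace LowRankClass

variable {S A : Type*} [MeasurableSpace S] [MeasurableSpace A] {H : ℕ} {E : Env S A H} {d : ℕ}
  (C : LowRankClass E d)

/-- The model class with `p_{(φ, ψ)}(s' | s, a) = ⟨φ(s, a), ψ(s')⟩` and `Θ_h = Φ_h × Ψ_h`. -/
def toModelClass : ModelClass E
    ((S → A → EuclideanSpace ℝ (Fin d)) × (S → EuclideanSpace ℝ (Fin d))) where
  dens ϑ s a s' := Real.toNNReal (inner ℝ (ϑ.1 s a) (ϑ.2 s'))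
  carrier h := {ϑ | ϑ.1 ∈ C.Phi h ∧ ϑ.2 ∈ C.Psi h}
  isTransDensity h ϑ hϑ := by
    refine ⟨?_, fun s a => C.lintegral_eq_one h _ hϑ.1 _ hϑ.2 s a⟩
    have h1 := (C.measurable_phi h _ hϑ.1).comp
      (measurable_fst : Measurable (fun x : (S × A) × S => x.1))
    have h2 := (C.measurable_psi h _ hϑ.2).comp
      (measurable_snd : Measurable (fun x : (S × A) × S => x.2))
    exact (h1.inner h2).real_toNNReal

/-- The number of models, `|Θ| = |Φ| |Ψ|` with `Φ = ∏_h Φ_h` and `Ψ = ∏_h Ψ_h`. -/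
def card : ℕ := (∏ h, (C.Phi h).card) * ∏ h, (C.Psi h).card

/-- The normalization of the true embeddings: `‖φ_h(s, a)‖ ≤ 1` and
`‖∫ g(s) ψ_h(s) ds‖ ≤ √d ‖g‖_∞` for bounded measurable `g`. -/
def IsNormalized (E : Env S A H)
    (θ : Fin H → (S → A → EuclideanSpace ℝ (Fin d)) × (S → EuclideanSpace ℝ (Fin d))) : Prop :=
  ∀ h, (∀ s a, ‖(θ h).1 s a‖ ≤ 1) ∧ Integrable (θ h).2 E.base ∧
    ∀ (g : S → ℝ) (b : ℝ), Measurable g → (∀ s, |g s| ≤ b) →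
      ‖∫ s, g s • (θ h).2 s ∂E.base‖ ≤ √d * b

end LowRankClass

/-- The confidence radius `H log(e K N / δ)`. -/
def betaMLE (H K N : ℕ) (δ : ℝ) : ℝ := H * Real.log (Real.exp 1 * K * N / δ)

end

end RSDisRL

/-! Both statements combine two mechanisms. A likelihood-ratio argument shows that every selected
model predicts well on the data collected so far. A potential argument then shows that models which
fit the past and whose errors are bilinear in policy and model cannot keep erring on the next
episode.

Concentration. Given the past, the ratio of a function with integrals at most `1 + ε` to the true
density has expectation at most `1 + ε` per step. Products of such ratios over episodes, suitably
normalized, are therefore nonnegative supermartingales. Ville's inequality and a union bound over a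
finite family fixed in advance (upper ends of brackets, or all models) control them for all episodes
at once: `IsAdaptiveSample.measure_exists_lt_prod_mul_exp_le`. For the ratio of the maximum
likelihood estimator this puts the true model into every confidence set. For square roots of ratios
the conditional expectation is at most `exp (-(D ^ 2 / 12 - ε / 2))`, where `D` is the expected `L¹`
error under the executed policy (`Env.lintegral_sqrt_ratio_le`). Since a model of the confidence set
has likelihood ratio at least `exp (-β)`, the sum of the past `D ^ 2` is of order `β`, up to a
logarithm of `H` in the low-rank case.

Potential. If the error of model `k` under policy `i` is `⟨f i, g k⟩` up to a factor, a small sum of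
past squares bounds `g k` in the norm of the regularized Gram matrix of the earlier `f i`.
Cauchy–Schwarz and the logarithmic growth of the determinant of this matrix give a total error of
order `√(K d β)` times logarithms: `sum_le_sqrt_of_bilinear` and `sum_le_sqrt_of_bilinear_l1`.

Transfer to returns. The simulation lemma `Env.cdfDist_returnLaw_le` bounds the distance of return
distributions by expected total variation errors along the executed policy in the true model, which
settles the witness rank case. In the low-rank case the errors at step `h` are measured under the
policy that turns uniform at step `h`. They are bilinear because the state at step `h` is drawn from
the previous low-rank transition (`LowRankClass.exists_bilinear_tv`), and returning to the greedy
policy costs a factor `A`. Optimism and the Lipschitz property turn this into regret.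
History-dependent competitors reduce to augmented Markov ones, because drawing actions from their
conditional law given `(s_h, y_h)` preserves the law of the return
(`Env.exists_augPolicy_returnLaw_eq`). -/

open MeasureTheory ProbabilityTheory
open scoped ENNReal NNReal

namespace RSDisRL

/-! ### The elliptical potential lemma -/

section EllipticalPotential

open Matrix

/-- The regularized Gram matrix of the first `n` vectors. -/
noncomputable def gramMatrix {d : ℕ} (v : ℕ → Fin d → ℝ) (n : ℕ) : Matrix (Fin d) (Fin d) ℝ :=
  1 + ∑ i ∈ Finset.range n, vecMulVec (v i) (v i)

variable {d : ℕ} (v : ℕ → Fin d → ℝ)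

theorem gramMatrix_succ (n : ℕ) :
    gramMatrix v (n + 1) = gramMatrix v n + vecMulVec (v n) (v n) := by
  simp [gramMatrix, Finset.sum_range_succ, add_assoc]

theorem posDef_gramMatrix (n : ℕ) : (gramMatrix v n).PosDef := by
  refine Matrix.PosDef.one.add_posSemidef (posSemidef_sum _ fun i _ => ?_)
  simpa using posSemidef_vecMulVec_self_star (v i)

/-- The matrix determinant lemma for a rank-one update. It makes the logarithm of the determinant
telescope into the terms `log (1 + q)` of the potential. -/
theorem det_gramMatrix_succ (n : ℕ) :
    (gramMatrix v (n + 1)).det =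
      (gramMatrix v n).det * (1 + v n ⬝ᵥ ((gramMatrix v n)⁻¹ *ᵥ v n)) := by
  have hu : IsUnit (gramMatrix v n).det :=
    (Matrix.isUnit_iff_isUnit_det _).1 (posDef_gramMatrix v n).isUnit
  have h := det_add_replicateCol_mul_replicateRow (ι := Unit) hu (v n) (v n)
  rw [gramMatrix_succ, vecMulVec_eq Unit, h]
  congr 1
  rw [Matrix.det_unique]
  simp [Matrix.add_apply, Matrix.mul_assoc, Matrix.mul_apply, dotProduct, mulVec]

theorem gramMatrix_inv_form_nonneg (n : ℕ) (w : Fin d → ℝ) :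
    0 ≤ w ⬝ᵥ ((gramMatrix v n)⁻¹ *ᵥ w) := by
  simpa using (posDef_gramMatrix v n).inv.posSemidef.dotProduct_mulVec_nonneg w

theorem gramMatrix_form (n : ℕ) (w : Fin d → ℝ) :
    w ⬝ᵥ (gramMatrix v n *ᵥ w) = w ⬝ᵥ w + ∑ i ∈ Finset.range n, (v i ⬝ᵥ w) ^ 2 := by
  simp only [gramMatrix, add_mulVec, one_mulVec, dotProduct_add, sum_mulVec, dotProduct_sum]
  congr 1
  refine Finset.sum_congr rfl fun i _ => ?_
  rw [vecMulVec_mulVec, dotProduct_smul, dotProduct_comm w]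
  simp [sq]

/-- Cauchy–Schwarz for the norms given by a positive definite matrix and by its inverse. -/
theorem sq_dotProduct_le_of_posDef {M : Matrix (Fin d) (Fin d) ℝ} (hM : M.PosDef)
    (x y : Fin d → ℝ) :
    (x ⬝ᵥ y) ^ 2 ≤ (x ⬝ᵥ (M⁻¹ *ᵥ x)) * (y ⬝ᵥ (M *ᵥ y)) := by
  have hu : IsUnit M.det := (Matrix.isUnit_iff_isUnit_det _).1 hM.isUnit
  have hz : M *ᵥ (M⁻¹ *ᵥ x) = x := by
    rw [mulVec_mulVec, Matrix.mul_nonsing_inv _ hu, one_mulVec]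
  have hsymm : (M⁻¹ *ᵥ x) ⬝ᵥ (M *ᵥ y) = x ⬝ᵥ y := by
    have hT : M.IsSymm := by simpa using hM.isHermitian
    rw [dotProduct_mulVec, ← mulVec_transpose, hT.eq, hz]
  -- The quadratic polynomial in `t` is the form of `M` at `M⁻¹ *ᵥ x - t • y`; its discriminant is
  -- nonpositive.
  have key : ∀ t : ℝ, 0 ≤ (y ⬝ᵥ (M *ᵥ y)) * (t * t) + (-2 * (x ⬝ᵥ y)) * t
      + x ⬝ᵥ (M⁻¹ *ᵥ x) := by
    intro t
    have h := hM.posSemidef.dotProduct_mulVec_nonneg (M⁻¹ *ᵥ x - t • y)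
    simp only [star_trivial, mulVec_sub, mulVec_smul, hz, sub_dotProduct, dotProduct_sub,
      smul_dotProduct, dotProduct_smul, hsymm, smul_eq_mul] at h
    rw [dotProduct_comm y x, dotProduct_comm (M⁻¹ *ᵥ x) x] at h
    linarith
  have := discrim_le_zero key
  rw [discrim] at this
  nlinarith

theorem trace_gramMatrix (n : ℕ) :
    (gramMatrix v n).trace = d + ∑ i ∈ Finset.range n, v i ⬝ᵥ v i := by
  simp [gramMatrix, trace_add, trace_sum, trace_vecMulVec]

/-- AM–GM for the eigenvalues: each eigenvalue `x` satisfies `log x ≤ x / m - 1 + log m`, and the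
eigenvalues sum to the trace. -/
theorem log_det_le_of_posDef {M : Matrix (Fin d) (Fin d) ℝ} (hM : M.PosDef) {m : ℝ} (hm : 0 < m)
    (h : M.trace ≤ d * m) : Real.log M.det ≤ d * Real.log m := by
  rw [hM.isHermitian.det_eq_prod_eigenvalues, Real.log_prod]
  · have h1 : ∀ i, Real.log (hM.isHermitian.eigenvalues i) ≤
        hM.isHermitian.eigenvalues i / m - 1 + Real.log m := by
      intro i
      have hp := hM.eigenvalues_pos i
      have := Real.log_le_sub_one_of_pos (div_pos hp hm)
      rw [Real.log_div hp.ne' hm.ne'] at this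
      linarith
    refine (Finset.sum_le_sum fun i _ => h1 i).trans ?_
    have h2 := hM.isHermitian.trace_eq_sum_eigenvalues
    simp only [RCLike.ofReal_real_eq_id, id] at h2
    simp only [Finset.sum_add_distrib, Finset.sum_sub_distrib, ← Finset.sum_div, ← h2]
    have : M.trace / m ≤ d := by rwa [div_le_iff₀ hm]
    simp
    linarith
  · intro i _
    simpa using (hM.eigenvalues_pos i).ne'

/-- Passes through `log (1 + q) ≥ q / (1 + q)`. The truncation at `1` is what permits a logarithm on
the right. -/
theorem min_one_le_two_mul_log {q : ℝ} (hq : 0 ≤ q) : min 1 q ≤ 2 * Real.log (1 + q) := by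
  have h := Real.one_sub_inv_le_log_of_pos (show 0 < 1 + q by linarith)
  have h2 : 1 - (1 + q)⁻¹ = q / (1 + q) := by field_simp; ring
  rw [h2] at h
  have h3 : min 1 q / 2 ≤ q / (1 + q) := by
    rw [div_le_div_iff₀ (by norm_num) (by linarith)]
    rcases le_total 1 q with h4 | h4
    · rw [min_eq_left h4]; linarith
    · rw [min_eq_right h4]; nlinarith
  linarith

/-- The elliptical potential lemma. -/
theorem sum_min_one_gramMatrix_inv_le {F : ℝ} (n : ℕ) (hF : 0 ≤ F)
    (hv : ∀ i < n, v i ⬝ᵥ v i ≤ d * F) :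
    ∑ i ∈ Finset.range n, min 1 (v i ⬝ᵥ ((gramMatrix v i)⁻¹ *ᵥ v i)) ≤
      2 * (d * Real.log (1 + n * F)) := by
  have hlog : ∀ m, Real.log (gramMatrix v m).det =
      ∑ i ∈ Finset.range m, Real.log (1 + v i ⬝ᵥ ((gramMatrix v i)⁻¹ *ᵥ v i)) := by
    intro m
    induction m with
    | zero => simp [gramMatrix]
    | succ m ih =>
      rw [det_gramMatrix_succ, Finset.sum_range_succ, ← ih, Real.log_mul]
      · exact (posDef_gramMatrix v m).det_pos.ne'
      · have := gramMatrix_inv_form_nonneg v m (v m); linarith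
  have hdet : Real.log (gramMatrix v n).det ≤ d * Real.log (1 + n * F) := by
    refine log_det_le_of_posDef (posDef_gramMatrix v n) (by positivity) ?_
    rw [trace_gramMatrix]
    have : ∑ i ∈ Finset.range n, v i ⬝ᵥ v i ≤ ∑ i ∈ Finset.range n, d * F :=
      Finset.sum_le_sum fun i hi => hv i (Finset.mem_range.1 hi)
    simp only [Finset.sum_const, Finset.card_range, nsmul_eq_mul] at this
    linarith
  rw [hlog] at hdet
  calc _ ≤ ∑ i ∈ Finset.range n, 2 * Real.log (1 + v i ⬝ᵥ ((gramMatrix v i)⁻¹ *ᵥ v i)) :=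
        Finset.sum_le_sum fun i _ => min_one_le_two_mul_log (gramMatrix_inv_form_nonneg v i _)
    _ ≤ _ := by rw [← Finset.mul_sum]; linarith

/-- Sums of bilinear predictions that have been fitted on the past. -/
theorem sum_range_le_sqrt_of_bilinear (f g : ℕ → Fin d → ℝ) (x : ℕ → ℝ) (n : ℕ) {F R : ℝ}
    (hF : 0 ≤ F) (hR : 0 ≤ R) (hf : ∀ k < n, f k ⬝ᵥ f k ≤ F) (hg : ∀ k < n, g k ⬝ᵥ g k ≤ d)
    (hfit : ∀ k < n, ∑ i ∈ Finset.range k, (f i ⬝ᵥ g k) ^ 2 ≤ R)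
    (hx1 : ∀ k < n, x k ≤ 1) (hx : ∀ k < n, x k ≤ f k ⬝ᵥ g k) :
    ∑ k ∈ Finset.range n, x k ≤ √((1 + R) * (n * (2 * (d * Real.log (1 + n * F))))) := by
  rcases Nat.eq_zero_or_pos d with rfl | hd
  · refine (Finset.sum_nonpos fun k hk => ?_).trans (Real.sqrt_nonneg _)
    simpa [dotProduct] using hx k (Finset.mem_range.1 hk)
  have hd' : (0 : ℝ) < d := by exact_mod_cast hd
  -- Scaling by `√d` matches the identity regularizer to `‖g k‖ ^ 2 ≤ d`: the Gram form at `g k` is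
  -- then at most `d * (1 + R)`, the factor `d` cancels below, and no dimension enters the
  -- logarithm.
  set v : ℕ → Fin d → ℝ := fun k => √d • f k with hvdef
  set q : ℕ → ℝ := fun k => v k ⬝ᵥ ((gramMatrix v k)⁻¹ *ᵥ v k) with hq
  have hq0 : ∀ k, 0 ≤ q k := fun k => gramMatrix_inv_form_nonneg v k _
  have hss : √(d : ℝ) * √d = d := Real.mul_self_sqrt hd'.le
  have hvw : ∀ k w, v k ⬝ᵥ w = √d * (f k ⬝ᵥ w) := fun k w => by simp [hvdef]
  have hvv : ∀ i < n, v i ⬝ᵥ v i ≤ d * F := by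
    intro i hi
    have : v i ⬝ᵥ v i = d * (f i ⬝ᵥ f i) := by
      rw [hvw, dotProduct_comm, hvw, ← mul_assoc, hss]
    rw [this]
    exact mul_le_mul_of_nonneg_left (hf i hi) hd'.le
  have hsq : ∀ k < n, (f k ⬝ᵥ g k) ^ 2 ≤ (1 + R) * q k := by
    intro k hk
    have h1 := sq_dotProduct_le_of_posDef (posDef_gramMatrix v k) (v k) (g k)
    rw [gramMatrix_form] at h1
    simp only [hvw, mul_pow, Real.sq_sqrt hd'.le, ← Finset.mul_sum] at h1
    have h2 : g k ⬝ᵥ g k + d * ∑ i ∈ Finset.range k, (f i ⬝ᵥ g k) ^ 2 ≤ d * (1 + R) := by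
      have := mul_le_mul_of_nonneg_left (hfit k hk) hd'.le
      linarith [hg k hk]
    have h3 : d * (f k ⬝ᵥ g k) ^ 2 ≤ d * ((1 + R) * q k) := by
      calc d * (f k ⬝ᵥ g k) ^ 2 ≤ _ := h1
        _ = q k * (g k ⬝ᵥ g k + d * ∑ i ∈ Finset.range k, (f i ⬝ᵥ g k) ^ 2) := by
            simp only [hq, hvw]
        _ ≤ q k * (d * (1 + R)) := mul_le_mul_of_nonneg_left h2 (hq0 k)
        _ = _ := by ring
    exact le_of_mul_le_mul_left h3 hd'
  have hxq : ∀ k < n, x k ≤ √((1 + R) * min 1 (q k)) := by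
    intro k hk
    -- `x k` may be negative, in which case `x k ≤ f k ⬝ᵥ g k` says nothing about squares; its
    -- positive part is bounded instead.
    refine Real.le_sqrt_of_sq_le ?_ |>.trans' (le_max_left (x k) 0)
    rcases le_total (x k) 0 with h0 | h0
    · rw [max_eq_right h0, zero_pow two_ne_zero]
      exact mul_nonneg (by linarith) (le_min zero_le_one (hq0 k))
    · rw [max_eq_left h0, mul_min_of_nonneg _ _ (by linarith)]
      refine le_min ?_ (le_trans ?_ (hsq k hk))
      · nlinarith [hx1 k hk]
      · exact pow_le_pow_left₀ h0 (hx k hk) 2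
  calc ∑ k ∈ Finset.range n, x k ≤ ∑ k ∈ Finset.range n, √((1 + R) * min 1 (q k)) :=
        Finset.sum_le_sum fun k hk => hxq k (Finset.mem_range.1 hk)
    _ ≤ √(n * ∑ k ∈ Finset.range n, (1 + R) * min 1 (q k)) := by
        refine Real.le_sqrt_of_sq_le ?_
        refine (sq_sum_le_card_mul_sum_sq).trans ?_
        rw [Finset.card_range]
        refine mul_le_mul_of_nonneg_left (Finset.sum_le_sum fun k _ => ?_) (by positivity)
        rw [Real.sq_sqrt (mul_nonneg (by linarith) (le_min zero_le_one (hq0 k)))]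
    _ ≤ _ := by
        refine Real.sqrt_le_sqrt ?_
        rw [← Finset.mul_sum]
        have h := mul_le_mul_of_nonneg_left (sum_min_one_gramMatrix_inv_le v n hF hvv)
          (show 0 ≤ (n : ℝ) * (1 + R) by positivity)
        calc _ = n * (1 + R) * ∑ i ∈ Finset.range n, min 1 (q i) := by ring
          _ ≤ _ := h
          _ = _ := by ring

end EllipticalPotential

/-- Sums of bilinear predictions that have been fitted on the past, for finite sequences. -/
theorem sum_le_sqrt_of_bilinear {d K : ℕ} (f g : Fin K → Fin d → ℝ) (x : Fin K → ℝ) {F R : ℝ}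
    (hF : 0 ≤ F) (hR : 0 ≤ R) (hf : ∀ k, ∑ i, f k i ^ 2 ≤ F) (hg : ∀ k, ∑ i, g k i ^ 2 ≤ d)
    (hfit : ∀ k : Fin K, ∑ j : Fin k, (∑ i, f (Fin.castLE k.isLt.le j) i * g k i) ^ 2 ≤ R)
    (hx1 : ∀ k, x k ≤ 1) (hx : ∀ k, x k ≤ ∑ i, f k i * g k i) :
    ∑ k, x k ≤ √((1 + R) * (K * (2 * (d * Real.log (1 + K * F))))) := by
  have h := sum_range_le_sqrt_of_bilinear
    (fun n => if h : n < K then f ⟨n, h⟩ else 0) (fun n => if h : n < K then g ⟨n, h⟩ else 0)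
    (fun n => if h : n < K then x ⟨n, h⟩ else 0) K hF hR
    (fun k hk => by simpa [hk, dotProduct, sq] using hf ⟨k, hk⟩)
    (fun k hk => by simpa [hk, dotProduct, sq] using hg ⟨k, hk⟩)
    (fun k hk => by
      rw [Finset.sum_range]
      refine le_trans (le_of_eq (Finset.sum_congr rfl fun j _ => ?_)) (hfit ⟨k, hk⟩)
      have hj : (j : ℕ) < K := j.isLt.trans hk
      simp [hk, hj, dotProduct, Fin.castLE])
    (fun k hk => by simpa [hk] using hx1 ⟨k, hk⟩)
    (fun k hk => by simpa [hk, dotProduct] using hx ⟨k, hk⟩)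
  rw [Finset.sum_range] at h
  simpa using h

/-- The same bound if only the products `‖f‖₁ ‖g‖_∞` are controlled. -/
theorem sum_le_sqrt_of_bilinear_l1 {d K : ℕ} (f g : Fin K → Fin d → ℝ) (x : Fin K → ℝ)
    {B R : ℝ} (hR : 0 ≤ R) (hfg : ∀ j k, (∑ i, |f j i|) * (⨆ i, |g k i|) ≤ B)
    (hfit : ∀ k : Fin K, ∑ j : Fin k, (∑ i, f (Fin.castLE k.isLt.le j) i * g k i) ^ 2 ≤ R)
    (hx1 : ∀ k, x k ≤ 1) (hx : ∀ k, x k ≤ ∑ i, f k i * g k i) :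
    ∑ k, x k ≤ √((1 + R) * (K * (2 * (d * Real.log (1 + K * B ^ 2))))) := by
  rcases isEmpty_or_nonempty (Fin K) with hK | hK
  · simp
  obtain ⟨k₀, hk₀⟩ := Finite.exists_max (fun k => ⨆ i, |g k i|)
  set G := ⨆ i, |g k₀ i| with hG
  have hgG : ∀ k i, |g k i| ≤ G := fun k i =>
    (le_ciSup (f := fun i => |g k i|) (Set.finite_range _).bddAbove i).trans (hk₀ k)
  have hG0 : 0 ≤ G := Real.iSup_nonneg fun i => abs_nonneg _
  rcases hG0.eq_or_lt with hG0 | hG0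
  · refine (Finset.sum_nonpos fun k _ => (hx k).trans (le_of_eq ?_)).trans (Real.sqrt_nonneg _)
    refine Finset.sum_eq_zero fun i _ => ?_
    have : g k i = 0 := by
      have := hgG k i
      rw [← hG0] at this
      exact abs_nonpos_iff.1 this
    simp [this]
  have hprod : ∀ j k : Fin K, ∑ i, (G * f j i) * (g k i / G) = ∑ i, f j i * g k i := fun j k =>
    Finset.sum_congr rfl fun i _ => by field_simp
  refine sum_le_sqrt_of_bilinear (fun k i => G * f k i) (fun k i => g k i / G) x (sq_nonneg B) hR
    (fun k => ?_) (fun k => ?_) (fun k => ?_) hx1 (fun k => ?_)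
  · have h1 : ∑ i, (G * f k i) ^ 2 ≤ (∑ i, |G * f k i|) ^ 2 := by
      have := Finset.sum_sq_le_sq_sum_of_nonneg (s := Finset.univ) (f := fun i => |G * f k i|)
        (fun i _ => abs_nonneg _)
      simpa only [sq_abs] using this
    refine h1.trans (pow_le_pow_left₀ (Finset.sum_nonneg fun i _ => abs_nonneg _) ?_ 2)
    have := hfg k k₀
    simp only [abs_mul, abs_of_pos hG0, ← Finset.mul_sum]
    linarith
  · calc ∑ i, (g k i / G) ^ 2 ≤ ∑ _i : Fin d, (1 : ℝ) := by
          refine Finset.sum_le_sum fun i _ => ?_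
          rw [sq_le_one_iff_abs_le_one, abs_div, abs_of_pos hG0, div_le_one hG0]
          exact hgG k i
      _ = d := by simp
  · simpa only [hprod] using hfit k
  · simpa only [hprod] using hx k

/-! ### Maximal inequality for adaptively collected data -/

/-- The product of the factors `w 0, …, w (n - 1)`, frozen once it exceeds `T`. -/
noncomputable def stoppedProd (T : ℝ≥0∞) (w : ℕ → ℝ≥0∞) : ℕ → ℝ≥0∞
  | 0 => 1
  | n + 1 => stoppedProd T w n * if T < stoppedProd T w n then 1 else w n

/-- Freezing keeps a crossing of `T` visible at every later time, so Markov's inequality at the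
final time alone controls the whole path. -/
theorem lt_stoppedProd_of_le {T : ℝ≥0∞} {w : ℕ → ℝ≥0∞} {m n : ℕ} (hmn : m ≤ n)
    (h : T < stoppedProd T w m) : T < stoppedProd T w n := by
  induction n, hmn using Nat.le_induction with
  | base => exact h
  | succ n _ ih => simp [stoppedProd, ih]

theorem lt_stoppedProd_or_eq (T : ℝ≥0∞) (w : ℕ → ℝ≥0∞) (n : ℕ) :
    T < stoppedProd T w n ∨ stoppedProd T w n = ∏ i ∈ Finset.range n, w i := by
  induction n with
  | zero => right; simp [stoppedProd]
  | succ n ih =>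
    by_cases h : T < stoppedProd T w n
    · exact Or.inl (lt_stoppedProd_of_le n.le_succ h)
    · right
      rw [stoppedProd, if_neg h, Finset.prod_range_succ, ih.resolve_left h]

theorem lt_stoppedProd_of_lt_prod {T : ℝ≥0∞} {w : ℕ → ℝ≥0∞} {m n : ℕ} (hmn : m ≤ n)
    (h : T < ∏ i ∈ Finset.range m, w i) : T < stoppedProd T w n := by
  refine lt_stoppedProd_of_le hmn ?_
  rcases lt_stoppedProd_or_eq T w m with h1 | h1
  · exact h1
  · rwa [h1]

section Adaptive

variable {Ω D : Type*} [MeasurableSpace Ω] [MeasurableSpace D] {K : ℕ} {P : Measure Ω}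
  {X : Fin K → Ω → D} {law : (k : Fin K) → (Fin k → D) → Measure D}

theorem IsAdaptiveSample.measurable_past (hX : IsAdaptiveSample P X law) (k : Fin K) :
    Measurable (past X k) :=
  measurable_pi_lambda _ fun _ => hX.1 _

/-- Disintegration of the joint law of the past and the next observation. Every conditional
expectation in the concentration argument is taken through this identity, so no filtration is
needed. -/
theorem IsAdaptiveSample.lintegral_pair (hX : IsAdaptiveSample P X law) [IsProbabilityMeasure P]
    (k : Fin K) {G : (Fin k → D) × D → ℝ≥0∞} (hG : Measurable G) :
    ∫⁻ ω, G (past X k ω, X k ω) ∂P = ∫⁻ ω, ∫⁻ y, G (past X k ω, y) ∂(law k (past X k ω)) ∂P := by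
  obtain ⟨κ, hκ, hlaw, hmap⟩ := hX.2 k
  have hpast := hX.measurable_past k
  have : IsProbabilityMeasure (P.map (past X k)) :=
    Measure.isProbabilityMeasure_map hpast.aemeasurable
  rw [← lintegral_map (f := G) hG (hpast.prodMk (hX.1 k)), hmap, Measure.lintegral_compProd hG,
    lintegral_map (f := fun x => ∫⁻ y, G (x, y) ∂κ x) ?_ hpast]
  · simp only [hlaw]
  · exact hG.lintegral_kernel_prod_right'

/-- Ville's inequality for products of factors with conditional expectation at most `1`. -/
theorem IsAdaptiveSample.measure_exists_lt_prod_le (hX : IsAdaptiveSample P X law)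
    [IsProbabilityMeasure P] (W : (k : Fin K) → (Fin k → D) → D → ℝ≥0∞)
    (hW : ∀ k : Fin K, Measurable (fun z : (Fin k → D) × D => W k z.1 z.2))
    (hle : ∀ k x, ∫⁻ y, W k x y ∂(law k x) ≤ 1) {T : ℝ≥0∞} (hT : T ≠ 0) (hT' : T ≠ ∞) :
    P {ω | ∃ k : Fin K, T < ∏ j : Fin k, W (Fin.castLE k.isLt.le j)
      (past X (Fin.castLE k.isLt.le j) ω) (X (Fin.castLE k.isLt.le j) ω)} ≤ T⁻¹ := by
  set w : Ω → ℕ → ℝ≥0∞ := fun ω n =>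
    if h : n < K then W ⟨n, h⟩ (past X ⟨n, h⟩ ω) (X ⟨n, h⟩ ω) else 1 with hw
  -- The induction also carries a measurable `Φ` exhibiting the stopped product as a function of the
  -- first `n` observations, which conditioning on the past requires.
  have key : ∀ n (hn : n ≤ K), (∃ Φ : (Fin n → D) → ℝ≥0∞, Measurable Φ ∧
      ∀ ω, stoppedProd T (w ω) n = Φ (fun j => X (Fin.castLE hn j) ω)) ∧
      ∫⁻ ω, stoppedProd T (w ω) n ∂P ≤ 1 := by
    intro n
    induction n with
    | zero =>
      intro _
      exact ⟨⟨fun _ => 1, measurable_const, fun ω => rfl⟩, by simp [stoppedProd]⟩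
    | succ n ih =>
      intro hn
      obtain ⟨⟨Φ, hΦ, hΦeq⟩, hint⟩ := ih (Nat.le_of_succ_le hn)
      have hn' : n < K := hn
      set G : (Fin n → D) × D → ℝ≥0∞ :=
        fun z => Φ z.1 * if T < Φ z.1 then 1 else W ⟨n, hn'⟩ z.1 z.2 with hG
      have hGm : Measurable G := by
        have h1 : Measurable fun z : (Fin n → D) × D => Φ z.1 := hΦ.comp measurable_fst
        exact h1.mul (Measurable.ite (measurableSet_lt measurable_const h1) measurable_const
          (hW ⟨n, hn'⟩))
      have hGeq : ∀ ω, stoppedProd T (w ω) (n + 1) =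
          G (past X ⟨n, hn'⟩ ω, X ⟨n, hn'⟩ ω) := by
        intro ω
        have : stoppedProd T (w ω) n = Φ (past X ⟨n, hn'⟩ ω) := hΦeq ω
        simp only [stoppedProd, this, hG]
        simp [hw, hn']
      refine ⟨⟨fun x => G (fun j => x j.castSucc, x (Fin.last n)), ?_, hGeq⟩, ?_⟩
      · exact hGm.comp ((measurable_pi_lambda _ fun j => measurable_pi_apply _).prodMk
          (measurable_pi_apply _))
      · simp only [hGeq]
        rw [hX.lintegral_pair ⟨n, hn'⟩ hGm]
        refine le_trans (lintegral_mono fun ω => ?_) hint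
        have : stoppedProd T (w ω) n = Φ (past X ⟨n, hn'⟩ ω) := hΦeq ω
        rw [this]
        obtain ⟨κ, hκ, hlaw, -⟩ := hX.2 ⟨n, hn'⟩
        simp only [hG]
        -- The frozen branch integrates a constant against a probability measure; the other branch
        -- uses the bound on the conditional expectation of the new factor.
        split_ifs with hlt
        · rw [← hlaw]
          simp
        · rw [lintegral_const_mul]
          · exact (mul_le_mul_right (hle _ _) _).trans (mul_one _).le
          · exact (hW ⟨n, hn'⟩).comp measurable_prodMk_left
  obtain ⟨⟨Φ, hΦ, hΦeq⟩, hint⟩ := key K le_rfl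
  have hmeas : Measurable fun ω => stoppedProd T (w ω) K := by
    simp only [hΦeq]
    exact hΦ.comp (measurable_pi_lambda _ fun j => hX.1 _)
  calc _ ≤ P {ω | T ≤ stoppedProd T (w ω) K} := by
        refine measure_mono fun ω => ?_
        rintro ⟨k, hk⟩
        refine (lt_stoppedProd_of_lt_prod k.isLt.le ?_).le
        rw [Finset.prod_range]
        convert hk using 2 with j
        have hj : (j : ℕ) < K := j.isLt.trans k.isLt
        simp only [hw, hj, dif_pos]
        rfl
    _ ≤ (∫⁻ ω, stoppedProd T (w ω) K ∂P) / T :=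
        meas_ge_le_lintegral_div hmeas.aemeasurable hT hT'
    _ ≤ T⁻¹ := by
        rw [ENNReal.div_eq_inv_mul]
        exact (mul_le_mul_right hint _).trans (mul_one _).le

/-- Uniform exponential concentration over a finite family: if `w i` has conditional expectation
at most `exp (-q i k x)`, then the products of the `w i` are controlled by the sums of the `q i`. -/
theorem IsAdaptiveSample.measure_exists_lt_prod_mul_exp_le (hX : IsAdaptiveSample P X law)
    [IsProbabilityMeasure P] {ι : Type*} (I : Finset ι) (w : ι → D → ℝ≥0∞)
    (hw : ∀ i ∈ I, Measurable (w i)) (q : ι → (k : Fin K) → (Fin k → D) → ℝ)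
    (hq : ∀ i ∈ I, ∀ k : Fin K, Measurable (q i k))
    (hle : ∀ i ∈ I, ∀ k x, ∫⁻ y, w i y ∂(law k x) ≤ ENNReal.ofReal (Real.exp (-q i k x)))
    {T : ℝ} (hT : 0 < T) :
    P {ω | ∃ i ∈ I, ∃ k : Fin K, ENNReal.ofReal T <
      (∏ j : Fin k, w i (X (Fin.castLE k.isLt.le j) ω)) * ENNReal.ofReal (Real.exp
        (∑ j : Fin k, q i (Fin.castLE k.isLt.le j) (past X (Fin.castLE k.isLt.le j) ω)))} ≤
      ENNReal.ofReal (I.card / T) := by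
  have hone : ∀ i ∈ I, P {ω | ∃ k : Fin K, ENNReal.ofReal T <
      (∏ j : Fin k, w i (X (Fin.castLE k.isLt.le j) ω)) * ENNReal.ofReal (Real.exp
        (∑ j : Fin k, q i (Fin.castLE k.isLt.le j) (past X (Fin.castLE k.isLt.le j) ω)))} ≤
      ENNReal.ofReal T⁻¹ := by
    intro i hi
    have h := hX.measure_exists_lt_prod_le
      (fun k x y => w i y * ENNReal.ofReal (Real.exp (q i k x)))
      (fun k => ((hw i hi).comp measurable_snd).mul
        ((((hq i hi k).comp measurable_fst).exp).ennreal_ofReal))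
      (fun k x => by
        rw [lintegral_mul_const _ (hw i hi)]
        refine (mul_le_mul_left (hle i hi k x) _).trans ?_
        rw [← ENNReal.ofReal_mul (Real.exp_pos _).le, ← Real.exp_add]
        simp)
      (T := ENNReal.ofReal T) (by simpa using hT) ENNReal.ofReal_ne_top
    rw [ENNReal.ofReal_inv_of_pos hT]
    refine le_trans (measure_mono fun ω => ?_) h
    rintro ⟨k, hk⟩
    refine ⟨k, ?_⟩
    rw [Finset.prod_mul_distrib, ← ENNReal.ofReal_prod_of_nonneg fun _ _ => (Real.exp_pos _).le,
      ← Real.exp_sum]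
    exact hk
  calc _ ≤ P (⋃ i ∈ I, {ω | ∃ k : Fin K, ENNReal.ofReal T <
      (∏ j : Fin k, w i (X (Fin.castLE k.isLt.le j) ω)) * ENNReal.ofReal (Real.exp
        (∑ j : Fin k, q i (Fin.castLE k.isLt.le j) (past X (Fin.castLE k.isLt.le j) ω)))}) := by
        refine measure_mono fun ω => ?_
        rintro ⟨i, hi, hk⟩
        exact Set.mem_biUnion hi hk
    _ ≤ ∑ _i ∈ I, ENNReal.ofReal T⁻¹ :=
        (measure_biUnion_finset_le _ _).trans (Finset.sum_le_sum hone)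
    _ = _ := by
        rw [Finset.sum_const, nsmul_eq_mul, div_eq_mul_inv, ENNReal.ofReal_mul (by positivity)]
        simp

/-- Properties that hold almost surely under every conditional law hold almost surely. -/
theorem IsAdaptiveSample.ae_of_forall_law (hX : IsAdaptiveSample P X law)
    [IsProbabilityMeasure P] {N : Set D} (hN : MeasurableSet N) (h : ∀ k x, law k x N = 0) :
    ∀ᵐ ω ∂P, ∀ k, X k ω ∉ N := by
  rw [ae_all_iff]
  intro k
  have h1 := hX.lintegral_pair k (G := fun z => N.indicator 1 z.2)
    ((measurable_one.indicator hN).comp measurable_snd)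
  simp only [lintegral_indicator_one hN, h, lintegral_zero] at h1
  rw [lintegral_eq_zero_iff (f := fun ω => N.indicator 1 (X k ω))
    ((measurable_one.indicator hN).comp (hX.1 k))] at h1
  filter_upwards [h1] with ω hω hmem
  simp [hmem] at hω

end Adaptive

/-! ### Laws of histories -/

namespace Hist

variable {S A : Type*} {n : ℕ}

theorem state_extend_castSucc (w : Hist S A n) (z : A × ℝ × S) (i : Fin (n + 1)) :
    (extend (w, z)).state i.castSucc = w.state i := by
  refine Fin.cases ?_ (fun j => ?_) i
  · simp [state, extend]
  · simp only [state, extend, ← Fin.succ_castSucc, Fin.cons_succ, Fin.snoc_castSucc]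

theorem last_extend (w : Hist S A n) (z : A × ℝ × S) : (extend (w, z)).last = z.2.2 := by
  simp only [last, state, extend, ← Fin.succ_last, Fin.cons_succ, Fin.snoc_last]

theorem action_extend_castSucc (w : Hist S A n) (z : A × ℝ × S) (i : Fin n) :
    (extend (w, z)).action i.castSucc = w.action i := by
  simp [action, extend]

theorem action_extend_last (w : Hist S A n) (z : A × ℝ × S) :
    (extend (w, z)).action (Fin.last n) = z.1 := by
  simp [action, extend]

theorem totalReward_extend (w : Hist S A n) (z : A × ℝ × S) :
    (extend (w, z)).totalReward = w.totalReward + z.2.1 := by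
  simp [totalReward, reward, extend, Fin.sum_univ_castSucc]

theorem aug_extend (w : Hist S A n) (z : A × ℝ × S) :
    (extend (w, z)).aug = (z.2.2, w.aug.2 + z.2.1) := by
  simp [aug, last_extend, totalReward_extend]

/-- The transition `((s_h, a_h), s_{h+1})` of a history. -/
def transition (w : Hist S A n) (h : Fin n) : (S × A) × S :=
  ((w.state h.castSucc, w.action h), w.state h.succ)

theorem transition_extend_castSucc (w : Hist S A n) (z : A × ℝ × S) (i : Fin n) :
    (extend (w, z)).transition i.castSucc = w.transition i := by
  simp only [transition, state_extend_castSucc, action_extend_castSucc, Fin.succ_castSucc]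

theorem transition_extend_last (w : Hist S A n) (z : A × ℝ × S) :
    (extend (w, z)).transition (Fin.last n) = ((w.last, z.1), z.2.2) := by
  have h := last_extend w z
  rw [last, ← Fin.succ_last] at h
  simp only [transition, state_extend_castSucc, action_extend_last, h]
  rfl

variable [MeasurableSpace S] [MeasurableSpace A]

theorem measurable_action (i : Fin n) : Measurable (fun w : Hist S A n => w.action i) := by
  unfold action
  fun_prop

theorem measurable_transition (h : Fin n) :
    Measurable (fun w : Hist S A n => w.transition h) :=
  ((measurable_state _).prodMk (measurable_action h)).prodMk (measurable_state _)

theorem measurable_extend : Measurable (extend : Hist S A n × (A × ℝ × S) → Hist S A (n + 1)) := by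
  refine (measurable_fst.comp measurable_fst).prodMk (measurable_pi_lambda _ fun i => ?_)
  refine Fin.lastCases ?_ (fun j => ?_) i
  · simpa using measurable_snd
  · simp only [Fin.snoc_castSucc]
    fun_prop

end Hist

/-! ### Integrals against the laws of the interaction -/

namespace Env

variable {S A : Type*} [MeasurableSpace S] [MeasurableSpace A] {H : ℕ} (E : Env S A H)

theorem lintegral_transKer {p : TransFun S A} (hp : IsTransDensity E.base p) (x : S × A)
    {G : S → ℝ≥0∞} (hG : Measurable G) :
    ∫⁻ s', G s' ∂E.transKer p x = ∫⁻ s', p x.1 x.2 s' * G s' ∂E.base := by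
  have := E.sigmaFinite_base
  rw [transKer, Kernel.lintegral_withDensity _ _ _ hG, Kernel.const_apply]
  exact hp.1.coe_nnreal_ennreal

theorem isMarkovKernel_transKer {p : TransFun S A} (hp : IsTransDensity E.base p) :
    IsMarkovKernel (E.transKer p) := by
  refine ⟨fun x => ⟨?_⟩⟩
  rw [← lintegral_one, E.lintegral_transKer hp x measurable_const]
  simpa using hp.2 x.1 x.2

variable {p : Fin H → TransFun S A} (π : HistPolicy S A H)

theorem isMarkovKernel_stepKer (hp : ∀ h, IsTransDensity E.base (p h)) (h : Fin H) :
    IsMarkovKernel (E.stepKer p π h) := by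
  have := π.isMarkov h
  have := E.isMarkov_rewardKer h
  have := E.isMarkovKernel_transKer (hp h)
  unfold stepKer
  infer_instance

theorem lintegral_stepKer (hp : ∀ h, IsTransDensity E.base (p h)) (h : Fin H)
    (w : Hist S A h) {G : A × ℝ × S → ℝ≥0∞} (hG : Measurable G) :
    ∫⁻ z, G z ∂E.stepKer p π h w = ∫⁻ a, ∫⁻ r, ∫⁻ s', p h w.last a s' * G (a, r, s') ∂E.base
      ∂E.rewardKer h (w.last, a) ∂π.ker h w := by
  have := π.isMarkov h
  have := E.isMarkov_rewardKer h
  have := E.isMarkovKernel_transKer (hp h)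
  rw [stepKer, Kernel.lintegral_compProd _ _ _ hG]
  refine lintegral_congr fun a => ?_
  rw [Kernel.comap_apply, Kernel.lintegral_prod _ _ _ (g := fun c => G (a, c))
    (hG.comp measurable_prodMk_left)]
  refine lintegral_congr fun r => ?_
  rw [E.lintegral_transKer (hp h)]
  exact hG.comp (measurable_prodMk_left.comp measurable_prodMk_left)

/-- The step kernel integrates functions of action and next state. -/
theorem lintegral_stepKer_of_transition (hp : ∀ h, IsTransDensity E.base (p h)) (h : Fin H)
    (w : Hist S A h) {G : A × S → ℝ≥0∞} (hG : Measurable G) :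
    ∫⁻ z, G (z.1, z.2.2) ∂E.stepKer p π h w =
      ∫⁻ a, ∫⁻ s', p h w.last a s' * G (a, s') ∂E.base ∂π.ker h w := by
  have := E.isMarkov_rewardKer h
  rw [E.lintegral_stepKer π hp h w (G := fun z => G (z.1, z.2.2)) (by fun_prop)]
  simp

theorem isProbabilityMeasure_histLaw (hp : ∀ h, IsTransDensity E.base (p h)) (n : ℕ)
    (hn : n ≤ H) : IsProbabilityMeasure (E.histLaw p π n hn) := by
  induction n with
  | zero =>
    have := E.isProb_init
    exact Measure.isProbabilityMeasure_map (by fun_prop)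
  | succ n ih =>
    have := ih (Nat.le_of_succ_le hn)
    have := E.isMarkovKernel_stepKer π hp ⟨n, hn⟩
    exact Measure.isProbabilityMeasure_map Hist.measurable_extend.aemeasurable

theorem isProbabilityMeasure_trajLaw (hp : ∀ h, IsTransDensity E.base (p h)) :
    IsProbabilityMeasure (E.trajLaw p π) :=
  E.isProbabilityMeasure_histLaw π hp H le_rfl

theorem isProbabilityMeasure_returnLaw (hp : ∀ h, IsTransDensity E.base (p h)) :
    IsProbabilityMeasure (E.returnLaw p π) :=
  have := E.isProbabilityMeasure_trajLaw π hp
  Measure.isProbabilityMeasure_map Hist.measurable_totalReward.aemeasurable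

theorem isProbabilityMeasure_visit (hp : ∀ h, IsTransDensity E.base (p h)) (h : Fin H) :
    IsProbabilityMeasure (E.visit p π h) :=
  have := E.isProbabilityMeasure_trajLaw π hp
  Measure.isProbabilityMeasure_map
    ((Hist.measurable_state _).prodMk (Hist.measurable_action h)).aemeasurable

theorem lintegral_histLaw_succ (hp : ∀ h, IsTransDensity E.base (p h)) (n : ℕ) (hn : n + 1 ≤ H)
    {G : Hist S A (n + 1) → ℝ≥0∞} (hG : Measurable G) :
    ∫⁻ w, G w ∂E.histLaw p π (n + 1) hn =
      ∫⁻ w, ∫⁻ z, G (Hist.extend (w, z)) ∂E.stepKer p π ⟨n, hn⟩ w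
        ∂E.histLaw p π n (Nat.le_of_succ_le hn) := by
  have := E.isProbabilityMeasure_histLaw π hp n (Nat.le_of_succ_le hn)
  have := E.isMarkovKernel_stepKer π hp ⟨n, hn⟩
  rw [histLaw, lintegral_map hG Hist.measurable_extend,
    Measure.lintegral_compProd (f := fun z => G (Hist.extend z))
      (hG.comp Hist.measurable_extend)]

/-- Steps after `h` are Markov kernels that leave the transition at `h` untouched, so they integrate
out. -/
theorem lintegral_histLaw_transition (hp : ∀ h, IsTransDensity E.base (p h)) (n : ℕ)
    (hn : n ≤ H) (h : Fin n) {G : (S × A) × S → ℝ≥0∞} (hG : Measurable G) :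
    ∫⁻ w, G (w.transition h) ∂E.histLaw p π n hn =
      ∫⁻ w, ∫⁻ a, ∫⁻ s', p (Fin.castLE hn h) w.last a s' * G ((w.last, a), s') ∂E.base
        ∂π.ker (Fin.castLE hn h) w ∂E.histLaw p π h (h.isLt.le.trans hn) := by
  induction n with
  | zero => exact h.elim0
  | succ n ih =>
    rw [E.lintegral_histLaw_succ π hp n hn (G := fun w => G (w.transition h))
      (hG.comp (Hist.measurable_transition h))]
    induction h using Fin.lastCases with
    | last =>
      simp only [Hist.transition_extend_last]
      refine lintegral_congr fun w => ?_
      exact E.lintegral_stepKer_of_transition π hp ⟨n, hn⟩ w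
        (G := fun y => G ((w.last, y.1), y.2)) (by fun_prop)
    | cast j =>
      have := E.isMarkovKernel_stepKer π hp ⟨n, hn⟩
      simp only [Hist.transition_extend_castSucc, lintegral_const, measure_univ, mul_one]
      exact ih (Nat.le_of_succ_le hn) j

/-- The visitation measure in terms of the history at the beginning of the step. -/
theorem lintegral_visit (hp : ∀ h, IsTransDensity E.base (p h)) (h : Fin H) {G : S × A → ℝ≥0∞}
    (hG : Measurable G) :
    ∫⁻ x, G x ∂E.visit p π h =
      ∫⁻ w, ∫⁻ a, G (w.last, a) ∂π.ker h w ∂E.histLaw p π h h.isLt.le := by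
  rw [visit, lintegral_map hG ((Hist.measurable_state _).prodMk (Hist.measurable_action h))]
  have h1 := E.lintegral_histLaw_transition π hp H le_rfl h (hG.comp measurable_fst)
  refine h1.trans (lintegral_congr fun w => lintegral_congr fun a => ?_)
  have hm : Measurable fun s' => (p h w.last a s' : ℝ≥0∞) :=
    ((hp h).1.comp (measurable_prodMk_left (x := (w.last, a)))).coe_nnreal_ennreal
  simp only [Function.comp]
  exact (lintegral_mul_const _ hm).trans (by rw [(hp h).2, one_mul])

theorem measurable_lintegral_dens {q : TransFun S A} (hq : IsTransDensity E.base q)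
    {G : (S × A) × S → ℝ≥0∞} (hG : Measurable G) :
    Measurable fun x : S × A => ∫⁻ s', q x.1 x.2 s' * G (x, s') ∂E.base := by
  have := E.sigmaFinite_base
  exact (hq.1.coe_nnreal_ennreal.mul hG).lintegral_prod_right'

/-- Given `(s_h, a_h)`, the next state has density `p_h(· | s_h, a_h)`. -/
theorem lintegral_trajLaw_transition (hp : ∀ h, IsTransDensity E.base (p h)) (h : Fin H)
    {G : (S × A) × S → ℝ≥0∞} (hG : Measurable G) :
    ∫⁻ w, G (w.transition h) ∂E.trajLaw p π =
      ∫⁻ x, ∫⁻ s', p h x.1 x.2 s' * G (x, s') ∂E.base ∂E.visit p π h := by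
  rw [E.lintegral_visit π hp h (E.measurable_lintegral_dens (hp h) hG)]
  exact E.lintegral_histLaw_transition π hp H le_rfl h hG

/-- The last step is integrated out first, at cost `c`; the remaining factors depend only on the
shorter history. This is the supermartingale property within an episode. -/
theorem lintegral_prod_transition_le (hp : ∀ h, IsTransDensity E.base (p h))
    {G : Fin H → (S × A) × S → ℝ≥0∞} (hG : ∀ h, Measurable (G h)) {c : ℝ≥0∞}
    (hc : ∀ h s a, ∫⁻ s', p h s a s' * G h ((s, a), s') ∂E.base ≤ c) :
    ∫⁻ w, ∏ h, G h (w.transition h) ∂E.trajLaw p π ≤ c ^ H := by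
  have key : ∀ n (hn : n ≤ H), ∫⁻ w, ∏ h : Fin n, G (Fin.castLE hn h) (w.transition h)
      ∂E.histLaw p π n hn ≤ c ^ n := by
    intro n
    induction n with
    | zero =>
      intro hn
      have := E.isProbabilityMeasure_histLaw π hp 0 hn
      simp
    | succ n ih =>
      intro hn
      have hprod : ∀ m (hm : m ≤ H), Measurable fun w : Hist S A m =>
          ∏ h : Fin m, G (Fin.castLE hm h) (w.transition h) := fun m hm =>
        Finset.measurable_fun_prod _ fun h _ => (hG _).comp (Hist.measurable_transition h)
      rw [E.lintegral_histLaw_succ π hp n hn (hprod _ hn), pow_succ]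
      have hmul : ∀ w : Hist S A n, ∫⁻ z, ∏ h : Fin (n + 1), G (Fin.castLE hn h)
          ((Hist.extend (w, z)).transition h) ∂E.stepKer p π ⟨n, hn⟩ w ≤
          (∏ h : Fin n, G (Fin.castLE (Nat.le_of_succ_le hn) h) (w.transition h)) * c := by
        intro w
        simp only [Fin.prod_univ_castSucc, Hist.transition_extend_castSucc,
          Hist.transition_extend_last]
        have hGl : Measurable fun y : A × S => G ⟨n, hn⟩ ((w.last, y.1), y.2) :=
          (hG _).comp (by fun_prop)
        have hGl' : Measurable fun z : A × ℝ × S => G ⟨n, hn⟩ ((w.last, z.1), z.2.2) :=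
          (hG _).comp (by fun_prop)
        refine (lintegral_const_mul _ hGl').le.trans (mul_le_mul_right ?_ _)
        have := π.isMarkov ⟨n, hn⟩
        rw [E.lintegral_stepKer_of_transition π hp ⟨n, hn⟩ w hGl]
        refine (lintegral_mono fun a => hc ⟨n, hn⟩ w.last a).trans ?_
        simp
      refine (lintegral_mono hmul).trans ?_
      rw [lintegral_mul_const _ (hprod _ _)]
      exact mul_le_mul_left (ih _) _
  exact key H le_rfl

/-! ### `L¹` and total variation distances of transitions -/

/-- The `L¹` distance of `u(· | x)` and `q(· | x)`. -/
noncomputable def l1 (u q : TransFun S A) (x : S × A) : ℝ≥0∞ :=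
  ∫⁻ s', ENNReal.ofReal |(u x.1 x.2 s' : ℝ) - q x.1 x.2 s'| ∂E.base

theorem measurable_l1 {u q : TransFun S A}
    (hu : Measurable (fun x : (S × A) × S => u x.1.1 x.1.2 x.2))
    (hq : Measurable (fun x : (S × A) × S => q x.1.1 x.1.2 x.2)) : Measurable (E.l1 u q) := by
  have := E.sigmaFinite_base
  have h : Measurable fun x : (S × A) × S =>
      ENNReal.ofReal |(u x.1.1 x.1.2 x.2 : ℝ) - q x.1.1 x.1.2 x.2| :=
    (continuous_abs.measurable.comp
      (hu.coe_nnreal_real.sub hq.coe_nnreal_real)).ennreal_ofReal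
  exact h.lintegral_prod_right'

theorem l1_le_two {u q : TransFun S A} (hu : IsTransDensity E.base u)
    (hq : IsTransDensity E.base q) (x : S × A) : E.l1 u q x ≤ 2 := by
  have hm : Measurable fun s' => (u x.1 x.2 s' : ℝ≥0∞) :=
    (hu.1.comp (measurable_prodMk_left (x := x))).coe_nnreal_ennreal
  calc E.l1 u q x ≤ ∫⁻ s', (u x.1 x.2 s' : ℝ≥0∞) + q x.1 x.2 s' ∂E.base := by
        refine lintegral_mono fun s' => ?_
        rw [← ENNReal.ofReal_coe_nnreal, ← ENNReal.ofReal_coe_nnreal,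
          ← ENNReal.ofReal_add (by positivity) (by positivity)]
        refine ENNReal.ofReal_le_ofReal (abs_le.2 ⟨?_, ?_⟩) <;>
        linarith [(u x.1 x.2 s').coe_nonneg, (q x.1 x.2 s').coe_nonneg]
    _ = 2 := by
        rw [lintegral_add_left hm, hu.2, hq.2, one_add_one_eq_two]

theorem coe_le_add_ofReal_abs_sub (a b : ℝ≥0) :
    (a : ℝ≥0∞) ≤ b + ENNReal.ofReal |(a : ℝ) - b| := by
  rw [← ENNReal.ofReal_coe_nnreal, ← ENNReal.ofReal_coe_nnreal (p := b),
    ← ENNReal.ofReal_add (by positivity) (by positivity)]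
  exact ENNReal.ofReal_le_ofReal (by linarith [le_abs_self ((a : ℝ) - b)])

theorem tv_eq {u q : TransFun S A} (hu : IsTransDensity E.base u) (hq : IsTransDensity E.base q)
    (x : S × A) : E.tv u q x.1 x.2 = (E.l1 u q x).toReal / 2 := by
  rw [tv, l1, integral_eq_lintegral_of_nonneg_ae]
  · ring
  · exact Filter.Eventually.of_forall fun s' => abs_nonneg _
  · exact (continuous_abs.measurable.comp
      ((hu.1.comp (measurable_prodMk_left (x := x))).coe_nnreal_real.sub
        (hq.1.comp (measurable_prodMk_left (x := x))).coe_nnreal_real)).aestronglyMeasurable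

theorem integral_tv {u q : TransFun S A} (hu : IsTransDensity E.base u)
    (hq : IsTransDensity E.base q) (ν : Measure (S × A)) :
    ∫ x, E.tv u q x.1 x.2 ∂ν = (∫⁻ x, E.l1 u q x ∂ν).toReal / 2 := by
  simp only [E.tv_eq hu hq, integral_div]
  rw [integral_toReal (E.measurable_l1 hu.1 hq.1).aemeasurable]
  exact Filter.Eventually.of_forall fun x => (E.l1_le_two hu hq x).trans_lt ENNReal.ofNat_lt_top

theorem lintegral_l1_le_two {u q : TransFun S A} (hu : IsTransDensity E.base u)
    (hq : IsTransDensity E.base q) (ν : Measure (S × A)) [IsProbabilityMeasure ν] :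
    ∫⁻ x, E.l1 u q x ∂ν ≤ 2 :=
  (lintegral_mono fun x => E.l1_le_two hu hq x).trans (by simp)

/-! ### Simulation lemma -/

theorem lintegral_stepKer_le_add {q : Fin H → TransFun S A}
    (hp : ∀ h, IsTransDensity E.base (p h)) (hq : ∀ h, IsTransDensity E.base (q h)) (h : Fin H)
    (w : Hist S A h) {G : A × ℝ × S → ℝ≥0∞} (hG : Measurable G) (hG1 : ∀ z, G z ≤ 1) :
    ∫⁻ z, G z ∂E.stepKer q π h w ≤
      ∫⁻ z, G z ∂E.stepKer p π h w + ∫⁻ a, E.l1 (q h) (p h) (w.last, a) ∂π.ker h w := by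
  have := E.isMarkov_rewardKer h
  have hl1 : Measurable fun a => E.l1 (q h) (p h) (w.last, a) :=
    (E.measurable_l1 (hq h).1 (hp h).1).comp measurable_prodMk_left
  rw [E.lintegral_stepKer π hp h w hG, E.lintegral_stepKer π hq h w hG,
    ← lintegral_add_right _ hl1]
  refine lintegral_mono fun a => ?_
  have hconst : E.l1 (q h) (p h) (w.last, a) =
      ∫⁻ _r, E.l1 (q h) (p h) (w.last, a) ∂E.rewardKer h (w.last, a) := by simp
  rw [hconst, ← lintegral_add_right _ measurable_const]
  refine lintegral_mono fun r => ?_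
  have hmeas : Measurable fun s' =>
      ENNReal.ofReal |(q h w.last a s' : ℝ) - p h w.last a s'| :=
    (continuous_abs.measurable.comp
      (((hq h).1.comp (measurable_prodMk_left (x := (w.last, a)))).coe_nnreal_real.sub
        ((hp h).1.comp (measurable_prodMk_left (x := (w.last, a)))).coe_nnreal_real)).ennreal_ofReal
  rw [l1, ← lintegral_add_right _ hmeas]
  refine lintegral_mono fun s' => ?_
  calc (q h w.last a s' : ℝ≥0∞) * G (a, r, s')
      ≤ (p h w.last a s' + ENNReal.ofReal |(q h w.last a s' : ℝ) - p h w.last a s'|) *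
          G (a, r, s') := mul_le_mul_left (coe_le_add_ofReal_abs_sub _ _) _
    _ ≤ _ := by
        rw [add_mul]
        exact add_le_add le_rfl ((mul_le_mul_right (hG1 _) _).trans (mul_one _).le)

/-- A telescoping exchange of `q` for `p`. The induction hypothesis is applied to the conditional
expectation of `F` under the last `q`-step, which is still at most `1`; the exchange at that step is
then paid for under the law of `p`, and hence by its visitation measure. -/
theorem lintegral_histLaw_le_add {q : Fin H → TransFun S A}
    (hp : ∀ h, IsTransDensity E.base (p h)) (hq : ∀ h, IsTransDensity E.base (q h)) (n : ℕ)
    (hn : n ≤ H) {F : Hist S A n → ℝ≥0∞} (hF : Measurable F) (hF1 : ∀ w, F w ≤ 1) :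
    ∫⁻ w, F w ∂E.histLaw q π n hn ≤ ∫⁻ w, F w ∂E.histLaw p π n hn +
      ∑ h : Fin n, ∫⁻ x, E.l1 (q (Fin.castLE hn h)) (p (Fin.castLE hn h)) x
        ∂E.visit p π (Fin.castLE hn h) := by
  induction n with
  | zero => simp [histLaw]
  | succ n ih =>
    have hn' : n ≤ H := Nat.le_of_succ_le hn
    have hl1 := E.measurable_l1 (hq ⟨n, hn⟩).1 (hp ⟨n, hn⟩).1
    have := E.isMarkovKernel_stepKer π hq ⟨n, hn⟩
    have hFe : Measurable fun z : Hist S A n × (A × ℝ × S) => F (Hist.extend z) :=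
      hF.comp Hist.measurable_extend
    have hm : Measurable fun w : Hist S A n =>
        ∫⁻ z, F (Hist.extend (w, z)) ∂E.stepKer q π ⟨n, hn⟩ w := hFe.lintegral_kernel_prod_right'
    have hπ := π.isMarkov ⟨n, hn⟩
    have hl1' : Measurable fun w : Hist S A n =>
        ∫⁻ a, E.l1 (q ⟨n, hn⟩) (p ⟨n, hn⟩) (w.last, a) ∂π.ker ⟨n, hn⟩ w :=
      Measurable.lintegral_kernel_prod_right' (κ := π.ker ⟨n, hn⟩)
        (f := fun z : Hist S A n × A => E.l1 (q ⟨n, hn⟩) (p ⟨n, hn⟩) (z.1.last, z.2))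
        (hl1.comp ((Hist.measurable_last.comp measurable_fst).prodMk measurable_snd))
    rw [E.lintegral_histLaw_succ π hq n hn hF, E.lintegral_histLaw_succ π hp n hn hF,
      Fin.sum_univ_castSucc]
    calc _ ≤ _ := ih hn' hm fun w => (lintegral_mono fun z => hF1 _).trans (by simp)
      _ ≤ (∫⁻ w, ∫⁻ z, F (Hist.extend (w, z)) ∂E.stepKer p π ⟨n, hn⟩ w ∂E.histLaw p π n hn' +
            ∫⁻ x, E.l1 (q ⟨n, hn⟩) (p ⟨n, hn⟩) x ∂E.visit p π ⟨n, hn⟩) +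
          ∑ h : Fin n, ∫⁻ x, E.l1 (q (Fin.castLE hn' h)) (p (Fin.castLE hn' h)) x
            ∂E.visit p π (Fin.castLE hn' h) := by
          gcongr
          rw [E.lintegral_visit π hp ⟨n, hn⟩ hl1, ← lintegral_add_right _ hl1']
          exact lintegral_mono fun w => E.lintegral_stepKer_le_add π hp hq ⟨n, hn⟩ w
            (hFe.comp measurable_prodMk_left) fun z => hF1 _
      _ = _ := by
          rw [add_assoc]
          congr 1
          rw [add_comm]
          rfl

/-- Simulation lemma: the return distributions under two models differ by at most the expected
`L¹` distances of the transitions along the second one. -/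
theorem cdfDist_returnLaw_le {q : Fin H → TransFun S A}
    (hp : ∀ h, IsTransDensity E.base (p h)) (hq : ∀ h, IsTransDensity E.base (q h)) :
    cdfDist (E.returnLaw q π) (E.returnLaw p π) ≤
      2 * ∑ h, ∫ x, E.tv (q h) (p h) x.1 x.2 ∂E.visit p π h := by
  have := E.isProbabilityMeasure_returnLaw π hp
  have := E.isProbabilityMeasure_returnLaw π hq
  have hε : ∀ h, ∫⁻ x, E.l1 (q h) (p h) x ∂E.visit p π h ≠ ∞ := fun h =>
    have := E.isProbabilityMeasure_visit π hp h
    ((E.lintegral_l1_le_two (hq h) (hp h) _).trans_lt ENNReal.ofNat_lt_top).ne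
  have hsum : 2 * ∑ h, ∫ x, E.tv (q h) (p h) x.1 x.2 ∂E.visit p π h =
      (∑ h, ∫⁻ x, E.l1 (q h) (p h) x ∂E.visit p π h).toReal := by
    rw [ENNReal.toReal_sum fun h _ => hε h, Finset.mul_sum]
    refine Finset.sum_congr rfl fun h _ => ?_
    rw [E.integral_tv (hq h) (hp h)]
    ring
  rw [hsum]
  have hset : ∀ s : Set ℝ, MeasurableSet s → (E.returnLaw q π).real s ≤
      (E.returnLaw p π).real s + (∑ h, ∫⁻ x, E.l1 (q h) (p h) x ∂E.visit p π h).toReal := by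
    intro s hs
    have hs' : MeasurableSet (Hist.totalReward ⁻¹' s : Set (Traj S A H)) :=
      Hist.measurable_totalReward hs
    have h := E.lintegral_histLaw_le_add π hp hq H le_rfl
      (F := (Hist.totalReward ⁻¹' s : Set (Traj S A H)).indicator 1)
      (measurable_one.indicator hs') (fun w => Set.indicator_le_self' (by simp) w)
    rw [lintegral_indicator_one hs', lintegral_indicator_one hs'] at h
    rw [measureReal_def, measureReal_def, ← ENNReal.toReal_add (measure_ne_top _ _)
      (ENNReal.sum_ne_top.2 fun h _ => hε h)]
    refine ENNReal.toReal_mono (ENNReal.add_ne_top.2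
      ⟨measure_ne_top _ _, ENNReal.sum_ne_top.2 fun h _ => hε h⟩) ?_
    rw [returnLaw, returnLaw, Measure.map_apply Hist.measurable_totalReward hs,
      Measure.map_apply Hist.measurable_totalReward hs]
    exact h
  refine Real.iSup_le (fun x => ?_) ENNReal.toReal_nonneg
  rw [cdf_eq_real, cdf_eq_real, abs_le]
  -- `hset` is one-sided; applying it to the complement gives the reverse inequality.
  have h1 := hset _ (measurableSet_Iic (a := x))
  have h2 := hset _ (measurableSet_Iic (a := x)).compl
  rw [probReal_compl_eq_one_sub measurableSet_Iic,
    probReal_compl_eq_one_sub measurableSet_Iic] at h2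
  constructor <;> linarith

theorem integral_tv_nonneg (u q : TransFun S A) (ν : Measure (S × A)) :
    0 ≤ ∫ x, E.tv u q x.1 x.2 ∂ν :=
  integral_nonneg fun _ => mul_nonneg (by norm_num) (integral_nonneg fun _ => abs_nonneg _)

theorem integral_tv_le_one {u q : TransFun S A} (hu : IsTransDensity E.base u)
    (hq : IsTransDensity E.base q) (ν : Measure (S × A)) [IsProbabilityMeasure ν] :
    ∫ x, E.tv u q x.1 x.2 ∂ν ≤ 1 := by
  rw [E.integral_tv hu hq]
  have := ENNReal.toReal_mono ENNReal.ofNat_ne_top (E.lintegral_l1_le_two hu hq ν)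
  simp only [ENNReal.toReal_ofNat] at this
  linarith

end Env

/-! ### Likelihood ratios -/

/-- The value of a transition function at a transition. -/
def transAt {S A : Type*} (u : TransFun S A) (z : (S × A) × S) : ℝ≥0 := u z.1.1 z.1.2 z.2

/-- Pointwise comparison of the Hellinger affinity and the `L¹` distance. -/
theorem two_mul_sqrt_ratio_add_le (u p : ℝ≥0) (t : ℝ) :
    2 * ((p : ℝ) * NNReal.sqrt (u / p)) + 2 * t * |(u : ℝ) - p| ≤
      (1 + 2 * t ^ 2) * ((u : ℝ) + p) := by
  obtain ⟨a, rfl⟩ : ∃ a : ℝ≥0, u = a ^ 2 := ⟨NNReal.sqrt u, by simp⟩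
  obtain ⟨b, rfl⟩ : ∃ b : ℝ≥0, p = b ^ 2 := ⟨NNReal.sqrt p, by simp⟩
  have hs : NNReal.sqrt (a ^ 2 / b ^ 2) = a / b := by
    rw [← div_pow, NNReal.sqrt_sq]
  have hab : ((b ^ 2 : ℝ≥0) : ℝ) * ((a / b : ℝ≥0) : ℝ) = a * b := by
    rcases eq_or_ne b 0 with rfl | hb
    · simp
    · have : (b : ℝ) ≠ 0 := by exact_mod_cast hb
      push_cast
      field_simp
  rw [hs, hab]
  push_cast
  have ha := a.coe_nonneg
  have hb := b.coe_nonneg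
  have habs : |(a : ℝ) ^ 2 - b ^ 2| = |(a : ℝ) - b| * (a + b) := by
    rw [sq_sub_sq, abs_mul, abs_of_nonneg (add_nonneg ha hb), mul_comm]
  rw [habs]
  -- With `a`, `b` the square roots of `u`, `p`, the difference of the two sides is exactly `(|a -
  -- b| - t * (a + b)) ^ 2 + t ^ 2 * (a - b) ^ 2`.
  have h1 : |(a : ℝ) - b| ^ 2 = (a - b) ^ 2 := sq_abs _
  nlinarith [sq_nonneg (|(a : ℝ) - b| - t * (a + b)), mul_nonneg (sq_nonneg t)
    (sq_nonneg ((a : ℝ) - b))]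

/-! ### Expected likelihood ratios along a trajectory -/

namespace Env

variable {S A : Type*} [MeasurableSpace S] [MeasurableSpace A] {H : ℕ} (E : Env S A H)

/-- The square root of a likelihood ratio has conditional expectation bounded away from one in terms
of the expected `L¹` distance. -/
theorem lintegral_sqrt_ratio_le {u p : TransFun S A}
    (hu : Measurable (fun x : (S × A) × S => u x.1.1 x.1.2 x.2)) (hp : IsTransDensity E.base p)
    {ε : ℝ} (hε : 0 ≤ ε) (hε1 : ε ≤ 1)
    (hu1 : ∀ s a, ∫⁻ s', (u s a s' : ℝ≥0∞) ∂E.base ≤ ENNReal.ofReal (1 + ε))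
    (ν : Measure (S × A)) [IsProbabilityMeasure ν] :
    ∫⁻ x, ∫⁻ s', (p x.1 x.2 s' : ℝ≥0∞) *
        (NNReal.sqrt (transAt u (x, s') / transAt p (x, s')) : ℝ≥0∞) ∂E.base ∂ν ≤
      ENNReal.ofReal (Real.exp (-((∫⁻ x, E.l1 u p x ∂ν).toReal ^ 2 / 12 - ε / 2))) := by
  have := E.sigmaFinite_base
  have hw : Measurable fun z : (S × A) × S =>
      (p z.1.1 z.1.2 z.2 : ℝ≥0∞) * (NNReal.sqrt (transAt u z / transAt p z) : ℝ≥0∞) :=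
    hp.1.coe_nnreal_ennreal.mul
      (NNReal.continuous_sqrt.measurable.comp (hu.div hp.1)).coe_nnreal_ennreal
  have hum : ∀ x : S × A, Measurable fun s' => (u x.1 x.2 s' : ℝ≥0∞) := fun x =>
    (hu.comp (measurable_prodMk_left (x := x))).coe_nnreal_ennreal
  have hl1m : ∀ x : S × A, Measurable fun s' =>
      ENNReal.ofReal |(u x.1 x.2 s' : ℝ) - p x.1 x.2 s'| := fun x =>
    (continuous_abs.measurable.comp
      ((hu.comp (measurable_prodMk_left (x := x))).coe_nnreal_real.sub
        (hp.1.comp (measurable_prodMk_left (x := x))).coe_nnreal_real)).ennreal_ofReal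
  set m := ∫⁻ x, ∫⁻ s', (p x.1 x.2 s' : ℝ≥0∞) *
        (NNReal.sqrt (transAt u (x, s') / transAt p (x, s')) : ℝ≥0∞) ∂E.base ∂ν with hm
  set D := ∫⁻ x, E.l1 u p x ∂ν with hD
  have hone : (1 : ℝ≥0∞) = ENNReal.ofReal 1 := by simp
  have hsum : ∀ x : S × A, ∫⁻ s', ((u x.1 x.2 s' : ℝ≥0∞) + p x.1 x.2 s') ∂E.base ≤
      ENNReal.ofReal (2 + ε) := by
    intro x
    rw [lintegral_add_left (hum x), hp.2]
    calc _ ≤ ENNReal.ofReal (1 + ε) + ENNReal.ofReal 1 := by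
          rw [← hone]; exact add_le_add (hu1 _ _) le_rfl
      _ = _ := by rw [← ENNReal.ofReal_add (by linarith) (by norm_num)]; congr 1; ring
  -- Keeping `t` free makes the pointwise inequality linear in the affinity and the `L¹` distance.
  -- It can thus be integrated over states and actions before optimizing, which yields the square of
  -- the averaged distance without a separate use of Jensen's inequality.
  have key : ∀ t : ℝ, 0 ≤ t → 2 * m + ENNReal.ofReal (2 * t) * D ≤
      ENNReal.ofReal ((1 + 2 * t ^ 2) * (2 + ε)) := by
    intro t ht
    have hpt : ∀ x : S × A, 2 * (∫⁻ s', (p x.1 x.2 s' : ℝ≥0∞) *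
        (NNReal.sqrt (transAt u (x, s') / transAt p (x, s')) : ℝ≥0∞) ∂E.base) +
        ENNReal.ofReal (2 * t) * E.l1 u p x ≤ ENNReal.ofReal ((1 + 2 * t ^ 2) * (2 + ε)) := by
      intro x
      have hwx : Measurable fun s' => (p x.1 x.2 s' : ℝ≥0∞) *
          (NNReal.sqrt (transAt u (x, s') / transAt p (x, s')) : ℝ≥0∞) :=
        hw.comp measurable_prodMk_left
      rw [l1, ← lintegral_const_mul _ hwx, ← lintegral_const_mul _ (hl1m x),
        ← lintegral_add_left (hwx.const_mul _),
        ENNReal.ofReal_mul (p := 1 + 2 * t ^ 2) (by positivity)]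
      refine le_trans ?_ (mul_le_mul_right (hsum x) _)
      rw [← lintegral_const_mul' _ _ ENNReal.ofReal_ne_top]
      refine lintegral_mono fun s' => ?_
      have h := ENNReal.ofReal_le_ofReal
        (two_mul_sqrt_ratio_add_le (u x.1 x.2 s') (p x.1 x.2 s') t)
      rw [ENNReal.ofReal_add (by positivity) (by positivity),
        ENNReal.ofReal_mul (by positivity), ENNReal.ofReal_mul (by positivity),
        ENNReal.ofReal_mul (p := 2 * t) (by positivity),
        ENNReal.ofReal_mul (p := 1 + 2 * t ^ 2) (by positivity),
        ENNReal.ofReal_add (NNReal.coe_nonneg _) (NNReal.coe_nonneg _)] at h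
      simp only [ENNReal.ofReal_coe_nnreal, ENNReal.ofReal_ofNat] at h
      exact h
    have hint := lintegral_mono (μ := ν) hpt
    rw [lintegral_const, measure_univ, mul_one, lintegral_add_left,
      lintegral_const_mul, lintegral_const_mul] at hint
    · exact hint
    · exact E.measurable_l1 hu hp.1
    · exact hw.lintegral_prod_right'
    · exact hw.lintegral_prod_right'.const_mul _
  have hm_fin : m ≠ ∞ := by
    intro h
    have := key 0 le_rfl
    rw [h] at this
    simp at this
  have hD_fin : D ≠ ∞ := by
    intro h
    have := key 1 zero_le_one
    rw [h] at this
    simp at this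
  have hreal : ∀ t : ℝ, 0 ≤ t → 2 * m.toReal + 2 * t * D.toReal ≤ (1 + 2 * t ^ 2) * (2 + ε) := by
    intro t ht
    have h := ENNReal.toReal_mono ENNReal.ofReal_ne_top (key t ht)
    rw [ENNReal.toReal_add (ENNReal.mul_ne_top (by simp) hm_fin)
      (ENNReal.mul_ne_top ENNReal.ofReal_ne_top hD_fin), ENNReal.toReal_mul, ENNReal.toReal_mul,
      ENNReal.toReal_ofReal (by positivity), ENNReal.toReal_ofReal (by positivity)] at h
    simpa using h
  -- With `t = D / 6` and `ε ≤ 1` the inequality reads `2 * m + D ^ 2 / 3 ≤ 2 + ε + D ^ 2 / 6`,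
  -- hence the constant `12` after halving.
  have h1 := hreal (D.toReal / 6) (by positivity)
  have h2 : m.toReal ≤ -(D.toReal ^ 2 / 12 - ε / 2) + 1 := by
    nlinarith [sq_nonneg D.toReal, mul_nonneg (sub_nonneg.2 hε1) (sq_nonneg D.toReal)]
  rw [← ENNReal.ofReal_toReal hm_fin]
  exact ENNReal.ofReal_le_ofReal (h2.trans (Real.add_one_le_exp _))

theorem lintegral_trajLaw_sqrt_ratio_le {p : Fin H → TransFun S A}
    (hp : ∀ h, IsTransDensity E.base (p h)) (π : HistPolicy S A H) (h : Fin H) {u : TransFun S A}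
    (hu : Measurable (fun x : (S × A) × S => u x.1.1 x.1.2 x.2))
    {ε : ℝ} (hε : 0 ≤ ε) (hε1 : ε ≤ 1)
    (hu1 : ∀ s a, ∫⁻ s', (u s a s' : ℝ≥0∞) ∂E.base ≤ ENNReal.ofReal (1 + ε)) :
    ∫⁻ w, (NNReal.sqrt (transAt u (w.transition h) / transAt (p h) (w.transition h)) : ℝ≥0∞)
        ∂E.trajLaw p π ≤
      ENNReal.ofReal (Real.exp
        (-((∫⁻ x, E.l1 u (p h) x ∂E.visit p π h).toReal ^ 2 / 12 - ε / 2))) := by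
  have := E.isProbabilityMeasure_visit π hp h
  have hm : Measurable fun z =>
      (NNReal.sqrt (transAt u z / transAt (p h) z) : ℝ≥0∞) :=
    (NNReal.continuous_sqrt.measurable.comp (hu.div (hp h).1)).coe_nnreal_ennreal
  rw [E.lintegral_trajLaw_transition π hp h hm]
  exact E.lintegral_sqrt_ratio_le hu (hp h) hε hε1 hu1 _

/-- Expected likelihood ratio of a whole trajectory. -/
theorem lintegral_trajLaw_prod_ratio_le {p : Fin H → TransFun S A}
    (hp : ∀ h, IsTransDensity E.base (p h)) (π : HistPolicy S A H) {u : Fin H → TransFun S A}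
    (hu : ∀ h, Measurable (fun x : (S × A) × S => u h x.1.1 x.1.2 x.2)) {c : ℝ≥0∞}
    (hu1 : ∀ h s a, ∫⁻ s', (u h s a s' : ℝ≥0∞) ∂E.base ≤ c) :
    ∫⁻ w, ∏ h, ((transAt (u h) (w.transition h) / transAt (p h) (w.transition h) : ℝ≥0) : ℝ≥0∞)
        ∂E.trajLaw p π ≤ c ^ H := by
  refine E.lintegral_prod_transition_le π hp
    (G := fun h z => ((transAt (u h) z / transAt (p h) z : ℝ≥0) : ℝ≥0∞))
    (fun h => ((hu h).div (hp h).1).coe_nnreal_ennreal) fun h s a => ?_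
  refine (lintegral_mono fun s' => ?_).trans (hu1 h s a)
  rw [← ENNReal.coe_mul, ENNReal.coe_le_coe]
  change p h s a s' * (u h s a s' / p h s a s') ≤ u h s a s'
  rcases eq_or_ne (p h s a s') 0 with h0 | h0
  · simp [h0]
  · rw [mul_div_cancel₀ _ h0]

/-- A transition is drawn from the density itself, hence almost surely not where it vanishes. Off
this null set, a ratio times the true likelihood recovers its numerator, despite the convention `x /
0 = 0`. -/
theorem trajLaw_transAt_eq_zero {p : Fin H → TransFun S A}
    (hp : ∀ h, IsTransDensity E.base (p h)) (π : HistPolicy S A H) :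
    E.trajLaw p π {w | ∃ h, transAt (p h) (w.transition h) = 0} = 0 := by
  have hset : {w : Traj S A H | ∃ h, transAt (p h) (w.transition h) = 0} =
      ⋃ h, {w | transAt (p h) (w.transition h) = 0} := by ext; simp
  rw [hset, measure_iUnion_null_iff]
  intro h
  have hZ : MeasurableSet {z | transAt (p h) z = 0} := (hp h).1 (measurableSet_singleton 0)
  have hZ' : MeasurableSet {w : Traj S A H | transAt (p h) (w.transition h) = 0} :=
    Hist.measurable_transition h hZ
  rw [← lintegral_indicator_one hZ']
  have h1 := E.lintegral_trajLaw_transition π hp h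
    (G := {z | transAt (p h) z = 0}.indicator 1) (measurable_one.indicator hZ)
  refine Eq.trans ?_ (h1.trans ?_)
  · rfl
  · have hz : ∀ x s', (p h x.1 x.2 s' : ℝ≥0∞) * {z | transAt (p h) z = 0}.indicator 1 (x, s') =
        0 := by
      intro x s'
      by_cases h0 : transAt (p h) (x, s') = 0
      · have : p h x.1 x.2 s' = 0 := h0
        simp [this]
      · simp [h0]
    simp [hz]

theorem measurableSet_transAt_eq_zero {p : Fin H → TransFun S A}
    (hp : ∀ h, IsTransDensity E.base (p h)) :
    MeasurableSet {w : Traj S A H | ∃ h, transAt (p h) (w.transition h) = 0} := by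
  have hset : {w : Traj S A H | ∃ h, transAt (p h) (w.transition h) = 0} =
      ⋃ h, {w | transAt (p h) (w.transition h) = 0} := by ext; simp
  rw [hset]
  exact MeasurableSet.iUnion fun h =>
    Hist.measurable_transition h ((hp h).1 (measurableSet_singleton 0))

end Env

/-! ### Confidence sets in terms of likelihoods -/

namespace ModelClass

variable {S A : Type*} [MeasurableSpace S] [MeasurableSpace A] {H : ℕ} {E : Env S A H}
  {Par : Type*} (M : ModelClass E Par) {ι : Type*} [Fintype ι]

/-- Likelihood at step `h`. -/
noncomputable def stepLik (data : ι → Traj S A H) (h : Fin H) (ϑ : Par) : ℝ≥0 :=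
  ∏ i, transAt (M.dens ϑ) ((data i).transition h)

theorem _root_.RSDisRL.log_prod_eq_sum_log {κ : Type*} (s : Finset κ) (f : κ → ℝ≥0∞) :
    ENNReal.log (∏ i ∈ s, f i) = ∑ i ∈ s, ENNReal.log (f i) := by
  classical
  induction s using Finset.induction_on with
  | empty => simp
  | insert a s ha ih => rw [Finset.prod_insert ha, Finset.sum_insert ha, ENNReal.log_mul_add, ih]

theorem stepLogLik_eq (data : ι → Traj S A H) (h : Fin H) (ϑ : Par) :
    M.stepLogLik data h ϑ = ENNReal.log (M.stepLik data h ϑ : ℝ≥0∞) := by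
  rw [stepLik, ENNReal.ofNNReal_finsetProd, log_prod_eq_sum_log]
  rfl

theorem logLik_eq (data : ι → Traj S A H) (θ : Fin H → Par) :
    M.logLik data θ = ENNReal.log ((∏ h, M.stepLik data h (θ h) : ℝ≥0) : ℝ≥0∞) := by
  rw [ENNReal.ofNNReal_finsetProd, log_prod_eq_sum_log]
  simp only [logLik, stepLogLik_eq]

/-- Moves the confidence constraint from extended logarithms to real likelihoods. It remains valid
for vanishing likelihoods, whose logarithm is `⊥`. -/
theorem _root_.RSDisRL.log_sub_le_log_iff (a b : ℝ≥0) (β : ℝ) :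
    ENNReal.log a - (β : EReal) ≤ ENNReal.log b ↔ (a : ℝ) ≤ Real.exp β * b := by
  have h1 : (β : EReal) = ENNReal.log (ENNReal.ofReal (Real.exp β)) := by
    rw [ENNReal.log_ofReal_of_pos (Real.exp_pos β), Real.log_exp]
  rw [EReal.sub_le_iff_le_add (by simp) (by simp), h1, ← ENNReal.log_mul_add, ENNReal.log_le_log_iff,
    ← ENNReal.ofReal_coe_nnreal, ← ENNReal.ofReal_coe_nnreal (p := b),
    ← ENNReal.ofReal_mul (by positivity), ENNReal.ofReal_le_ofReal_iff (by positivity), mul_comm]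

theorem mem_confSet_iff {β : ℝ} {data : ι → Traj S A H} {θmle θ : Fin H → Par} :
    θ ∈ M.confSet β data θmle ↔ θ ∈ M.models ∧
      ∏ h, (M.stepLik data h (θmle h) : ℝ) ≤ Real.exp β * ∏ h, (M.stepLik data h (θ h) : ℝ) := by
  rw [confSet, Set.mem_ofPred_eq, logLik_eq, logLik_eq, log_sub_le_log_iff]
  simp

/-- Every model of the confidence set is, at every step, almost as likely as any other model. -/
theorem stepLik_le_of_mem_confSet {β : ℝ} {data : ι → Traj S A H} {θmle θ θstar : Fin H → Par}
    (hmle : M.IsMLE data θmle) (hstar : θstar ∈ M.models)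
    (hpos : ∀ h, 0 < M.stepLik data h (θstar h)) (hθ : θ ∈ M.confSet β data θmle) (h : Fin H) :
    (M.stepLik data h (θstar h) : ℝ) ≤ Real.exp β * M.stepLik data h (θ h) := by
  have hle : ∀ h, ∀ ϑ ∈ M.carrier h, M.stepLik data h ϑ ≤ M.stepLik data h (θmle h) := by
    intro h ϑ hϑ
    have := (hmle h).2 ϑ hϑ
    rwa [stepLogLik_eq, stepLogLik_eq, ENNReal.log_le_log_iff, ENNReal.coe_le_coe] at this
  obtain ⟨hmod, hprod⟩ := M.mem_confSet_iff.1 hθ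
  -- The constraint concerns the product over all steps. At the steps other than `h` the estimator
  -- is at least as likely as `θ`, so those factors cancel; they are positive because the estimator
  -- also dominates the true model.
  rw [← Finset.mul_prod_erase _ _ (Finset.mem_univ h),
    ← Finset.mul_prod_erase _ _ (Finset.mem_univ h)] at hprod
  have hrest : ∏ i ∈ Finset.univ.erase h, (M.stepLik data i (θ i) : ℝ) ≤
      ∏ i ∈ Finset.univ.erase h, (M.stepLik data i (θmle i) : ℝ) :=
    Finset.prod_le_prod (fun _ _ => NNReal.coe_nonneg _) fun i _ =>
      NNReal.coe_le_coe.2 (hle i _ (hmod i))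
  have hrest_pos : 0 < ∏ i ∈ Finset.univ.erase h, (M.stepLik data i (θmle i) : ℝ) :=
    Finset.prod_pos fun i _ => NNReal.coe_pos.2 ((hpos i).trans_le (hle i _ (hstar i)))
  have h1 : (M.stepLik data h (θmle h) : ℝ) ≤ Real.exp β * M.stepLik data h (θ h) := by
    refine le_of_mul_le_mul_right (hprod.trans ?_) hrest_pos
    rw [← mul_assoc]
    exact mul_le_mul_of_nonneg_left hrest (by positivity)
  exact (NNReal.coe_le_coe.2 (hle h _ (hstar h))).trans h1

end ModelClass

/-- If the likelihood ratio is at least `exp (-β)`, the exponential weight is controlled. -/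
theorem le_log_add_of_prod_sqrt_ratio_le {ι : Type*} [Fintype ι] {u p a : ι → ℝ≥0}
    (hp : ∀ i, 0 < p i) (hau : ∀ i, a i ≤ u i) {β q T : ℝ} (hT : 0 < T)
    (hlik : ((∏ i, p i : ℝ≥0) : ℝ) ≤ Real.exp β * ((∏ i, a i : ℝ≥0) : ℝ))
    (h : ¬ ENNReal.ofReal T < (∏ i, (NNReal.sqrt (u i / p i) : ℝ≥0∞)) *
      ENNReal.ofReal (Real.exp q)) :
    q ≤ Real.log T + β / 2 := by
  have hpp : 0 < ∏ i, p i := Finset.prod_pos fun i _ => hp i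
  have hsq : (∏ i, NNReal.sqrt (u i / p i)) ^ 2 = (∏ i, u i) / ∏ i, p i := by
    rw [← Finset.prod_pow, ← Finset.prod_div_distrib]
    simp
  have hau' : ∏ i, a i ≤ ∏ i, u i := Finset.prod_le_prod' fun i _ => hau i
  -- Replacing `a` by a majorant `u`, such as the upper end of its bracket, only increases the
  -- ratio. The square root halves `β`.
  have hge : Real.exp (-(β / 2)) ≤ ((∏ i, NNReal.sqrt (u i / p i) : ℝ≥0) : ℝ) := by
    refine le_of_sq_le_sq ?_ (NNReal.coe_nonneg _)
    rw [← NNReal.coe_pow, hsq, NNReal.coe_div, le_div_iff₀ (NNReal.coe_pos.2 hpp), sq,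
      ← Real.exp_add]
    calc _ ≤ Real.exp (-(β / 2) + -(β / 2)) * (Real.exp β * ((∏ i, a i : ℝ≥0) : ℝ)) := by
          gcongr
      _ = ((∏ i, a i : ℝ≥0) : ℝ) := by
          rw [← mul_assoc, ← Real.exp_add, show -(β / 2) + -(β / 2) + β = 0 by ring, Real.exp_zero,
            one_mul]
      _ ≤ _ := NNReal.coe_le_coe.2 hau'
  rw [not_lt, ← ENNReal.ofNNReal_finsetProd, ← ENNReal.ofReal_coe_nnreal,
    ← ENNReal.ofReal_mul (NNReal.coe_nonneg _), ENNReal.ofReal_le_ofReal_iff hT.le] at h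
  have h2 : Real.exp (q - β / 2) ≤ T := by
    refine le_trans ?_ h
    rw [sub_eq_add_neg, Real.exp_add, mul_comm]
    gcongr
  have := (Real.le_log_iff_exp_le hT).2 h2
  linarith

/-! ### The confidence sets built from bracketing numbers -/

theorem Env.l1_triangle {S A : Type*} [MeasurableSpace S] [MeasurableSpace A] {H : ℕ}
    (E : Env S A H) {a b c : TransFun S A}
    (ha : Measurable (fun x : (S × A) × S => a x.1.1 x.1.2 x.2))
    (hb : Measurable (fun x : (S × A) × S => b x.1.1 x.1.2 x.2)) (x : S × A) :
    E.l1 a c x ≤ E.l1 a b x + E.l1 b c x := by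
  have hm : Measurable fun s' => ENNReal.ofReal |(a x.1 x.2 s' : ℝ) - b x.1 x.2 s'| :=
    (continuous_abs.measurable.comp
      ((ha.comp (measurable_prodMk_left (x := x))).coe_nnreal_real.sub
        (hb.comp (measurable_prodMk_left (x := x))).coe_nnreal_real)).ennreal_ofReal
  rw [Env.l1, Env.l1, Env.l1, ← lintegral_add_left hm]
  refine lintegral_mono fun s' => ?_
  rw [← ENNReal.ofReal_add (abs_nonneg _) (abs_nonneg _)]
  exact ENNReal.ofReal_le_ofReal (abs_sub_le _ _ _)

section Bracketing

variable {S A : Type*} [MeasurableSpace S] [MeasurableSpace A] {H : ℕ} {E : Env S A H}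
  {Par : Type*} {M : ModelClass E Par}

theorem ModelClass.trans_isTransDensity {θ : Fin H → Par} (hθ : θ ∈ M.models) (h : Fin H) :
    IsTransDensity E.base (M.trans θ h) := M.isTransDensity h _ (hθ h)

/-- The upper ends of the brackets that contain a model. -/
theorem ModelClass.HasBracketing.exists_upper {ε : ℝ} {n : ℕ} (hε : 0 ≤ ε)
    (hb : M.HasBracketing ε n) :
    ∃ (I : Finset (Fin n)) (u : Fin n → Fin H → TransFun S A),
      (∀ j ∈ I, ∀ h, Measurable (fun x : (S × A) × S => u j h x.1.1 x.1.2 x.2)) ∧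
      (∀ j ∈ I, ∀ h s a, ∫⁻ s', (u j h s a s' : ℝ≥0∞) ∂E.base ≤ ENNReal.ofReal (1 + ε)) ∧
      ∀ θ ∈ M.models, ∃ j ∈ I, (∀ h s a s', M.trans θ h s a s' ≤ u j h s a s') ∧
        ∀ h x, E.l1 (M.trans θ h) (u j h) x ≤ ENNReal.ofReal ε := by
  classical
  obtain ⟨b, hbε, hcov⟩ := hb
  -- Brackets containing no model are discarded, since nothing bounds the mass of their upper ends.
  -- In the others, the upper end exceeds a density by at most the bracket width.
  refine ⟨Finset.univ.filter fun j => ∃ θ ∈ M.models, ∀ h s a s',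
    (b j).lower h s a s' ≤ (M.trans θ h s a s' : ℝ) ∧
      (M.trans θ h s a s' : ℝ) ≤ (b j).upper h s a s',
    fun j h s a s' => ((b j).upper h s a s').toNNReal, fun j _ h => ?_, fun j hj h s a => ?_,
    fun θ hθ => ?_⟩
  · exact ((b j).measurable_upper h).real_toNNReal
  · obtain ⟨θ, hθ, hθj⟩ := (Finset.mem_filter.1 hj).2
    have hd := M.trans_isTransDensity hθ h
    have hm : Measurable fun s' => (M.trans θ h s a s' : ℝ≥0∞) :=
      (hd.1.comp (measurable_prodMk_left (x := (s, a)))).coe_nnreal_ennreal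
    calc ∫⁻ s', (((b j).upper h s a s').toNNReal : ℝ≥0∞) ∂E.base
        ≤ ∫⁻ s', (M.trans θ h s a s' : ℝ≥0∞) +
            ENNReal.ofReal ((b j).upper h s a s' - (b j).lower h s a s') ∂E.base := by
          refine lintegral_mono fun s' => ?_
          rw [← ENNReal.ofReal_coe_nnreal (p := M.trans θ h s a s'),
            ← ENNReal.ofReal_add (NNReal.coe_nonneg _) (sub_nonneg.2 ((b j).le h s a s'))]
          exact ENNReal.ofReal_le_ofReal (by linarith [(hθj h s a s').1])
      _ ≤ 1 + ENNReal.ofReal ε := by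
          rw [lintegral_add_left hm, hd.2]
          exact add_le_add le_rfl (hbε j h s a)
      _ = _ := by rw [ENNReal.ofReal_add zero_le_one hε, ENNReal.ofReal_one]
  · obtain ⟨j, hj⟩ := hcov θ hθ
    refine ⟨j, Finset.mem_filter.2 ⟨Finset.mem_univ _, θ, hθ, hj⟩, fun h s a s' => ?_,
      fun h x => ?_⟩
    · exact NNReal.le_toNNReal_of_coe_le (hj h s a s').2
    · refine (lintegral_mono fun s' => ENNReal.ofReal_le_ofReal ?_).trans (hbε j h x.1 x.2)
      obtain ⟨h1, h2⟩ := hj h x.1 x.2 s'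
      rw [Real.coe_toNNReal _ ((NNReal.coe_nonneg _).trans h2), abs_sub_comm,
        abs_of_nonneg (by linarith)]
      linarith

variable {K : ℕ} {Ω : Type*} [MeasurableSpace Ω] {P : Measure Ω} [IsProbabilityMeasure P]

/-- The radius equals `H * (1 + log K + log (N / δ))`. The summand `H` pays for the excess mass of
the bracket ends over all episodes, or for a union bound over steps. -/
theorem log_add_le_betaMLE {H K N : ℕ} {δ : ℝ} (hH : 1 ≤ H) (hK : 1 ≤ K) (hN : 1 ≤ N)
    (hδ : 0 < δ) (hδ1 : δ ≤ 1) : Real.log (N / δ) + H ≤ betaMLE H K N δ := by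
  have hH' : (1 : ℝ) ≤ H := by exact_mod_cast hH
  have hK' : (1 : ℝ) ≤ K := by exact_mod_cast hK
  have hN' : (1 : ℝ) ≤ N := by exact_mod_cast hN
  have h1 : 1 ≤ N / δ := by rw [le_div_iff₀ hδ]; linarith
  have h2 : 0 ≤ Real.log (N / δ) := Real.log_nonneg h1
  have h3 : 0 ≤ Real.log K := Real.log_nonneg hK'
  have h4 : Real.log (Real.exp 1 * K * N / δ) = 1 + Real.log K + Real.log (N / δ) := by
    rw [mul_div_assoc, Real.log_mul (by positivity) (by positivity),
      Real.log_mul (by positivity) (by positivity), Real.log_exp]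
  rw [betaMLE, h4]
  nlinarith [mul_nonneg (sub_nonneg.2 hH') h2, mul_nonneg (zero_le_one.trans hH') h3]

theorem ModelClass.one_le_bracketingNumber {θ : Fin H → Par} (hθ : θ ∈ M.models) {ε : ℝ}
    (hb : ∃ n, M.HasBracketing ε n) : 1 ≤ M.bracketingNumber ε := by
  obtain ⟨b, -, hcov⟩ : M.HasBracketing ε (M.bracketingNumber ε) := Nat.sInf_mem hb
  obtain ⟨j, -⟩ := hcov θ hθ
  exact Nat.one_le_iff_ne_zero.2 fun h => (Fin.cast h j).elim0

variable {ρ : Measure ℝ → ℝ} {δ : ℝ} {θstar : Fin H → Par}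
  {plan : (Fin H → Par) → AugPolicy S A H}
  {mle θhat : (k : Fin K) → (Fin k → Traj S A H) → Fin H → Par} {X : Fin K → Ω → Traj S A H}

theorem ModelClass.mem_models_of_isMLE {ι : Type*} [Fintype ι] {data : ι → Traj S A H}
    {θ : Fin H → Par} (h : M.IsMLE data θ) : θ ∈ M.models := fun i => (h i).1

theorem IsMLERun.ae_transAt_pos {β : ℝ} (hstar : θstar ∈ M.models)
    (run : IsMLERun M ρ β θstar plan mle θhat P X) :
    ∀ᵐ ω ∂P, ∀ k h, 0 < transAt (M.trans θstar h) ((X k ω).transition h) := by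
  have hp := M.trans_isTransDensity hstar
  have h := run.sample.ae_of_forall_law (E.measurableSet_transAt_eq_zero hp)
    fun k x => E.trajLaw_transAt_eq_zero hp _
  filter_upwards [h] with ω hω k h
  refine pos_iff_ne_zero.2 fun h0 => hω k ⟨h, h0⟩

/-- The true model lies in all confidence sets with high probability. -/
theorem IsMLERun.measure_not_mem_confSet_le (hH : 1 ≤ H) (hK : 1 ≤ K) (hδ : 0 < δ) (hδ1 : δ ≤ 1)
    (hstar : θstar ∈ M.models) (hbr : ∃ n, M.HasBracketing (1 / K) n)
    (run : IsMLERun M ρ (betaMLE H K (M.bracketingNumber (1 / K)) δ) θstar plan mle θhat P X) :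
    P {ω | ¬ ∀ k : Fin K, θstar ∈ M.confSet (betaMLE H K (M.bracketingNumber (1 / K)) δ)
      (past X k ω) (mle k (past X k ω))} ≤ ENNReal.ofReal δ := by
  have hp := M.trans_isTransDensity hstar
  have hN1 := M.one_le_bracketingNumber hstar hbr
  have hbN : M.HasBracketing (1 / K) (M.bracketingNumber (1 / K)) := Nat.sInf_mem hbr
  set N := M.bracketingNumber (1 / K) with hN
  have hK0 : (0 : ℝ) < K := by exact_mod_cast hK
  have hN0 : (0 : ℝ) < N := by exact_mod_cast hN1
  obtain ⟨I, u, hum, hu1, hcov⟩ := hbN.exists_upper (by positivity)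
  have hT : 0 < N / δ := by positivity
  have hconc := run.sample.measure_exists_lt_prod_mul_exp_le I
    (fun j w => ∏ h, ((transAt (u j h) (w.transition h) /
      transAt (M.trans θstar h) (w.transition h) : ℝ≥0) : ℝ≥0∞))
    (fun j hj => Finset.measurable_fun_prod _ fun h _ =>
      (((hum j hj h).div (hp h).1).comp (Hist.measurable_transition h)).coe_nnreal_ennreal)
    -- Upper ends are not densities: a trajectory ratio may have expectation up to `(1 + 1 / K) ^ H
    -- ≤ exp (H / K)`. Over at most `K` episodes this costs `H` in the exponent.
    (fun _ _ _ => -(H / K)) (fun _ _ _ => measurable_const)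
    (fun j hj k x => by
      refine (E.lintegral_trajLaw_prod_ratio_le hp _ (hum j hj) (hu1 j hj)).trans ?_
      rw [← ENNReal.ofReal_pow (by positivity), neg_neg]
      refine ENNReal.ofReal_le_ofReal ?_
      calc (1 + 1 / (K : ℝ)) ^ H ≤ (Real.exp (1 / K)) ^ H := by
            gcongr
            rw [add_comm]
            exact Real.add_one_le_exp _
        _ = Real.exp (H / K) := by rw [← Real.exp_nat_mul]; congr 1; ring) hT
  refine (measure_mono_ae ?_).trans (hconc.trans (ENNReal.ofReal_le_ofReal ?_))
  · filter_upwards [run.ae_transAt_pos hstar] with ω hpos hbad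
    by_contra hgood
    refine hbad fun k => M.mem_confSet_iff.2 ⟨hstar, ?_⟩
    -- The estimator depends on the data, whereas the upper end of a bracket around it belongs to a
    -- family fixed in advance.
    obtain ⟨j, hj, hle, -⟩ := hcov _ (M.mem_models_of_isMLE (run.isMLE k (past X k ω)))
    have hk : ¬ ENNReal.ofReal (N / δ) < _ := fun hlt => hgood ⟨j, hj, k, hlt⟩
    have hsum : ∑ _j : Fin k, -((H : ℝ) / K) = -(k * (H / K)) := by simp
    rw [not_lt, hsum] at hk
    simp only [← ENNReal.ofNNReal_finsetProd] at hk
    rw [← ENNReal.ofReal_coe_nnreal, ← ENNReal.ofReal_mul (NNReal.coe_nonneg _),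
      ENNReal.ofReal_le_ofReal_iff hT.le] at hk
    set ratio : ℝ≥0 := ∏ i : Fin k, ∏ h, (transAt (u j h) ((past X k ω i).transition h) /
      transAt (M.trans θstar h) ((past X k ω i).transition h)) with hratio
    have hratio_le : (ratio : ℝ) ≤ Real.exp (betaMLE H K N δ) := by
      have h1 : (ratio : ℝ) * Real.exp (-(k * (H / K))) ≤ N / δ := hk
      have h2 : (k : ℝ) * (H / K) ≤ H := by
        have : (k : ℝ) ≤ K := by exact_mod_cast k.isLt.le
        rw [← mul_div_assoc, div_le_iff₀ hK0]
        nlinarith [(Nat.cast_nonneg H : (0 : ℝ) ≤ H)]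
      calc (ratio : ℝ) = ratio * Real.exp (-(k * (H / K))) * Real.exp (k * (H / K)) := by
            rw [mul_assoc, ← Real.exp_add]; simp
        _ ≤ N / δ * Real.exp H := by gcongr
        _ = Real.exp (Real.log (N / δ) + H) := by rw [Real.exp_add, Real.exp_log hT]
        _ ≤ _ := Real.exp_le_exp.2 (log_add_le_betaMLE hH hK hN1 hδ hδ1)
    have hlik : ∏ h, M.stepLik (past X k ω) h (mle k (past X k ω) h) ≤
        ratio * ∏ h, M.stepLik (past X k ω) h (θstar h) := by
      have h1 : ratio * ∏ h, M.stepLik (past X k ω) h (θstar h) =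
          ∏ h, ∏ i : Fin k, transAt (u j h) ((past X k ω i).transition h) := by
        rw [hratio, Finset.prod_comm, ← Finset.prod_mul_distrib]
        refine Finset.prod_congr rfl fun h _ => ?_
        rw [ModelClass.stepLik, ← Finset.prod_mul_distrib]
        refine Finset.prod_congr rfl fun i _ => ?_
        exact div_mul_cancel₀ _ (hpos _ h).ne'
      rw [h1]
      exact Finset.prod_le_prod' fun h _ => Finset.prod_le_prod' fun i _ => hle h _ _ _
    have hlik' := NNReal.coe_le_coe.2 hlik
    push_cast at hlik'
    exact hlik'.trans (mul_le_mul_of_nonneg_right hratio_le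
      (Finset.prod_nonneg fun h _ => NNReal.coe_nonneg _))
  · have hcard : (I.card : ℝ) ≤ N := by
      have := Finset.card_le_univ I
      simp only [Fintype.card_fin] at this
      exact_mod_cast this
    rw [div_div_eq_mul_div, div_le_iff₀ hN0, mul_comm]
    gcongr

/-- Measurability of the chosen policy in the data is not assumed; it is needed only for the
resulting trajectory law, and the kernel of the adaptive sample supplies it. -/
theorem measurable_toReal_lintegral_visit {D : Type*} [MeasurableSpace D]
    {p : Fin H → TransFun S A} {κ : Kernel D (Traj S A H)} {π : D → HistPolicy S A H}
    (hκ : ∀ x, κ x = E.trajLaw p (π x)) (h : Fin H) {G : S × A → ℝ≥0∞} (hG : Measurable G) :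
    Measurable fun x => (∫⁻ y, G y ∂E.visit p (π x) h).toReal := by
  have hm : Measurable fun w : Traj S A H => (w.state h.castSucc, w.action h) :=
    (Hist.measurable_state _).prodMk (Hist.measurable_action h)
  have : (fun x => ∫⁻ y, G y ∂E.visit p (π x) h) =
      fun x => ∫⁻ w, G (w.state h.castSucc, w.action h) ∂κ x := by
    ext x
    rw [Env.visit, lintegral_map hG hm, hκ]
  rw [show (fun x => (∫⁻ y, G y ∂E.visit p (π x) h).toReal) =
    ENNReal.toReal ∘ fun x => ∫⁻ y, G y ∂E.visit p (π x) h from rfl, this]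
  exact ENNReal.measurable_toReal.comp (hG.comp hm).lintegral_kernel

/-- The selected models predict the past well, with high probability. -/
theorem IsMLERun.measure_not_sum_sq_tv_le (hH : 1 ≤ H) (hK : 1 ≤ K) (hδ : 0 < δ) (hδ1 : δ ≤ 1)
    (hstar : θstar ∈ M.models) (hbr : ∃ n, M.HasBracketing (1 / K) n)
    (run : IsMLERun M ρ (betaMLE H K (M.bracketingNumber (1 / K)) δ) θstar plan mle θhat P X) :
    P {ω | ¬ ∀ (h : Fin H) (k : Fin K), ∑ i : Fin k,
      (∫ x, E.tv (M.trans (θhat k (past X k ω)) h) (M.trans θstar h) x.1 x.2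
        ∂E.visit (M.trans θstar) (plan (θhat (Fin.castLE k.isLt.le i)
          (past X (Fin.castLE k.isLt.le i) ω))).toHist h) ^ 2 ≤
      13 * betaMLE H K (M.bracketingNumber (1 / K)) δ} ≤ ENNReal.ofReal δ := by
  have hp := M.trans_isTransDensity hstar
  have hN1 := M.one_le_bracketingNumber hstar hbr
  have hbN : M.HasBracketing (1 / K) (M.bracketingNumber (1 / K)) := Nat.sInf_mem hbr
  set N := M.bracketingNumber (1 / K) with hN
  set β := betaMLE H K N δ with hβ
  have hK0 : (0 : ℝ) < K := by exact_mod_cast hK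
  have hK1 : (1 : ℝ) ≤ K := by exact_mod_cast hK
  have hN0 : (0 : ℝ) < N := by exact_mod_cast hN1
  have hH0 : (0 : ℝ) < H := by exact_mod_cast hH
  have hε1 : 1 / (K : ℝ) ≤ 1 := by rw [div_le_one hK0]; exact hK1
  obtain ⟨I, u, hum, hu1, hcov⟩ := hbN.exists_upper (by positivity)
  -- The union bound runs over the brackets and also over the `H` steps, each with its own weight.
  have hT : 0 < N * H / δ := by positivity
  set D : Fin N × Fin H → AugPolicy S A H → ℝ := fun j π =>
    (∫⁻ x, E.l1 (u j.1 j.2) (M.trans θstar j.2) x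
      ∂E.visit (M.trans θstar) π.toHist j.2).toReal with hD
  have hconc := run.sample.measure_exists_lt_prod_mul_exp_le (I ×ˢ (Finset.univ : Finset (Fin H)))
    (fun j w => (NNReal.sqrt (transAt (u j.1 j.2) (w.transition j.2) /
      transAt (M.trans θstar j.2) (w.transition j.2)) : ℝ≥0∞))
    (fun j hj => (NNReal.continuous_sqrt.measurable.comp
      (((hum j.1 (Finset.mem_product.1 hj).1 j.2).div (hp j.2).1).comp
        (Hist.measurable_transition j.2))).coe_nnreal_ennreal)
    (fun j k x => D j (plan (θhat k x)) ^ 2 / 12 - 1 / K / 2)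
    (fun j hj k => by
      obtain ⟨κ, -, hκ, -⟩ := run.sample.2 k
      exact (((measurable_toReal_lintegral_visit hκ j.2 (E.measurable_l1
        (hum j.1 (Finset.mem_product.1 hj).1 j.2) (hp j.2).1)).pow_const 2).div_const _).sub_const _)
    (fun j hj k x => E.lintegral_trajLaw_sqrt_ratio_le hp _ j.2
      (hum j.1 (Finset.mem_product.1 hj).1 j.2) (by positivity) hε1
      (hu1 j.1 (Finset.mem_product.1 hj).1 j.2)) hT
  refine (measure_mono_ae ?_).trans (hconc.trans (ENNReal.ofReal_le_ofReal ?_))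
  · filter_upwards [run.ae_transAt_pos hstar] with ω hpos hbad
    by_contra hgood
    refine hbad fun h k => ?_
    have hmem := run.mem_confSet k (past X k ω)
    obtain ⟨j, hj, hle, hl1⟩ := hcov _ hmem.1
    have hθd := M.trans_isTransDensity hmem.1 h
    have hum' := hum j hj h
    have hlik := M.stepLik_le_of_mem_confSet (run.isMLE k (past X k ω)) hstar
      (fun h => Finset.prod_pos fun i _ => hpos _ h) hmem h
    have hq := le_log_add_of_prod_sqrt_ratio_le (fun i => hpos (Fin.castLE k.isLt.le i) h)
      (fun i => hle h _ _ _) hT hlik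
      (fun hlt => hgood ⟨(j, h), Finset.mem_product.2 ⟨hj, Finset.mem_univ _⟩, k, hlt⟩)
    -- Here `log H ≤ H - 1` absorbs the union over steps.
    have hlogT : Real.log (N * H / δ) ≤ β := by
      have h1 := log_add_le_betaMLE hH hK hN1 hδ hδ1
      have h2 : Real.log (N * H / δ) = Real.log (N / δ) + Real.log H := by
        rw [← Real.log_mul (by positivity) (by positivity)]; congr 1; ring
      have h3 := Real.log_le_sub_one_of_pos hH0
      linarith
    have hβ1 : 1 ≤ β := by
      have h1 := log_add_le_betaMLE hH hK hN1 hδ hδ1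
      have h2 : 0 ≤ Real.log (N / δ) := by
        refine Real.log_nonneg ?_
        rw [le_div_iff₀ hδ]
        have : (1 : ℝ) ≤ N := by exact_mod_cast hN1
        linarith
      have h3 : (1 : ℝ) ≤ H := by exact_mod_cast hH
      linarith
    set Dk : Fin k → ℝ := fun i => D (j, h) (plan (θhat (Fin.castLE k.isLt.le i)
      (past X (Fin.castLE k.isLt.le i) ω))) with hDk
    have hkK : (k : ℝ) ≤ K := by exact_mod_cast k.isLt.le
    -- The exponential bound is `log T + β / 2`, with a bracketing slack of at most `1 / 2`; as `β ≥
    -- 1` the total is at most `2 * β`, and multiplying by `12` gives `24`.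
    have hsumD : ∑ i, Dk i ^ 2 ≤ 24 * β := by
      have h1 : ∑ i : Fin k, (Dk i ^ 2 / 12 - 1 / K / 2) ≤ Real.log (N * H / δ) + β / 2 := hq
      rw [Finset.sum_sub_distrib, ← Finset.sum_div] at h1
      simp only [Finset.sum_const, Finset.card_univ, Fintype.card_fin, nsmul_eq_mul] at h1
      have h2 : (k : ℝ) * (1 / K / 2) ≤ 1 / 2 := by
        have : (k : ℝ) * (1 / K) ≤ 1 := by rw [mul_one_div, div_le_one hK0]; exact hkK
        linarith
      linarith
    -- Total variation is half the `L¹` distance, and the selected model is within `1 / K` of its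
    -- bracket end. Summing over `k ≤ K` episodes gives `(1 + 24 * β) / 2 ≤ 13 * β`.
    have htv : ∀ i : Fin k, (∫ x, E.tv (M.trans (θhat k (past X k ω)) h) (M.trans θstar h) x.1 x.2
        ∂E.visit (M.trans θstar) (plan (θhat (Fin.castLE k.isLt.le i)
          (past X (Fin.castLE k.isLt.le i) ω))).toHist h) ^ 2 ≤ (1 / K + Dk i ^ 2) / 2 := by
      intro i
      set π := plan (θhat (Fin.castLE k.isLt.le i) (past X (Fin.castLE k.isLt.le i) ω)) with hπ
      have := E.isProbabilityMeasure_visit π.toHist hp h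
      have hDfin : ∫⁻ x, E.l1 (u j h) (M.trans θstar h) x
          ∂E.visit (M.trans θstar) π.toHist h ≠ ∞ := by
        refine ne_top_of_le_ne_top (b := ENNReal.ofReal (1 / K) + 2) (by simp) ?_
        refine (lintegral_mono fun x => (E.l1_triangle hum' hθd.1 x).trans
          (add_le_add ((le_of_eq ?_).trans (hl1 h x)) (E.l1_le_two hθd (hp h) x))).trans ?_
        · simp only [Env.l1, abs_sub_comm]
        · simp
      have hle2 : ∫⁻ x, E.l1 (M.trans (θhat k (past X k ω)) h) (M.trans θstar h) x
          ∂E.visit (M.trans θstar) π.toHist h ≤ ENNReal.ofReal (1 / K) +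
            ∫⁻ x, E.l1 (u j h) (M.trans θstar h) x ∂E.visit (M.trans θstar) π.toHist h := by
        refine (lintegral_mono fun x => (E.l1_triangle hθd.1 hum' x).trans
          (add_le_add (hl1 h x) le_rfl)).trans ?_
        rw [lintegral_add_left measurable_const]
        simp
      have hreal := ENNReal.toReal_mono (ENNReal.add_ne_top.2 ⟨ENNReal.ofReal_ne_top, hDfin⟩) hle2
      rw [ENNReal.toReal_add ENNReal.ofReal_ne_top hDfin,
        ENNReal.toReal_ofReal (by positivity)] at hreal
      have hreal' : _ ≤ 1 / (K : ℝ) + Dk i := hreal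
      rw [E.integral_tv hθd (hp h)]
      have h0 := ENNReal.toReal_nonneg (a := ∫⁻ x, E.l1 (M.trans (θhat k (past X k ω)) h)
        (M.trans θstar h) x ∂E.visit (M.trans θstar) π.toHist h)
      have hsq := pow_le_pow_left₀ h0 hreal' 2
      have hKK : (1 / (K : ℝ)) ^ 2 ≤ 1 / K := by
        rw [sq]
        exact mul_le_of_le_one_left (by positivity) hε1
      nlinarith [sq_nonneg (1 / (K : ℝ) - Dk i)]
    refine (Finset.sum_le_sum fun i _ => htv i).trans ?_
    rw [← Finset.sum_div, Finset.sum_add_distrib]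
    simp only [Finset.sum_const, Finset.card_univ, Fintype.card_fin, nsmul_eq_mul]
    have h2 : (k : ℝ) * (1 / K) ≤ 1 := by rw [mul_one_div, div_le_one hK0]; exact hkK
    linarith
  · have hcard : ((I ×ˢ (Finset.univ : Finset (Fin H))).card : ℝ) ≤ N * H := by
      have := Finset.card_le_univ I
      rw [Finset.card_product]
      simp only [Fintype.card_fin, Finset.card_univ] at this ⊢
      exact_mod_cast Nat.mul_le_mul_right _ this
    rw [div_div_eq_mul_div, div_le_iff₀ (by positivity), mul_comm]
    gcongr

end Bracketing

/-! ### Regret under the witness rank condition -/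

theorem one_le_log_exp_one_add {K B : ℝ} (hK : 0 ≤ K) (hB : 0 ≤ B) :
    1 ≤ Real.log (Real.exp 1 + K + B) := by
  rw [Real.le_log_iff_exp_le (by positivity)]
  linarith

theorem log_one_add_mul_sq_le {K B : ℝ} (hK : 0 ≤ K) (hB : 0 ≤ B) :
    Real.log (1 + K * B ^ 2) ≤ 3 * Real.log (Real.exp 1 + K + B) := by
  have hy : 1 + (K + B) ≤ Real.exp 1 + K + B := by
    have := Real.add_one_le_exp (1 : ℝ)
    linarith
  rw [show (3 : ℝ) * Real.log (Real.exp 1 + K + B) = Real.log ((Real.exp 1 + K + B) ^ 3) by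
    rw [Real.log_pow]; norm_num]
  refine Real.log_le_log (by positivity) ?_
  calc 1 + K * B ^ 2 ≤ (1 + (K + B)) ^ 3 := by
        have h1 : K * B ^ 2 ≤ (K + B) * (K + B) ^ 2 :=
          mul_le_mul (by linarith) (pow_le_pow_left₀ hB (by linarith) 2) (by positivity)
            (by positivity)
        nlinarith [mul_nonneg (add_nonneg hK hB) (add_nonneg hK hB)]
    _ ≤ _ := pow_le_pow_left₀ (by positivity) hy 3

section Witness

variable {S A : Type*} [MeasurableSpace S] [MeasurableSpace A] {H : ℕ} {E : Env S A H}
  {Par : Type*} {M : ModelClass E Par} {θstar : Fin H → Par}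
  {plan : (Fin H → Par) → AugPolicy S A H} {d : ℕ} {α B : ℝ}

/-- A sign for `B` is part of no hypothesis but is forced by the norm bound at any single step; it
makes the logarithm of the final bound at least `1`. -/
theorem ModelClass.WitnessRank.bound_nonneg (hwit : M.WitnessRank θstar plan d α B) (hH : 1 ≤ H)
    (hstar : θstar ∈ M.models) : 0 ≤ B := by
  obtain ⟨f, g, hfg⟩ := hwit
  refine le_trans ?_ (hfg ⟨0, hH⟩ θstar hstar θstar hstar).2.2
  exact mul_nonneg (Finset.sum_nonneg fun _ _ => abs_nonneg _)
    (Real.iSup_nonneg fun _ => abs_nonneg _)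

/-- Models that predict the past well have small total prediction error. -/
theorem ModelClass.WitnessRank.sum_tv_le (hwit : M.WitnessRank θstar plan d α B) (hα : 0 < α)
    (hB : 0 ≤ B) (hstar : θstar ∈ M.models) {K : ℕ} (θ : Fin K → Fin H → Par)
    (hθ : ∀ k, θ k ∈ M.models) (h : Fin H) {β : ℝ} (hβ : 1 ≤ β)
    (hfit : ∀ k : Fin K, ∑ i : Fin k, (∫ x, E.tv (M.trans (θ k) h) (M.trans θstar h) x.1 x.2
      ∂E.visit (M.trans θstar) (plan (θ (Fin.castLE k.isLt.le i))).toHist h) ^ 2 ≤ 13 * β) :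
    ∑ k, ∫ x, E.tv (M.trans (θ k) h) (M.trans θstar h) x.1 x.2
      ∂E.visit (M.trans θstar) (plan (θ k)).toHist h ≤
      10 * Real.log (Real.exp 1 + K + B) * (α * √(K * d * β)) := by
  have hp := M.trans_isTransDensity hstar
  have hl1 := one_le_log_exp_one_add (Nat.cast_nonneg K) hB
  set ℓ := Real.log (Real.exp 1 + K + B) with hℓ
  obtain ⟨f, g, hfg⟩ := hwit
  set e : Fin K → Fin K → ℝ := fun i k => ∫ x, E.tv (M.trans (θ k) h) (M.trans θstar h) x.1 x.2
      ∂E.visit (M.trans θstar) (plan (θ i)).toHist h with he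
  have he0 : ∀ i k, 0 ≤ e i k := fun i k => E.integral_tv_nonneg _ _ _
  have hlow : ∀ i k, e i k ≤ ∑ j, f h (θ i) j * g h (θ k) j := fun i k =>
    (hfg h _ (hθ i) _ (hθ k)).1
  have hup : ∀ i k, ∑ j, f h (θ i) j * g h (θ k) j ≤ α * e i k := fun i k => by
    have := (hfg h _ (hθ i) _ (hθ k)).2.1
    rwa [inv_mul_le_iff₀ hα] at this
  rcases lt_or_ge α 1 with hα1 | hα1
  -- For `α < 1` the condition reads `e ≤ ⟨f, g⟩ ≤ α * e`, so all errors vanish.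
  · refine (Finset.sum_nonpos fun k _ => ?_).trans (by positivity)
    change e k k ≤ 0
    nlinarith [hlow k k, hup k k, he0 k k]
  have hR : 0 ≤ α ^ 2 * (13 * β) := by positivity
  have hmain := sum_le_sqrt_of_bilinear_l1 (fun k => f h (θ k)) (fun k => g h (θ k))
    (fun k => e k k) hR (fun i k => (hfg h _ (hθ i) _ (hθ k)).2.2)
    (fun k => by
      refine le_trans (Finset.sum_le_sum fun i _ => ?_)
        ((Finset.mul_sum _ _ _).symm.le.trans (mul_le_mul_of_nonneg_left (hfit k) (sq_nonneg α)))
      rw [← mul_pow]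
      exact pow_le_pow_left₀ ((he0 _ _).trans (hlow _ _)) (hup _ _) 2)
    (fun k =>
      have := E.isProbabilityMeasure_visit (plan (θ k)).toHist hp h
      E.integral_tv_le_one (M.trans_isTransDensity (hθ k) h) (hp h) _)
    (fun k => hlow k k)
  refine hmain.trans ?_
  have hlog := log_one_add_mul_sq_le (Nat.cast_nonneg K) hB
  have hrhs : 10 * ℓ * (α * √(K * d * β)) = √((10 * ℓ * α) ^ 2 * (K * d * β)) := by
    rw [Real.sqrt_mul (sq_nonneg _), Real.sqrt_sq (by positivity)]
    ring
  rw [hrhs]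
  refine Real.sqrt_le_sqrt ?_
  -- Absorbs the `1` of the regularizer: `1 + 13 * α ^ 2 * β ≤ 14 * α ^ 2 * β`. With `2 * 3` from
  -- the potential and the logarithm this is `84`, rounded up to `10 ^ 2`.
  have hαβ : 1 ≤ α ^ 2 * β := by nlinarith [mul_nonneg (sub_nonneg.2 hα1) (zero_le_one.trans hα1)]
  calc (1 + α ^ 2 * (13 * β)) * (K * (2 * (d * Real.log (1 + K * B ^ 2))))
      ≤ (14 * (α ^ 2 * β)) * (K * (2 * (d * (3 * ℓ)))) := by
        have : 0 ≤ Real.log (1 + K * B ^ 2) := Real.log_nonneg (by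
          have : 0 ≤ K * B ^ 2 := by positivity
          linarith)
        gcongr
        linarith
    _ = 84 * ℓ * (α ^ 2 * (K * d * β)) := by ring
    _ ≤ 100 * ℓ ^ 2 * (α ^ 2 * (K * d * β)) := by
        gcongr
        · norm_num
        · nlinarith
    _ = _ := by ring

variable {K : ℕ} {Ω : Type*} [MeasurableSpace Ω] {P : Measure Ω} [IsProbabilityMeasure P]
  {ρ : Measure ℝ → ℝ} {δ : ℝ}
  {mle θhat : (k : Fin K) → (Fin k → Traj S A H) → Fin H → Par} {X : Fin K → Ω → Traj S A H}

/-- Total estimation error of the return distributions under the witness rank condition. -/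
theorem IsMLERun.measure_not_sum_cdfDist_le (hH : 1 ≤ H) (hK : 1 ≤ K) (hδ : 0 < δ) (hδ1 : δ ≤ 1)
    (hstar : θstar ∈ M.models) (hbr : ∃ n, M.HasBracketing (1 / K) n)
    (run : IsMLERun M ρ (betaMLE H K (M.bracketingNumber (1 / K)) δ) θstar plan mle θhat P X)
    (hα : 0 < α) (hwit : M.WitnessRank θstar plan d α B) :
    P {ω | ¬ ∑ k : Fin K,
        cdfDist (E.returnLaw (M.trans (θhat k (past X k ω))) (plan (θhat k (past X k ω))).toHist)
          (E.returnLaw (M.trans θstar) (plan (θhat k (past X k ω))).toHist)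
        ≤ 20 * H * Real.log (Real.exp 1 + K + B) *
            (α * √(K * d * betaMLE H K (M.bracketingNumber (1 / K)) δ))} ≤ ENNReal.ofReal δ := by
  have hp := M.trans_isTransDensity hstar
  have hB := hwit.bound_nonneg hH hstar
  have hβ1 : 1 ≤ betaMLE H K (M.bracketingNumber (1 / K)) δ := by
    have hN1 := M.one_le_bracketingNumber hstar hbr
    have h1 := log_add_le_betaMLE hH hK hN1 hδ hδ1
    have h2 : 0 ≤ Real.log (M.bracketingNumber (1 / K) / δ) := by
      refine Real.log_nonneg ?_
      rw [le_div_iff₀ hδ]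
      have : (1 : ℝ) ≤ M.bracketingNumber (1 / K) := by exact_mod_cast hN1
      linarith
    have h3 : (1 : ℝ) ≤ H := by exact_mod_cast hH
    linarith
  refine le_trans (measure_mono fun ω hω => ?_)
    (run.measure_not_sum_sq_tv_le hH hK hδ hδ1 hstar hbr)
  intro hfit
  refine hω ?_
  have hmem : ∀ k, θhat k (past X k ω) ∈ M.models := fun k => (run.mem_confSet k _).1
  calc _ ≤ ∑ k, 2 * ∑ h, ∫ x, E.tv (M.trans (θhat k (past X k ω)) h) (M.trans θstar h) x.1 x.2
        ∂E.visit (M.trans θstar) (plan (θhat k (past X k ω))).toHist h :=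
        Finset.sum_le_sum fun k _ =>
          E.cdfDist_returnLaw_le _ hp (M.trans_isTransDensity (hmem k))
    _ = 2 * ∑ h, ∑ k, ∫ x, E.tv (M.trans (θhat k (past X k ω)) h) (M.trans θstar h) x.1 x.2
        ∂E.visit (M.trans θstar) (plan (θhat k (past X k ω))).toHist h := by
        rw [← Finset.mul_sum, Finset.sum_comm]
    _ ≤ 2 * ∑ _h : Fin H, 10 * Real.log (Real.exp 1 + K + B) *
          (α * √(K * d * betaMLE H K (M.bracketingNumber (1 / K)) δ)) := by
        gcongr with h
        exact hwit.sum_tv_le hα hB hstar (fun k => θhat k (past X k ω)) hmem h hβ1 (hfit h)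
    _ = _ := by
        simp only [Finset.sum_const, Finset.card_univ, Fintype.card_fin, nsmul_eq_mul]
        ring

end Witness

namespace Env

variable {S A : Type*} [MeasurableSpace S] [MeasurableSpace A] {H : ℕ} (E : Env S A H)
  {p : Fin H → TransFun S A}

/-! ### Range of the return -/

theorem histLaw_totalReward_notMem (hp : ∀ h, IsTransDensity E.base (p h)) (π : HistPolicy S A H)
    (n : ℕ) (hn : n ≤ H) :
    E.histLaw p π n hn {w | w.totalReward ∉ Set.Icc (0 : ℝ) n} = 0 := by
  have hmeas : ∀ m : ℕ, MeasurableSet {w : Hist S A m | w.totalReward ∉ Set.Icc (0 : ℝ) m} :=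
    fun m => Hist.measurable_totalReward measurableSet_Icc.compl
  induction n with
  | zero =>
    have : {w : Hist S A 0 | w.totalReward ∉ Set.Icc (0 : ℝ) (0 : ℕ)} = ∅ := by
      ext w
      simp [Hist.totalReward]
    rw [this, measure_empty]
  | succ n ih =>
    have hn' : n ≤ H := Nat.le_of_succ_le hn
    rw [← lintegral_indicator_one (hmeas (n + 1)), E.lintegral_histLaw_succ π hp n hn
      (measurable_one.indicator (hmeas (n + 1)))]
    have hae : ∀ᵐ w ∂E.histLaw p π n hn', w.totalReward ∈ Set.Icc (0 : ℝ) n := by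
      rw [ae_iff]
      exact ih hn'
    rw [lintegral_congr_ae (g := fun _ => 0), lintegral_zero]
    filter_upwards [hae] with w hw
    have hR : Measurable ((Set.Icc (0 : ℝ) 1)ᶜ.indicator (1 : ℝ → ℝ≥0∞)) :=
      measurable_one.indicator measurableSet_Icc.compl
    refine le_antisymm ?_ (zero_le)
    calc ∫⁻ z, {w : Hist S A (n + 1) | w.totalReward ∉ Set.Icc (0 : ℝ) (n + 1 : ℕ)}.indicator 1
          (Hist.extend (w, z)) ∂E.stepKer p π ⟨n, hn⟩ w
        ≤ ∫⁻ z, (Set.Icc (0 : ℝ) 1)ᶜ.indicator 1 z.2.1 ∂E.stepKer p π ⟨n, hn⟩ w := by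
          refine lintegral_mono fun z => ?_
          by_cases hz : z.2.1 ∈ Set.Icc (0 : ℝ) 1
          · have : (Hist.extend (w, z)).totalReward ∈ Set.Icc (0 : ℝ) (n + 1 : ℕ) := by
              rw [Hist.totalReward_extend]
              push_cast
              exact ⟨add_nonneg hw.1 hz.1, add_le_add hw.2 hz.2⟩
            refine (Set.indicator_of_notMem ?_ _).trans_le zero_le
            intro h
            exact h this
          · have hz' : z.2.1 ∈ (Set.Icc (0 : ℝ) 1)ᶜ := hz
            rw [Set.indicator_of_mem hz']
            exact Set.indicator_le_self' (by simp) _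
      _ = 0 := by
          rw [E.lintegral_stepKer π hp ⟨n, hn⟩ w
            (G := fun z => (Set.Icc (0 : ℝ) 1)ᶜ.indicator 1 z.2.1)
            (hR.comp (measurable_fst.comp measurable_snd))]
          have hin : ∀ a r, ∫⁻ s', p ⟨n, hn⟩ w.last a s' *
              (Set.Icc (0 : ℝ) 1)ᶜ.indicator (1 : ℝ → ℝ≥0∞) r ∂E.base =
              (Set.Icc (0 : ℝ) 1)ᶜ.indicator (1 : ℝ → ℝ≥0∞) r := by
            intro a r
            rw [lintegral_mul_const, (hp _).2, one_mul]
            exact ((hp ⟨n, hn⟩).1.comp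
              (measurable_prodMk_left (x := (w.last, a)))).coe_nnreal_ennreal
          simp only [hin]
          simp only [lintegral_indicator_one measurableSet_Icc.compl, E.reward_mem,
            lintegral_zero]

/-- The Lipschitz property of the risk measure is granted only for laws supported on `[0, H]`. -/
theorem returnLaw_compl_Icc (hp : ∀ h, IsTransDensity E.base (p h)) (π : HistPolicy S A H) :
    E.returnLaw p π (Set.Icc 0 (H : ℝ))ᶜ = 0 := by
  rw [returnLaw, Measure.map_apply Hist.measurable_totalReward measurableSet_Icc.compl]
  exact E.histLaw_totalReward_notMem hp π H le_rfl

/-! ### Policies of the augmented MDP suffice -/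

theorem measurable_augmented_step (h : Fin H) (hp : IsTransDensity E.base (p h))
    {G : S × ℝ → ℝ≥0∞} (hG : Measurable G) :
    Measurable fun y : (S × ℝ) × A => ∫⁻ r, ∫⁻ s', p h y.1.1 y.2 s' * G (s', y.1.2 + r) ∂E.base
      ∂E.rewardKer h (y.1.1, y.2) := by
  have := E.sigmaFinite_base
  have := E.isMarkov_rewardKer h
  have hpm : Measurable fun z : (((S × ℝ) × A) × ℝ) × S => (p h z.1.1.1.1 z.1.1.2 z.2 : ℝ≥0∞) :=
    (hp.1.comp (((measurable_fst.comp (measurable_fst.comp (measurable_fst.comp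
      measurable_fst))).prodMk (measurable_snd.comp (measurable_fst.comp
        measurable_fst))).prodMk measurable_snd)).coe_nnreal_ennreal
  have hin : Measurable fun z : ((S × ℝ) × A) × ℝ =>
      ∫⁻ s', p h z.1.1.1 z.1.2 s' * G (s', z.1.1.2 + z.2) ∂E.base :=
    Measurable.lintegral_prod_right' (f := fun z : (((S × ℝ) × A) × ℝ) × S =>
      (p h z.1.1.1.1 z.1.1.2 z.2 : ℝ≥0∞) * G (z.2, z.1.1.1.2 + z.1.2))
      (hpm.mul (hG.comp (by fun_prop)))
  exact hin.lintegral_kernel_prod_right'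
    (κ := (E.rewardKer h).comap (fun y : (S × ℝ) × A => (y.1.1, y.2)) (by fun_prop))

/-- Once the action is drawn, the next augmented state depends on the history only through the
current augmented state. Hence only the joint law of augmented state and action matters. -/
theorem lintegral_histLaw_succ_aug (hp : ∀ h, IsTransDensity E.base (p h)) (π : HistPolicy S A H)
    (n : ℕ) (hn : n + 1 ≤ H) {G : S × ℝ → ℝ≥0∞} (hG : Measurable G) :
    ∫⁻ w, G w.aug ∂E.histLaw p π (n + 1) hn =
      ∫⁻ w, ∫⁻ a, ∫⁻ r, ∫⁻ s', p ⟨n, hn⟩ w.aug.1 a s' * G (s', w.aug.2 + r) ∂E.base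
        ∂E.rewardKer ⟨n, hn⟩ (w.aug.1, a) ∂π.ker ⟨n, hn⟩ w
        ∂E.histLaw p π n (Nat.le_of_succ_le hn) := by
  rw [E.lintegral_histLaw_succ π hp n hn (G := fun w => G w.aug) (hG.comp Hist.measurable_aug)]
  refine lintegral_congr fun w => ?_
  simp only [Hist.aug_extend]
  exact E.lintegral_stepKer π hp ⟨n, hn⟩ w (G := fun z => G (z.2.2, w.aug.2 + z.2.1))
    (hG.comp (by fun_prop))

/-- Every history-dependent policy has the return distribution of a policy of the augmented
MDP. -/
theorem exists_augPolicy_returnLaw_eq [StandardBorelSpace A] [Nonempty A]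
    (hp : ∀ h, IsTransDensity E.base (p h)) (π : HistPolicy S A H) :
    ∃ π' : AugPolicy S A H, E.returnLaw p π'.toHist = E.returnLaw p π := by
  have hprob : ∀ n (hn : n ≤ H), IsProbabilityMeasure (E.histLaw p π n hn) :=
    E.isProbabilityMeasure_histLaw π hp
  have hmark := π.isMarkov
  set ν : (h : Fin H) → Measure (Hist S A h × A) :=
    fun h => E.histLaw p π h h.isLt.le ⊗ₘ π.ker h with hν
  -- The action of `π` is resampled from its conditional law given the augmented state; standard
  -- Borel actions make this law a kernel.
  set π' : AugPolicy S A H :=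
    { ker := fun h => condDistrib Prod.snd (fun z : Hist S A h × A => z.1.aug) (ν h)
      isMarkov := fun h => inferInstance } with hπ'
  have haugm : ∀ h : Fin H, Measurable fun z : Hist S A h × A => z.1.aug := fun h =>
    Hist.measurable_aug.comp measurable_fst
  have hmarg : ∀ h : Fin H, (ν h).map (fun z => z.1.aug) =
      (E.histLaw p π h h.isLt.le).map Hist.aug := by
    intro h
    rw [show (fun z : Hist S A h × A => z.1.aug) = Hist.aug ∘ Prod.fst from rfl,
      ← Measure.map_map Hist.measurable_aug measurable_fst]
    congr 1
    exact Measure.fst_compProd _ _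
  -- The laws of the augmented state agree at every time. The laws of whole histories need not, and
  -- the return is read off the final augmented state.
  have key : ∀ n (hn : n ≤ H) (G : S × ℝ → ℝ≥0∞), Measurable G →
      ∫⁻ w, G w.aug ∂E.histLaw p π'.toHist n hn = ∫⁻ w, G w.aug ∂E.histLaw p π n hn := by
    intro n
    induction n with
    | zero => intro hn G hG; rfl
    | succ n ih =>
      intro hn G hG
      have hn' : n ≤ H := Nat.le_of_succ_le hn
      rw [E.lintegral_histLaw_succ_aug hp _ n hn hG, E.lintegral_histLaw_succ_aug hp _ n hn hG]
      set T : (S × ℝ) × A → ℝ≥0∞ := fun y => ∫⁻ r, ∫⁻ s', p ⟨n, hn⟩ y.1.1 y.2 s' *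
        G (s', y.1.2 + r) ∂E.base ∂E.rewardKer ⟨n, hn⟩ (y.1.1, y.2) with hTdef
      have hT : Measurable T := E.measurable_augmented_step ⟨n, hn⟩ (hp _) hG
      have hk : IsMarkovKernel (π'.ker ⟨n, hn⟩) := π'.isMarkov _
      have hTk : Measurable fun y => ∫⁻ a, T (y, a) ∂π'.ker ⟨n, hn⟩ y :=
        hT.lintegral_kernel_prod_right'
      have hpr : IsProbabilityMeasure (ν ⟨n, hn⟩) := inferInstance
      have hpm : IsProbabilityMeasure ((E.histLaw p π n hn').map Hist.aug) :=
        Measure.isProbabilityMeasure_map Hist.measurable_aug.aemeasurable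
      calc _ = ∫⁻ w, ∫⁻ a, T (w.aug, a) ∂π'.ker ⟨n, hn⟩ w.aug ∂E.histLaw p π'.toHist n hn' := rfl
        _ = ∫⁻ w, ∫⁻ a, T (w.aug, a) ∂π'.ker ⟨n, hn⟩ w.aug ∂E.histLaw p π n hn' := ih hn' _ hTk
        _ = ∫⁻ y, ∫⁻ a, T (y, a) ∂π'.ker ⟨n, hn⟩ y ∂((E.histLaw p π n hn').map Hist.aug) :=
            (lintegral_map hTk Hist.measurable_aug).symm
        _ = ∫⁻ y, T y ∂((E.histLaw p π n hn').map Hist.aug ⊗ₘ π'.ker ⟨n, hn⟩) :=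
            (Measure.lintegral_compProd hT).symm
        _ = ∫⁻ y, T y ∂((ν ⟨n, hn⟩).map fun z => (z.1.aug, z.2)) := by
            have h1 := compProd_map_condDistrib (μ := ν ⟨n, hn⟩) (Y := Prod.snd)
              (X := fun z : Hist S A n × A => z.1.aug) (mβ := inferInstance)
              measurable_snd.aemeasurable
            rw [← h1]
            have h2 := hmarg ⟨n, hn⟩
            rw [h2]
        _ = ∫⁻ z, T (z.1.aug, z.2) ∂ν ⟨n, hn⟩ :=
            lintegral_map hT ((haugm ⟨n, hn⟩).prodMk measurable_snd)
        _ = _ := Measure.lintegral_compProd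
            (hT.comp ((haugm ⟨n, hn⟩).prodMk measurable_snd))
  refine ⟨π', Measure.ext fun s hs => ?_⟩
  have hs' : MeasurableSet (Hist.totalReward ⁻¹' s : Set (Traj S A H)) :=
    Hist.measurable_totalReward hs
  have h := key H le_rfl (fun y => s.indicator 1 y.2)
    ((measurable_one.indicator hs).comp measurable_snd)
  rw [returnLaw, returnLaw, Measure.map_apply Hist.measurable_totalReward hs,
    Measure.map_apply Hist.measurable_totalReward hs, ← lintegral_indicator_one hs',
    ← lintegral_indicator_one hs']
  exact h

/-! ### Exploratory policies -/

section Explore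

variable [Fintype A] [Nonempty A]

theorem histLaw_explore (π : AugPolicy S A H) (j : Fin H) (n : ℕ) (hn : n ≤ H) (hnj : n ≤ j) :
    E.histLaw p (π.explore j).toHist n hn = E.histLaw p π.toHist n hn := by
  induction n with
  | zero => rfl
  | succ n ih =>
    have hlt : (⟨n, hn⟩ : Fin H) < j := Fin.lt_def.2 hnj
    have hker : (π.explore j).toHist.ker ⟨n, hn⟩ = π.toHist.ker ⟨n, hn⟩ := by
      ext w s hs
      simp [AugPolicy.toHist, AugPolicy.explore, hlt]
    have hstep : E.stepKer p (π.explore j).toHist ⟨n, hn⟩ = E.stepKer p π.toHist ⟨n, hn⟩ := by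
      unfold stepKer
      rw [hker]
    rw [histLaw, histLaw, hstep, ih _ (Nat.le_of_succ_le hnj)]

variable [MeasurableSingletonClass A]

theorem lintegral_visit_explore (hp : ∀ h, IsTransDensity E.base (p h)) (π : AugPolicy S A H)
    (j : Fin H) {G : S × A → ℝ≥0∞} (hG : Measurable G) :
    ∫⁻ x, G x ∂E.visit p (π.explore j).toHist j =
      ∫⁻ w, ∑ a, G (w.last, a) * (Fintype.card A : ℝ≥0∞)⁻¹ ∂E.histLaw p π.toHist j j.isLt.le := by
  rw [E.lintegral_visit _ hp j hG, E.histLaw_explore π j j _ le_rfl]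
  refine lintegral_congr fun w => ?_
  have hker : (π.explore j).toHist.ker j w = (PMF.uniformOfFintype A).toMeasure := by
    simp [AugPolicy.toHist, AugPolicy.explore]
  rw [hker, lintegral_fintype]
  refine Finset.sum_congr rfl fun a _ => ?_
  rw [PMF.toMeasure_apply_singleton _ _ (measurableSet_singleton a), PMF.uniformOfFintype_apply]

/-- Change of measure from a policy to uniform exploration. -/
theorem lintegral_visit_le_explore (hp : ∀ h, IsTransDensity E.base (p h)) (π : AugPolicy S A H)
    (j : Fin H) {G : S × A → ℝ≥0∞} (hG : Measurable G) :
    ∫⁻ x, G x ∂E.visit p π.toHist j ≤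
      Fintype.card A * ∫⁻ x, G x ∂E.visit p (π.explore j).toHist j := by
  rw [E.lintegral_visit_explore hp π j hG, E.lintegral_visit _ hp j hG,
    ← lintegral_const_mul' _ _ (ENNReal.natCast_ne_top _)]
  refine lintegral_mono fun w => ?_
  have := π.toHist.isMarkov j
  rw [← Finset.sum_mul, mul_comm (Fintype.card A : ℝ≥0∞), mul_assoc, ENNReal.inv_mul_cancel
    (by simp) (ENNReal.natCast_ne_top _), mul_one]
  -- `A` times the uniform average is the sum over all actions, which dominates every mixture.
  calc ∫⁻ a, G (w.last, a) ∂π.toHist.ker j w ≤ ∫⁻ _a, ∑ b, G (w.last, b) ∂π.toHist.ker j w :=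
        lintegral_mono fun a =>
          Finset.single_le_sum (f := fun b => G (w.last, b)) (fun _ _ => zero_le)
            (Finset.mem_univ a)
    _ = _ := by simp

end Explore

end Env

/-! ### Low-rank MDPs -/

section LowRank

variable {S A : Type*} [MeasurableSpace S] [MeasurableSpace A] {H d : ℕ} {E : Env S A H}
  {Q : LowRankClass E d}
  {θstar : Fin H → (S → A → EuclideanSpace ℝ (Fin d)) × (S → EuclideanSpace ℝ (Fin d))}

/-- In dimension zero all inner products vanish and cannot be densities. A coordinate vector and `1
≤ √d` are needed at the initial step. -/
theorem LowRankClass.one_le_dim [Nonempty A] (hH : 1 ≤ H)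
    (hstar : θstar ∈ Q.toModelClass.models) : 1 ≤ d := by
  refine Nat.one_le_iff_ne_zero.2 fun hd => ?_
  have := E.isProb_init
  obtain ⟨s⟩ : Nonempty S := E.init.nonempty_of_neZero
  obtain ⟨a⟩ := ‹Nonempty A›
  have h := hstar ⟨0, hH⟩
  have h1 := Q.lintegral_eq_one ⟨0, hH⟩ _ h.1 _ h.2 s a
  subst hd
  simp [PiLp.inner_apply] at h1

/-- Averages of a bounded function of the next state are bilinear in the low-rank embeddings. -/
theorem LowRankClass.toReal_lintegral_eq_inner (hstar : θstar ∈ Q.toModelClass.models)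
    (hnorm : LowRankClass.IsNormalized E θstar) (h : Fin H) (ν : Measure (S × A))
    [IsProbabilityMeasure ν] {G : S → ℝ≥0∞} (hG : Measurable G) (hG2 : ∀ s, G s ≤ 2) :
    (∫⁻ x, ∫⁻ s', Q.toModelClass.trans θstar h x.1 x.2 s' * G s' ∂E.base ∂ν).toReal =
      inner ℝ (∫ x, (θstar h).1 x.1 x.2 ∂ν) (∫ s, (G s).toReal • (θstar h).2 s ∂E.base) := by
  set φ := (θstar h).1 with hφ
  set ψ := (θstar h).2 with hψ
  obtain ⟨hφ1, hψint, -⟩ := hnorm h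
  have hφm : Measurable fun x : S × A => φ x.1 x.2 := Q.measurable_phi h _ (hstar h).1
  have hφint : Integrable (fun x : S × A => φ x.1 x.2) ν :=
    Integrable.of_bound hφm.aestronglyMeasurable 1 (Filter.Eventually.of_forall fun x => hφ1 _ _)
  have hGt : ∀ s, G s ≠ ∞ := fun s => ((hG2 s).trans_lt ENNReal.ofNat_lt_top).ne
  have hGψ : Integrable (fun s => (G s).toReal • ψ s) E.base := by
    refine Integrable.bdd_smul hψint 2 hG.ennreal_toReal.aestronglyMeasurable
      (Filter.Eventually.of_forall fun s => ?_)
    rw [Real.norm_of_nonneg ENNReal.toReal_nonneg]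
    exact ENNReal.toReal_le_of_le_ofReal (by norm_num) (by simpa using hG2 s)
  set v := ∫ s, (G s).toReal • ψ s ∂E.base with hv
  have hnn : ∀ s a s', 0 ≤ inner ℝ (φ s a) (ψ s') := Q.nonneg h _ (hstar h).1 _ (hstar h).2
  have hinner : ∀ x : S × A, ∫⁻ s', Q.toModelClass.trans θstar h x.1 x.2 s' * G s' ∂E.base =
      ENNReal.ofReal (inner ℝ (φ x.1 x.2) v) := by
    intro x
    rw [hv, ← integral_inner hGψ, ofReal_integral_eq_lintegral_ofReal (hGψ.const_inner _)]
    · refine lintegral_congr fun s' => ?_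
      rw [inner_smul_right, mul_comm, ENNReal.ofReal_mul ENNReal.toReal_nonneg,
        ENNReal.ofReal_toReal (hGt _)]
      rfl
    · refine Filter.Eventually.of_forall fun s' => ?_
      change 0 ≤ inner ℝ (φ x.1 x.2) ((G s').toReal • ψ s')
      rw [inner_smul_right]
      exact mul_nonneg ENNReal.toReal_nonneg (hnn _ _ _)
  have hvnn : ∀ x : S × A, 0 ≤ inner ℝ (φ x.1 x.2) v := by
    intro x
    rw [hv, ← integral_inner hGψ]
    refine integral_nonneg fun s' => ?_
    rw [inner_smul_right]
    exact mul_nonneg ENNReal.toReal_nonneg (hnn _ _ _)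
  simp only [hinner]
  rw [← ofReal_integral_eq_lintegral_ofReal (hφint.inner_const v)
    (Filter.Eventually.of_forall hvnn), ENNReal.toReal_ofReal (integral_nonneg hvnn),
    real_inner_comm, ← integral_inner hφint]
  simp only [real_inner_comm]

theorem Env.lintegral_histLaw_zero_last {p : Fin H → TransFun S A} (π : HistPolicy S A H)
    {G : S → ℝ≥0∞} (hG : Measurable G) :
    ∫⁻ w, G w.last ∂E.histLaw p π 0 (Nat.zero_le H) = ∫⁻ s, G s ∂E.init := by
  rw [Env.histLaw, lintegral_map (f := fun w : Hist S A 0 => G w.last)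
    (hG.comp Hist.measurable_last) (by fun_prop)]
  rfl

theorem Env.lintegral_histLaw_succ_last {p : Fin H → TransFun S A}
    (hp : ∀ h, IsTransDensity E.base (p h)) (π : HistPolicy S A H) (n : ℕ) (hn : n + 1 ≤ H)
    {G : S → ℝ≥0∞} (hG : Measurable G) :
    ∫⁻ w, G w.last ∂E.histLaw p π (n + 1) hn =
      ∫⁻ x, ∫⁻ s', p ⟨n, hn⟩ x.1 x.2 s' * G s' ∂E.base ∂E.visit p π ⟨n, hn⟩ := by
  rw [E.lintegral_histLaw_succ π hp n hn (G := fun w => G w.last) (hG.comp Hist.measurable_last),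
    E.lintegral_visit π hp ⟨n, hn⟩
      (E.measurable_lintegral_dens (hp _) (G := fun z => G z.2) (hG.comp measurable_snd))]
  refine lintegral_congr fun w => ?_
  simp only [Hist.last_extend]
  exact E.lintegral_stepKer_of_transition π hp ⟨n, hn⟩ w (G := fun y => G y.2)
    (hG.comp measurable_snd)

variable [Fintype A] [Nonempty A] [MeasurableSingletonClass A]

/-- The prediction errors of the exploratory policies are bilinear in policy and model. -/
theorem LowRankClass.exists_bilinear_tv (hH : 1 ≤ H) (hstar : θstar ∈ Q.toModelClass.models)
    (hnorm : LowRankClass.IsNormalized E θstar) (h : Fin H) :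
    ∃ f : AugPolicy S A H → EuclideanSpace ℝ (Fin d), (∀ π, ‖f π‖ ≤ 1) ∧
      ∀ q : TransFun S A, IsTransDensity E.base q → ∃ v : EuclideanSpace ℝ (Fin d), ‖v‖ ≤ √d ∧
        ∀ π : AugPolicy S A H, ∫ x, E.tv q (Q.toModelClass.trans θstar h) x.1 x.2
          ∂E.visit (Q.toModelClass.trans θstar) (π.explore h).toHist h = inner ℝ (f π) v := by
  have hp := Q.toModelClass.trans_isTransDensity hstar
  have hd := LowRankClass.one_le_dim hH hstar
  have hd1 : (1 : ℝ) ≤ √d := by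
    rw [Real.one_le_sqrt]
    exact_mod_cast hd
  set pstar := Q.toModelClass.trans θstar with hpstar
  have hexp : ∀ (q : TransFun S A), IsTransDensity E.base q → ∀ π : AugPolicy S A H,
      ∫ x, E.tv q (pstar h) x.1 x.2 ∂E.visit pstar (π.explore h).toHist h =
        (∫⁻ w, ∑ a, E.l1 q (pstar h) (w.last, a) * (Fintype.card A : ℝ≥0∞)⁻¹
          ∂E.histLaw pstar π.toHist h h.isLt.le).toReal / 2 := fun q hq π => by
    rw [E.integral_tv hq (hp h), E.lintegral_visit_explore hp π h (E.measurable_l1 hq.1 (hp h).1)]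
  have hGm : ∀ q : TransFun S A, IsTransDensity E.base q → Measurable fun s =>
      ∑ a, E.l1 q (pstar h) (s, a) * (Fintype.card A : ℝ≥0∞)⁻¹ := fun q hq =>
    Finset.measurable_fun_sum _ fun a _ =>
      ((E.measurable_l1 hq.1 (hp h).1).comp measurable_prodMk_right).mul_const _
  have hG2 : ∀ q : TransFun S A, IsTransDensity E.base q → ∀ s,
      ∑ a, E.l1 q (pstar h) (s, a) * (Fintype.card A : ℝ≥0∞)⁻¹ ≤ 2 := by
    intro q hq s
    rw [← Finset.sum_mul]
    calc _ ≤ (∑ _a : A, (2 : ℝ≥0∞)) * (Fintype.card A : ℝ≥0∞)⁻¹ :=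
          mul_le_mul_left (Finset.sum_le_sum fun a _ => E.l1_le_two hq (hp h) _) _
      _ = 2 := by
          rw [Finset.sum_const, Finset.card_univ, nsmul_eq_mul, mul_comm (Fintype.card A : ℝ≥0∞),
            mul_assoc, ENNReal.mul_inv_cancel (by simp) (ENNReal.natCast_ne_top _), mul_one]
  obtain ⟨n, hn⟩ := h
  rcases n with _ | n
  -- At the initial step there is no preceding transition, but the exploratory error does not depend
  -- on the policy, so a fixed unit vector serves for `f`.
  · refine ⟨fun _ => EuclideanSpace.single ⟨0, hd⟩ 1, fun π => by simp, fun q hq => ?_⟩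
    set c := (∫⁻ s, ∑ a, E.l1 q (pstar ⟨0, hn⟩) (s, a) * (Fintype.card A : ℝ≥0∞)⁻¹
      ∂E.init).toReal / 2 with hc
    have := E.isProb_init
    have hc1 : |c| ≤ 1 := by
      rw [abs_of_nonneg (by positivity)]
      have h2 : ∫⁻ s, ∑ a, E.l1 q (pstar ⟨0, hn⟩) (s, a) * (Fintype.card A : ℝ≥0∞)⁻¹
          ∂E.init ≤ 2 := (lintegral_mono fun s => hG2 q hq s).trans (by simp)
      have h3 := ENNReal.toReal_mono ENNReal.ofNat_ne_top h2
      simp only [ENNReal.toReal_ofNat] at h3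
      linarith
    refine ⟨EuclideanSpace.single ⟨0, hd⟩ c, ?_, fun π => ?_⟩
    · simpa using hc1.trans hd1
    · rw [hexp q hq π, EuclideanSpace.inner_single_left,
        E.lintegral_histLaw_zero_last π.toHist (hGm q hq)]
      simp [hc]
  · have hn' : n < H := Nat.lt_of_succ_lt hn
    -- The policy enters through its mean feature at the preceding step; the model enters through
    -- the action-averaged `L¹` error integrated against `ψ`. That error is at most `2`, which the
    -- factor `2⁻¹` of total variation offsets in the norm bound.
    refine ⟨fun π => ∫ x, (θstar ⟨n, hn'⟩).1 x.1 x.2 ∂E.visit pstar π.toHist ⟨n, hn'⟩,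
      fun π => ?_, fun q hq => ?_⟩
    · have := E.isProbabilityMeasure_visit π.toHist hp ⟨n, hn'⟩
      refine (norm_integral_le_of_norm_le_const (C := 1) (Filter.Eventually.of_forall fun x =>
        (hnorm ⟨n, hn'⟩).1 _ _)).trans ?_
      simp
    · refine ⟨(2 : ℝ)⁻¹ • ∫ s, (∑ a, E.l1 q (pstar ⟨n + 1, hn⟩) (s, a) *
        (Fintype.card A : ℝ≥0∞)⁻¹).toReal • (θstar ⟨n, hn'⟩).2 s ∂E.base, ?_, fun π => ?_⟩
      · have h1 := (hnorm ⟨n, hn'⟩).2.2 _ 2 (hGm q hq).ennreal_toReal (fun s => by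
          rw [abs_of_nonneg ENNReal.toReal_nonneg]
          exact ENNReal.toReal_le_of_le_ofReal (by norm_num) (by simpa using hG2 q hq s))
        rw [norm_smul]
        norm_num
        linarith
      · have := E.isProbabilityMeasure_visit π.toHist hp ⟨n, hn'⟩
        rw [hexp q hq π, inner_smul_right,
          ← LowRankClass.toReal_lintegral_eq_inner hstar hnorm ⟨n, hn'⟩ _ (hGm q hq) (hG2 q hq),
          ← E.lintegral_histLaw_succ_last hp π.toHist n hn' (hGm q hq)]
        ring

end LowRank

/-! ### Regret in low-rank MDPs -/

/-- The trajectories of one round are independent given the past, so the expected weight of a round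
factors. -/
theorem lintegral_pi_prod {ι D : Type*} [Fintype ι] [MeasurableSpace D] (μ : ι → Measure D)
    [∀ i, IsProbabilityMeasure (μ i)] {w : ι → D → ℝ≥0∞} (hw : ∀ i, Measurable (w i)) :
    ∫⁻ y, ∏ i, w i (y i) ∂Measure.pi μ = ∏ i, ∫⁻ x, w i x ∂μ i := by
  rw [lintegral_prod_eq_prod_lintegral_of_indepFun (μ := Measure.pi μ) Finset.univ
    (fun i (y : ι → D) => w i (y i)) (iIndepFun_pi (X := w) fun i => (hw i).aemeasurable)
    (fun i => (hw i).comp (measurable_pi_apply i))]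
  exact Finset.prod_congr rfl fun i _ => (measurePreserving_eval μ i).lintegral_comp (hw i)

/-- Lipschitz constants of risk measures are nonnegative. -/
theorem IsLipschitzRisk.nonneg {H : ℕ} {ρ : Measure ℝ → ℝ} {L : ℝ} (hρ : IsLipschitzRisk H ρ L)
    (hH : 1 ≤ H) : 0 ≤ L := by
  have hH' : (1 : ℝ) ≤ H := by exact_mod_cast hH
  -- Two point masses in `[0, H]` whose distribution functions differ by `1` at `0`; a negative
  -- constant would bound an absolute value by a negative number.
  have h := hρ (Measure.dirac 0) (Measure.dirac 1) inferInstance inferInstance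
    (by simp [measurableSet_Icc.compl]) (by simp [measurableSet_Icc.compl, hH'])
  have hbdd : BddAbove (Set.range fun x : ℝ =>
      |cdf (Measure.dirac (0 : ℝ)) x - cdf (Measure.dirac (1 : ℝ)) x|) := by
    refine ⟨1, ?_⟩
    rintro _ ⟨x, rfl⟩
    have h1 := cdf_nonneg (Measure.dirac (0 : ℝ)) x
    have h2 := cdf_nonneg (Measure.dirac (1 : ℝ)) x
    have h3 := cdf_le_one (Measure.dirac (0 : ℝ)) x
    have h4 := cdf_le_one (Measure.dirac (1 : ℝ)) x
    rw [abs_le]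
    constructor <;> linarith
  have hpos : 1 ≤ cdfDist (Measure.dirac (0 : ℝ)) (Measure.dirac 1) := by
    refine le_trans ?_ (le_ciSup hbdd 0)
    simp [cdf_eq_real, measureReal_def, measurableSet_Iic]
  by_contra hL
  push Not at hL
  nlinarith [abs_nonneg (ρ (Measure.dirac 0) - ρ (Measure.dirac 1))]

section LowRankRegret

variable {S A : Type*} [MeasurableSpace S] [MeasurableSpace A] {H d : ℕ} {E : Env S A H}
  {Q : LowRankClass E d}
  {θstar : Fin H → (S → A → EuclideanSpace ℝ (Fin d)) × (S → EuclideanSpace ℝ (Fin d))}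

/-- The models of a low-rank class. -/
def LowRankClass.modelFinset (Q : LowRankClass E d) :
    Finset (Fin H → (S → A → EuclideanSpace ℝ (Fin d)) × (S → EuclideanSpace ℝ (Fin d))) :=
  Fintype.piFinset fun h => Q.Phi h ×ˢ Q.Psi h

theorem LowRankClass.mem_modelFinset
    {θ : Fin H → (S → A → EuclideanSpace ℝ (Fin d)) × (S → EuclideanSpace ℝ (Fin d))} :
    θ ∈ Q.modelFinset ↔ θ ∈ Q.toModelClass.models := by
  simp only [modelFinset, Fintype.mem_piFinset, Finset.mem_product]
  rfl

theorem LowRankClass.card_modelFinset : Q.modelFinset.card = Q.card := by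
  simp [modelFinset, card, Fintype.card_piFinset, Finset.card_product, Finset.prod_mul_distrib]

theorem LowRankClass.card_pos (hstar : θstar ∈ Q.toModelClass.models) : 0 < Q.card := by
  rw [← Q.card_modelFinset]
  exact Finset.card_pos.2 ⟨θstar, LowRankClass.mem_modelFinset.2 hstar⟩

variable [Fintype A] [Nonempty A]
  {K : ℕ} {Ω : Type*} [MeasurableSpace Ω] {P : Measure Ω} [IsProbabilityMeasure P]
  {ρ : Measure ℝ → ℝ} {δ β L : ℝ}
  {plan : (Fin H → (S → A → EuclideanSpace ℝ (Fin d)) × (S → EuclideanSpace ℝ (Fin d))) →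
    AugPolicy S A H}
  {mle θhat : (k : Fin K) → (Fin k → Fin H → Traj S A H) →
    Fin H → (S → A → EuclideanSpace ℝ (Fin d)) × (S → EuclideanSpace ℝ (Fin d))}
  {X : Fin K → Ω → (Fin H → Traj S A H)}

theorem IsExploratoryMLERun.ae_transAt_pos (hstar : θstar ∈ Q.toModelClass.models)
    (run : IsExploratoryMLERun Q.toModelClass ρ β θstar plan mle θhat P X) :
    ∀ᵐ ω ∂P, ∀ k j h,
      0 < transAt (Q.toModelClass.trans θstar h) ((X k ω j).transition h) := by
  have hp := Q.toModelClass.trans_isTransDensity hstar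
  have hZ := E.measurableSet_transAt_eq_zero hp
  have hae : ∀ j, ∀ᵐ ω ∂P, ∀ k, X k ω ∉ Function.eval j ⁻¹'
      {w : Traj S A H | ∃ h, transAt (Q.toModelClass.trans θstar h) (w.transition h) = 0} := by
    intro j
    refine run.sample.ae_of_forall_law (measurable_pi_apply j hZ) fun k x => ?_
    have := fun i => E.isProbabilityMeasure_trajLaw ((plan (θhat k x)).explore i).toHist hp
    rw [(measurePreserving_eval (fun i => E.trajLaw (Q.toModelClass.trans θstar)
      ((plan (θhat k x)).explore i).toHist) j).measure_preimage hZ.nullMeasurableSet]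
    exact E.trajLaw_transAt_eq_zero hp _
  filter_upwards [ae_all_iff.2 hae] with ω hω k j h
  exact pos_iff_ne_zero.2 fun h0 => hω j k ⟨h, h0⟩

/-- The true model lies in all confidence sets with high probability. -/
theorem IsExploratoryMLERun.measure_not_mem_confSet_le (hδ : 0 < δ)
    (hstar : θstar ∈ Q.toModelClass.models) (hβ : β = Real.log (Q.card / δ))
    (run : IsExploratoryMLERun Q.toModelClass ρ β θstar plan mle θhat P X) :
    P {ω | ¬ ∀ k : Fin K, θstar ∈ Q.toModelClass.confSet β
      (flatten (past X k ω)) (mle k (past X k ω))} ≤ ENNReal.ofReal δ := by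
  have hp := Q.toModelClass.trans_isTransDensity hstar
  have hN0 : (0 : ℝ) < Q.card := by exact_mod_cast LowRankClass.card_pos hstar
  have hT : 0 < Q.card / δ := by positivity
  have hexp : Real.exp β = Q.card / δ := by rw [hβ, Real.exp_log hT]
  have hdens : ∀ θ ∈ Q.modelFinset, ∀ h, IsTransDensity E.base (Q.toModelClass.trans θ h) :=
    fun θ hθ => Q.toModelClass.trans_isTransDensity (LowRankClass.mem_modelFinset.1 hθ)
  have hwm : ∀ θ ∈ Q.modelFinset, Measurable fun w : Traj S A H =>
      ∏ h, ((transAt (Q.toModelClass.trans θ h) (w.transition h) /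
        transAt (Q.toModelClass.trans θstar h) (w.transition h) : ℝ≥0) : ℝ≥0∞) := fun θ hθ =>
    Finset.measurable_fun_prod _ fun h _ =>
      (((hdens θ hθ h).1.div (hp h).1).comp (Hist.measurable_transition h)).coe_nnreal_ennreal
  have hconc := run.sample.measure_exists_lt_prod_mul_exp_le Q.modelFinset
    (fun θ y => ∏ j, ∏ h, ((transAt (Q.toModelClass.trans θ h) ((y j).transition h) /
      transAt (Q.toModelClass.trans θstar h) ((y j).transition h) : ℝ≥0) : ℝ≥0∞))
    (fun θ hθ => Finset.measurable_fun_prod _ fun j _ =>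
      (hwm θ hθ).comp (measurable_pi_apply j))
    -- For a finite class the ratios are those of genuine densities, so there is no bracketing
    -- slack.
    (fun _ _ _ => 0) (fun _ _ _ => measurable_const)
    (fun θ hθ k x => by
      have := fun i => E.isProbabilityMeasure_trajLaw ((plan (θhat k x)).explore i).toHist hp
      have h1 := lintegral_pi_prod (fun j => E.trajLaw (Q.toModelClass.trans θstar)
        ((plan (θhat k x)).explore j).toHist) (fun _ : Fin H => hwm θ hθ)
      rw [neg_zero, Real.exp_zero, ENNReal.ofReal_one]
      refine h1.le.trans (Finset.prod_le_one' fun j _ => ?_)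
      have h2 := E.lintegral_trajLaw_prod_ratio_le hp ((plan (θhat k x)).explore j).toHist
        (fun h => (hdens θ hθ h).1) (c := 1) (fun h s a => ((hdens θ hθ h).2 s a).le)
      rwa [one_pow] at h2) hT
  refine (measure_mono_ae ?_).trans (hconc.trans (ENNReal.ofReal_le_ofReal ?_))
  · filter_upwards [run.ae_transAt_pos hstar] with ω hpos hbad
    by_contra hgood
    refine hbad fun k => Q.toModelClass.mem_confSet_iff.2 ⟨hstar, ?_⟩
    have hmle := Q.toModelClass.mem_models_of_isMLE (run.isMLE k (past X k ω))
    have hk : ¬ ENNReal.ofReal (Q.card / δ) < _ := fun hlt =>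
      hgood ⟨_, LowRankClass.mem_modelFinset.2 hmle, k, hlt⟩
    rw [not_lt] at hk
    simp only [← ENNReal.ofNNReal_finsetProd, Finset.sum_const_zero, Real.exp_zero,
      ENNReal.ofReal_one, mul_one] at hk
    rw [← ENNReal.ofReal_coe_nnreal, ENNReal.ofReal_le_ofReal_iff hT.le] at hk
    set θm := mle k (past X k ω) with hθm
    set ratio : ℝ≥0 := ∏ i : Fin k, ∏ j, ∏ h,
      (transAt (Q.toModelClass.trans θm h) ((past X k ω i j).transition h) /
        transAt (Q.toModelClass.trans θstar h) ((past X k ω i j).transition h)) with hratio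
    have hratio_le : (ratio : ℝ) ≤ Real.exp β := hexp ▸ hk
    have hlik : ∏ h, Q.toModelClass.stepLik (flatten (past X k ω)) h (θm h) =
        ratio * ∏ h, Q.toModelClass.stepLik (flatten (past X k ω)) h (θstar h) := by
      have h1 : ratio = ∏ h, ∏ z : Fin k × Fin H,
          (transAt (Q.toModelClass.trans θm h) ((past X k ω z.1 z.2).transition h) /
            transAt (Q.toModelClass.trans θstar h) ((past X k ω z.1 z.2).transition h)) := by
        rw [Finset.prod_comm, Fintype.prod_prod_type]
      rw [h1, ← Finset.prod_mul_distrib]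
      refine Finset.prod_congr rfl fun h _ => ?_
      rw [ModelClass.stepLik, ModelClass.stepLik, ← Finset.prod_mul_distrib]
      refine Finset.prod_congr rfl fun z _ => ?_
      exact (div_mul_cancel₀ _ (hpos _ _ h).ne').symm
    have hlik' := congrArg NNReal.toReal hlik
    push_cast at hlik'
    rw [hlik']
    exact mul_le_mul_of_nonneg_right hratio_le
      (Finset.prod_nonneg fun h _ => NNReal.coe_nonneg _)
  · rw [LowRankClass.card_modelFinset]
    exact le_of_eq (by field_simp)

/-- The selected models predict the exploratory past well, with high probability. -/
theorem IsExploratoryMLERun.measure_not_sum_sq_tv_le (hH : 1 ≤ H) (hδ : 0 < δ)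
    (hstar : θstar ∈ Q.toModelClass.models) (hβ : β = Real.log (Q.card / δ))
    (run : IsExploratoryMLERun Q.toModelClass ρ β θstar plan mle θhat P X) :
    P {ω | ¬ ∀ (h : Fin H) (k : Fin K), ∑ i : Fin k,
      (∫ x, E.tv (Q.toModelClass.trans (θhat k (past X k ω)) h)
          (Q.toModelClass.trans θstar h) x.1 x.2
        ∂E.visit (Q.toModelClass.trans θstar) ((plan (θhat (Fin.castLE k.isLt.le i)
          (past X (Fin.castLE k.isLt.le i) ω))).explore h).toHist h) ^ 2 ≤
      3 * (Real.log H + 3 / 2 * β)} ≤ ENNReal.ofReal δ := by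
  have hp := Q.toModelClass.trans_isTransDensity hstar
  have hN0 : (0 : ℝ) < Q.card := by exact_mod_cast LowRankClass.card_pos hstar
  have hH0 : (0 : ℝ) < H := by exact_mod_cast hH
  have hT : 0 < Q.card * H / δ := by positivity
  have hlogT : Real.log (Q.card * H / δ) = β + Real.log H := by
    rw [hβ, ← Real.log_mul (by positivity) (by positivity)]
    congr 1
    ring
  have hdens : ∀ θ ∈ Q.modelFinset, ∀ h, IsTransDensity E.base (Q.toModelClass.trans θ h) :=
    fun θ hθ => Q.toModelClass.trans_isTransDensity (LowRankClass.mem_modelFinset.1 hθ)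
  have hmem : ∀ {i}, i ∈ Q.modelFinset ×ˢ (Finset.univ : Finset (Fin H)) →
      IsTransDensity E.base (Q.toModelClass.trans i.1 i.2) := fun {i} hi =>
    hdens i.1 (Finset.mem_product.1 hi).1 i.2
  have hwm : ∀ i ∈ Q.modelFinset ×ˢ (Finset.univ : Finset (Fin H)),
      Measurable fun w : Traj S A H =>
        (NNReal.sqrt (transAt (Q.toModelClass.trans i.1 i.2) (w.transition i.2) /
          transAt (Q.toModelClass.trans θstar i.2) (w.transition i.2)) : ℝ≥0∞) := fun i hi =>
    (NNReal.continuous_sqrt.measurable.comp (((hmem hi).1.div (hp i.2).1).comp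
      (Hist.measurable_transition i.2))).coe_nnreal_ennreal
  set D : (Fin H → (S → A → EuclideanSpace ℝ (Fin d)) × (S → EuclideanSpace ℝ (Fin d))) × Fin H →
      AugPolicy S A H → Fin H → ℝ := fun i π j =>
    (∫⁻ x, E.l1 (Q.toModelClass.trans i.1 i.2) (Q.toModelClass.trans θstar i.2) x
      ∂E.visit (Q.toModelClass.trans θstar) (π.explore j).toHist i.2).toReal with hD
  have hconc := run.sample.measure_exists_lt_prod_mul_exp_le
    (Q.modelFinset ×ˢ (Finset.univ : Finset (Fin H)))
    (fun i y => ∏ j, (NNReal.sqrt (transAt (Q.toModelClass.trans i.1 i.2) ((y j).transition i.2) /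
      transAt (Q.toModelClass.trans θstar i.2) ((y j).transition i.2)) : ℝ≥0∞))
    (fun i hi => Finset.measurable_fun_prod _ fun j _ =>
      (hwm i hi).comp (measurable_pi_apply j))
    -- Only the trajectory that starts exploring at the step in question is credited; the other
    -- trajectories of the round contribute factors of expectation at most `1`.
    (fun i k x => D i (plan (θhat k x)) i.2 ^ 2 / 12)
    (fun i hi k => by
      obtain ⟨κ, -, hκ, -⟩ := run.sample.2 k
      have hκ' : ∀ x, (κ.map (Function.eval i.2)) x = E.trajLaw (Q.toModelClass.trans θstar)
          ((plan (θhat k x)).explore i.2).toHist := by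
        intro x
        have := fun j => E.isProbabilityMeasure_trajLaw ((plan (θhat k x)).explore j).toHist hp
        rw [Kernel.map_apply _ (measurable_pi_apply i.2), hκ]
        exact (measurePreserving_eval _ i.2).map_eq
      exact ((measurable_toReal_lintegral_visit hκ' i.2
        (E.measurable_l1 (hmem hi).1 (hp i.2).1)).pow_const 2).div_const _)
    (fun i hi k x => by
      have := fun j => E.isProbabilityMeasure_trajLaw ((plan (θhat k x)).explore j).toHist hp
      have h1 := lintegral_pi_prod (fun j => E.trajLaw (Q.toModelClass.trans θstar)
        ((plan (θhat k x)).explore j).toHist) (fun _ : Fin H => hwm i hi)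
      have h2 : ∀ j, ∫⁻ w, (NNReal.sqrt (transAt (Q.toModelClass.trans i.1 i.2)
          (w.transition i.2) / transAt (Q.toModelClass.trans θstar i.2) (w.transition i.2)) : ℝ≥0∞)
          ∂E.trajLaw (Q.toModelClass.trans θstar) ((plan (θhat k x)).explore j).toHist ≤
          ENNReal.ofReal (Real.exp (-(D i (plan (θhat k x)) j ^ 2 / 12))) := by
        intro j
        have h3 := E.lintegral_trajLaw_sqrt_ratio_le hp ((plan (θhat k x)).explore j).toHist i.2
          (hmem hi).1 le_rfl zero_le_one (fun s a => by simpa using ((hmem hi).2 s a).le)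
        simpa using h3
      refine h1.le.trans ?_
      rw [← Finset.mul_prod_erase _ _ (Finset.mem_univ i.2)]
      refine (mul_le_mul' (h2 i.2) (Finset.prod_le_one' fun j _ => (h2 j).trans ?_)).trans
        (mul_one _).le
      rw [ENNReal.ofReal_le_one, Real.exp_le_one_iff]
      have : 0 ≤ D i (plan (θhat k x)) j ^ 2 / 12 := by positivity
      linarith) hT
  refine (measure_mono_ae ?_).trans (hconc.trans (ENNReal.ofReal_le_ofReal ?_))
  · filter_upwards [run.ae_transAt_pos hstar] with ω hpos hbad
    by_contra hgood
    refine hbad fun h k => ?_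
    have hmemθ := (run.optimistic k (past X k ω)).1
    have hθd := Q.toModelClass.trans_isTransDensity hmemθ.1 h
    have hlik := Q.toModelClass.stepLik_le_of_mem_confSet (run.isMLE k (past X k ω)) hstar
      (fun h => Finset.prod_pos fun i _ => hpos _ _ h) hmemθ h
    have hq := le_log_add_of_prod_sqrt_ratio_le (ι := Fin k × Fin H)
      (fun i => hpos (Fin.castLE k.isLt.le i.1) i.2 h)
      (fun i => le_rfl) hT hlik (q := ∑ i : Fin k, D (θhat k (past X k ω), h)
        (plan (θhat (Fin.castLE k.isLt.le i) (past X (Fin.castLE k.isLt.le i) ω))) h ^ 2 / 12)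
      (fun hlt => hgood ⟨(θhat k (past X k ω), h), Finset.mem_product.2
        ⟨LowRankClass.mem_modelFinset.2 hmemθ.1, Finset.mem_univ _⟩, k, by
          rw [Fintype.prod_prod_type] at hlt
          exact hlt⟩)
    -- Now the sum of `D ^ 2` is at most `12 * (log H + 3 / 2 * β)`, and total variation squared is
    -- `D ^ 2 / 4`.
    rw [hlogT, ← Finset.sum_div] at hq
    simp only [E.integral_tv hθd (hp h), div_pow, ← Finset.sum_div]
    change (∑ i : Fin k, D (θhat k (past X k ω), h) (plan (θhat (Fin.castLE k.isLt.le i)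
      (past X (Fin.castLE k.isLt.le i) ω))) h ^ 2) / 2 ^ 2 ≤ _
    linarith
  · rw [Finset.card_product, LowRankClass.card_modelFinset]
    push_cast
    rw [Finset.card_univ, Fintype.card_fin]
    exact le_of_eq (by field_simp)

variable [MeasurableSingletonClass A]

/-- The potential argument applied to the bilinear form of the exploratory errors. Since the
embedded policies have norm at most `1`, the logarithm involves only `K`. -/
theorem LowRankClass.sum_tv_explore_le (hH : 1 ≤ H) (hstar : θstar ∈ Q.toModelClass.models)
    (hnorm : LowRankClass.IsNormalized E θstar) (h : Fin H) (hβ : 1 / 2 ≤ β)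
    (θ : Fin K → Fin H → (S → A → EuclideanSpace ℝ (Fin d)) × (S → EuclideanSpace ℝ (Fin d)))
    (hθ : ∀ k, θ k ∈ Q.toModelClass.models)
    (hfit : ∀ k : Fin K, ∑ i : Fin k, (∫ x, E.tv (Q.toModelClass.trans (θ k) h)
        (Q.toModelClass.trans θstar h) x.1 x.2 ∂E.visit (Q.toModelClass.trans θstar)
          ((plan (θ (Fin.castLE k.isLt.le i))).explore h).toHist h) ^ 2 ≤
      3 * (Real.log H + 3 / 2 * β)) :
    ∑ k, ∫ x, E.tv (Q.toModelClass.trans (θ k) h) (Q.toModelClass.trans θstar h) x.1 x.2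
        ∂E.visit (Q.toModelClass.trans θstar) ((plan (θ k)).explore h).toHist h ≤
      6 * H * Real.log (Real.exp 1 + K) * √(d * β * K) := by
  have hp := Q.toModelClass.trans_isTransDensity hstar
  have hH1 : (1 : ℝ) ≤ H := by exact_mod_cast hH
  have hβ0 : 0 ≤ β := by linarith
  have hℓ1 : 1 ≤ Real.log (Real.exp 1 + K) := by
    simpa using one_le_log_exp_one_add (Nat.cast_nonneg K) (le_refl (0 : ℝ))
  have hlogK : Real.log (1 + K * 1) ≤ Real.log (Real.exp 1 + K) := by
    refine Real.log_le_log (by positivity) ?_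
    have := Real.add_one_le_exp (1 : ℝ)
    linarith
  have hlogK0 : 0 ≤ Real.log (1 + K * 1) := Real.log_nonneg (by
    have : (0 : ℝ) ≤ K := Nat.cast_nonneg K
    linarith)
  set ℓ := Real.log (Real.exp 1 + K) with hℓ
  have hlogH0 : 0 ≤ Real.log H := Real.log_nonneg hH1
  obtain ⟨f, hf, hv⟩ := LowRankClass.exists_bilinear_tv hH hstar hnorm h
  choose v hv1 hv2 using fun k =>
    hv _ (Q.toModelClass.trans_isTransDensity (hθ k) h)
  have hinner : ∀ a b : EuclideanSpace ℝ (Fin d), inner ℝ a b = ∑ i, a i * b i := fun a b => by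
    rw [PiLp.inner_apply]
    exact Finset.sum_congr rfl fun i _ => by simp [mul_comm]
  have hmain := sum_le_sqrt_of_bilinear (fun k i => f (plan (θ k)) i) (fun k i => v k i)
    (fun k => ∫ x, E.tv (Q.toModelClass.trans (θ k) h) (Q.toModelClass.trans θstar h) x.1 x.2
        ∂E.visit (Q.toModelClass.trans θstar) ((plan (θ k)).explore h).toHist h)
    zero_le_one (R := 3 * (Real.log H + 3 / 2 * β)) (by positivity)
    (fun k => by
      have h1 := EuclideanSpace.real_norm_sq_eq (f (plan (θ k)))
      rw [← h1]
      exact pow_le_one₀ (norm_nonneg _) (hf _))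
    (fun k => by
      have h1 := EuclideanSpace.real_norm_sq_eq (v k)
      rw [← h1, ← Real.sq_sqrt (Nat.cast_nonneg d)]
      exact pow_le_pow_left₀ (norm_nonneg _) (hv1 k) 2)
    (fun k => by simpa only [← hinner, ← hv2] using hfit k)
    (fun k =>
      have := E.isProbabilityMeasure_visit ((plan (θ k)).explore h).toHist hp h
      E.integral_tv_le_one (Q.toModelClass.trans_isTransDensity (hθ k) h) (hp h) _)
    (fun k => by simp only [← hinner, ← hv2, le_refl])
  refine hmain.trans ?_
  have hrhs : 6 * H * ℓ * √(d * β * K) = √((6 * H * ℓ) ^ 2 * (d * β * K)) := by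
    rw [Real.sqrt_mul (sq_nonneg _), Real.sqrt_sq (by positivity)]
  rw [hrhs]
  refine Real.sqrt_le_sqrt ?_
  -- The lower bound on `β` absorbs the regularizer, and `log H ≤ H - 1` the union over steps. With
  -- the factor `2` of the potential this gives `26`, rounded up to `6 ^ 2`.
  have hR : 1 + 3 * (Real.log H + 3 / 2 * β) ≤ 13 * H * β := by
    have h1 := Real.log_le_sub_one_of_pos (show (0 : ℝ) < H by linarith)
    nlinarith [mul_nonneg (sub_nonneg.2 hH1) (sub_nonneg.2 hβ)]
  calc (1 + 3 * (Real.log H + 3 / 2 * β)) * (K * (2 * (d * Real.log (1 + K * 1))))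
      ≤ (13 * H * β) * (K * (2 * (d * ℓ))) := by gcongr
    _ = (26 * (H * ℓ)) * (d * β * K) := by ring
    _ ≤ (36 * (H * ℓ) ^ 2) * (d * β * K) := by
        have : 1 ≤ H * ℓ := by nlinarith
        gcongr ?_ * _
        nlinarith
    _ = _ := by ring

/-- Regret of optimistic planning in low-rank MDPs. -/
theorem IsExploratoryMLERun.measure_not_regret_le (hH : 1 ≤ H) (hδ : 0 < δ)
    (hstar : θstar ∈ Q.toModelClass.models) (hnorm : LowRankClass.IsNormalized E θstar)
    (hρ : IsLipschitzRisk H ρ L) (hβ : β = Real.log (Q.card / δ))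
    (run : IsExploratoryMLERun Q.toModelClass ρ β θstar plan mle θhat P X) :
    P {ω | ¬ ∀ π : HistPolicy S A H,
        ∑ k : Fin K,
          (ρ (E.returnLaw (Q.toModelClass.trans θstar) π) -
            ρ (E.returnLaw (Q.toModelClass.trans θstar)
              (plan (θhat k (past X k ω))).toHist))
        ≤ 12 * H ^ 2 * Real.log (Real.exp 1 + K) * (L * Fintype.card A * √(d * β * K))} ≤
      ENNReal.ofReal (2 * δ) := by
  -- For `δ ≥ 1 / 2` the claimed probability bound is trivial; otherwise `β ≥ log 2 > 1 / 2`, as the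
  -- potential bound requires.
  rcases le_or_gt (1 / 2) δ with hδ2 | hδ2
  · refine prob_le_one.trans ?_
    rw [← ENNReal.ofReal_one]
    exact ENNReal.ofReal_le_ofReal (by linarith)
  have hp := Q.toModelClass.trans_isTransDensity hstar
  have hL := hρ.nonneg hH
  have hN1 : (1 : ℝ) ≤ Q.card := by exact_mod_cast LowRankClass.card_pos hstar
  have hβ2 : 1 / 2 ≤ β := by
    have h1 : Real.log 2 ≤ β := by
      rw [hβ]
      refine Real.log_le_log (by norm_num) ?_
      rw [le_div_iff₀ hδ]
      linarith
    linarith [Real.log_two_gt_d9]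
  have h1 := run.measure_not_mem_confSet_le hδ hstar hβ
  have h2 := run.measure_not_sum_sq_tv_le hH hδ hstar hβ
  have h12 := (measure_union_le _ _).trans (add_le_add h1 h2)
  rw [← ENNReal.ofReal_add hδ.le hδ.le, ← two_mul] at h12
  refine le_trans (measure_mono fun ω hω => ?_) h12
  by_contra hgood
  refine hω fun π => ?_
  simp only [Set.mem_union, Set.mem_ofPred_eq, not_or, not_not] at hgood
  obtain ⟨hconf, hfit⟩ := hgood
  have hmem : ∀ k, θhat k (past X k ω) ∈ Q.toModelClass.models := fun k =>
    (run.optimistic k (past X k ω)).1.1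
  -- Optimism compares only with augmented policies, so the competitor is replaced by one with the
  -- same return law. The good event does not depend on the competitor.
  obtain ⟨π', hπ'⟩ := E.exists_augPolicy_returnLaw_eq hp π
  rw [← hπ']
  have hstep : ∀ k, ρ (E.returnLaw (Q.toModelClass.trans θstar) π'.toHist) -
      ρ (E.returnLaw (Q.toModelClass.trans θstar) (plan (θhat k (past X k ω))).toHist) ≤
      L * (2 * ∑ h, Fintype.card A * ∫ x, E.tv (Q.toModelClass.trans (θhat k (past X k ω)) h)
        (Q.toModelClass.trans θstar h) x.1 x.2 ∂E.visit (Q.toModelClass.trans θstar)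
          ((plan (θhat k (past X k ω))).explore h).toHist h) := by
    intro k
    set π₁ := plan (θhat k (past X k ω)) with hπ₁
    have hq := Q.toModelClass.trans_isTransDensity (hmem k)
    -- Optimism: the true model is a candidate, so the planned value dominates that of the
    -- competitor. What remains is the gap between two models under the same policy.
    have hopt := (run.optimistic k (past X k ω)).2 θstar (hconf k) π'
    have hlip := hρ _ _ (E.isProbabilityMeasure_returnLaw π₁.toHist hq)
      (E.isProbabilityMeasure_returnLaw π₁.toHist hp) (E.returnLaw_compl_Icc hq _)
      (E.returnLaw_compl_Icc hp _)
    have hsim := E.cdfDist_returnLaw_le π₁.toHist hp hq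
    have hexp : ∀ h, ∫ x, E.tv (Q.toModelClass.trans (θhat k (past X k ω)) h)
        (Q.toModelClass.trans θstar h) x.1 x.2 ∂E.visit (Q.toModelClass.trans θstar)
          π₁.toHist h ≤ Fintype.card A * ∫ x, E.tv (Q.toModelClass.trans (θhat k (past X k ω)) h)
        (Q.toModelClass.trans θstar h) x.1 x.2 ∂E.visit (Q.toModelClass.trans θstar)
          (π₁.explore h).toHist h := by
      intro h
      have := E.isProbabilityMeasure_visit (π₁.explore h).toHist hp h
      rw [E.integral_tv (hq h) (hp h), E.integral_tv (hq h) (hp h)]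
      have hle := E.lintegral_visit_le_explore hp π₁ h (E.measurable_l1 (hq h).1 (hp h).1)
      have hle' := ENNReal.toReal_mono (ENNReal.mul_ne_top (ENNReal.natCast_ne_top _)
        ((E.lintegral_l1_le_two (hq h) (hp h) _).trans_lt ENNReal.ofNat_lt_top).ne) hle
      rw [ENNReal.toReal_mul, ENNReal.toReal_natCast] at hle'
      linarith
    calc _ ≤ L * cdfDist (E.returnLaw (Q.toModelClass.trans (θhat k (past X k ω))) π₁.toHist)
          (E.returnLaw (Q.toModelClass.trans θstar) π₁.toHist) := by
          linarith [le_abs_self (ρ (E.returnLaw (Q.toModelClass.trans (θhat k (past X k ω)))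
            π₁.toHist) - ρ (E.returnLaw (Q.toModelClass.trans θstar) π₁.toHist))]
      _ ≤ _ := by
          refine mul_le_mul_of_nonneg_left (hsim.trans ?_) hL
          gcongr with h
          exact hexp h
  calc _ ≤ ∑ k, L * (2 * ∑ h, Fintype.card A * ∫ x, E.tv
        (Q.toModelClass.trans (θhat k (past X k ω)) h) (Q.toModelClass.trans θstar h) x.1 x.2
          ∂E.visit (Q.toModelClass.trans θstar)
            ((plan (θhat k (past X k ω))).explore h).toHist h) :=
        Finset.sum_le_sum fun k _ => hstep k
    _ = L * (2 * (Fintype.card A * ∑ h, ∑ k, ∫ x, E.tv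
        (Q.toModelClass.trans (θhat k (past X k ω)) h) (Q.toModelClass.trans θstar h) x.1 x.2
          ∂E.visit (Q.toModelClass.trans θstar)
            ((plan (θhat k (past X k ω))).explore h).toHist h)) := by
        simp only [← Finset.mul_sum]
        rw [Finset.sum_comm]
    _ ≤ L * (2 * (Fintype.card A * ∑ _h : Fin H,
          6 * H * Real.log (Real.exp 1 + K) * √(d * β * K))) := by
        gcongr with h
        exact LowRankClass.sum_tv_explore_le hH hstar hnorm h hβ2
          (fun k => θhat k (past X k ω)) hmem (hfit h)
    _ = _ := by
        simp only [Finset.sum_const, Finset.card_univ, Fintype.card_fin, nsmul_eq_mul]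
        ring

end LowRankRegret

end RSDisRL

/-! ### The theorem -/

open MeasureTheory ProbabilityTheory RSDisRL in
theorem theorem4 :
    ∃ (C : ℝ) (c : ℕ),
      -- Q-type witness rank: concentration and general elliptical potential
      (∀ (S A Par Ω : Type*) [MeasurableSpace S] [MeasurableSpace A] [MeasurableSpace Ω]
        (H K : ℕ) (E : Env S A H) (M : ModelClass E Par) (θstar : Fin H → Par)
        (ρ : Measure ℝ → ℝ) (L δ : ℝ) (plan : (Fin H → Par) → AugPolicy S A H)
        (mle θhat : (k : Fin K) → (Fin k → Traj S A H) → Fin H → Par)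
        (P : Measure Ω) [IsProbabilityMeasure P] (X : Fin K → Ω → Traj S A H),
        1 ≤ H → 1 ≤ K → 0 < δ → δ ≤ 1 →
        θstar ∈ M.models →
        IsLipschitzRisk H ρ L →
        (∃ n, M.HasBracketing (1 / K) n) →
        IsMLERun M ρ (betaMLE H K (M.bracketingNumber (1 / K)) δ) θstar plan mle θhat P X →
        P {ω | ¬ ∀ k : Fin K, θstar ∈ M.confSet (betaMLE H K (M.bracketingNumber (1 / K)) δ)
              (past X k ω) (mle k (past X k ω))} ≤ ENNReal.ofReal δ ∧
        ∀ (d : ℕ) (α B : ℝ), 0 < α → M.WitnessRank θstar plan d α B →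
          P {ω | ¬ ∑ k : Fin K,
              cdfDist
                (E.returnLaw (M.trans (θhat k (past X k ω)))
                  (plan (θhat k (past X k ω))).toHist)
                (E.returnLaw (M.trans θstar) (plan (θhat k (past X k ω))).toHist)
              ≤ C * H ^ c * Real.log (Real.exp 1 + K + B) ^ c *
                  (α * √(K * d * betaMLE H K (M.bracketingNumber (1 / K)) δ))}
            ≤ ENNReal.ofReal δ) ∧
      -- V-type variant: concentration and regret in low-rank MDPs
      (∀ (S A Ω : Type*) [MeasurableSpace S] [MeasurableSpace A] [Fintype A] [Nonempty A]
        [MeasurableSingletonClass A] [MeasurableSpace Ω]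
        (H K d : ℕ) (E : Env S A H) (Q : LowRankClass E d)
        (θstar : Fin H → (S → A → EuclideanSpace ℝ (Fin d)) × (S → EuclideanSpace ℝ (Fin d)))
        (ρ : Measure ℝ → ℝ) (L δ β : ℝ)
        (plan : (Fin H → (S → A → EuclideanSpace ℝ (Fin d)) × (S → EuclideanSpace ℝ (Fin d))) →
          AugPolicy S A H)
        (mle θhat : (k : Fin K) → (Fin k → Fin H → Traj S A H) →
          Fin H → (S → A → EuclideanSpace ℝ (Fin d)) × (S → EuclideanSpace ℝ (Fin d)))
        (P : Measure Ω) [IsProbabilityMeasure P] (X : Fin K → Ω → (Fin H → Traj S A H)),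
        1 ≤ H → 1 ≤ K → 0 < δ → δ ≤ 1 →
        θstar ∈ Q.toModelClass.models →
        LowRankClass.IsNormalized E θstar →
        IsLipschitzRisk H ρ L →
        β = Real.log (Q.card / δ) →
        IsExploratoryMLERun Q.toModelClass ρ β θstar plan mle θhat P X →
        P {ω | ¬ ∀ k : Fin K, θstar ∈ Q.toModelClass.confSet β
              (flatten (past X k ω)) (mle k (past X k ω))} ≤ ENNReal.ofReal δ ∧
        P {ω | ¬ ∀ π : HistPolicy S A H,
            ∑ k : Fin K,
              (ρ (E.returnLaw (Q.toModelClass.trans θstar) π) -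
                ρ (E.returnLaw (Q.toModelClass.trans θstar)
                  (plan (θhat k (past X k ω))).toHist))
            ≤ C * H ^ c * Real.log (Real.exp 1 + K) ^ c *
                (L * Fintype.card A * √(d * β * K))}
          ≤ ENNReal.ofReal (2 * δ)) := by
  -- The witness rank bound has `20 * H` and one logarithm, the low-rank bound `12 * H ^ 2` and one
  -- logarithm; powers are raised to `2` because `H` and the logarithms are at least `1`.
  refine ⟨20, 2, ?_, ?_⟩
  · intro S A Par Ω _ _ _ H K E M θstar ρ L δ plan mle θhat P _ X hH hK hδ hδ1 hstar _ hbr run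
    refine ⟨run.measure_not_mem_confSet_le hH hK hδ hδ1 hstar hbr, fun d α B hα hwit => ?_⟩
    refine le_trans (measure_mono fun ω hω => ?_)
      (run.measure_not_sum_cdfDist_le hH hK hδ hδ1 hstar hbr hα hwit)
    intro hle
    refine hω (hle.trans ?_)
    have hℓ := one_le_log_exp_one_add (Nat.cast_nonneg K) (hwit.bound_nonneg hH hstar)
    have hH1 : (1 : ℝ) ≤ H := by exact_mod_cast hH
    gcongr
    · exact le_self_pow₀ hH1 two_ne_zero
    · exact le_self_pow₀ hℓ two_ne_zero
  · intro S A Ω _ _ _ _ _ _ H K d E Q θstar ρ L δ β plan mle θhat P _ X hH _ hδ _ hstar hnorm hρ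
      hβ run
    refine ⟨run.measure_not_mem_confSet_le hδ hstar hβ, ?_⟩
    refine le_trans (measure_mono fun ω hω => ?_)
      (run.measure_not_regret_le hH hδ hstar hnorm hρ hβ)
    intro hle
    refine hω fun π => (hle π).trans ?_
    have hL := hρ.nonneg hH
    have hℓ : 1 ≤ Real.log (Real.exp 1 + K) := by
      simpa using one_le_log_exp_one_add (Nat.cast_nonneg K) (le_refl (0 : ℝ))
    gcongr
    · norm_num
    · exact le_self_pow₀ hℓ two_ne_zero
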